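/- Let $N\ge 0$. An \emph{orthant of rank $k$} in $\mathbb Z^N$ is a set $a+\langle Y\rangle$, where $a\in\mathbb Z^N$ and $\langle Y\rangle$ is the monoid generated by a set $Y$ of $k$ vectors $\pm e_i$ with pairwise different indices $i$. A set $S\subseteq\mathbb Z^N$ is \emph{orthohedral} if it is a finite union of orthants; for $S\ne\emptyset$ its rank $\mathrm{rk}\,S$ is the maximal rank of an orthant contained in $S$, and we put $\mathrm{rk}\,\emptyset=0$. The group $\mathrm{pei}(S)$ consists of all permutations $g$ of $\mathbb Z^N$ that fix every point outside $S$ and for which $\mathbb Z^N$ is a disjoint union of finitely many orthants on each of which $g$ restricts to an isometric embedding (for the Euclidean metric). The support $\mathrm{supp}(g)$ is the union of all orthants on which $g$ restricts to an isometric embedding different from the identity, and for $k\ge 0$ the \emph{rank group} is $G_k(S)=\{g\in\mathrm{pei}(S)\mid \mathrm{rk}(\mathrm{supp}(g))\le k\}$. Let $S\subseteq\mathbb Z^N$ be orthohedral. Then the following holds. 1. $\mathrm{pei}(S)$ satisfies the maximal condition for normal subgroups. 2. Each $G_k(S)$ is a normal subgroup of $\mathrm{pei}(S)$, and these subgroups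 are determined by the group structure: if $T\subseteq\mathbb Z^M$ is orthohedral and $\varphi:\mathrm{pei}(S)\to\mathrm{pei}(T)$ is an isomorphism of groups, then $\varphi(G_k(S))=G_k(T)$ for all $k\ge 0$; moreover $\mathrm{rk}\,S=\mathrm{rk}\,T$ if $S$ and $T$ are non-empty. 3. Suppose that $S$ has at least two points and is not the union of a rank-1 orthant and a finite set. Then the poly-(Abelian-by-locally-finite) length of $\mathrm{pei}(S)$ is $\mathrm{rk}\,S+1$; that is, $\mathrm{rk}\,S+1$ is the minimal length $m$ of a series $1=H_0\le H_1\le\dots\le H_m=\mathrm{pei}(S)$ of normal subgroups of $\mathrm{pei}(S)$ such that each factor $H_{i+1}/H_i$ has an Abelian normal subgroup with locally finite quotient. The minimum over all subnormal series with such factors is $\mathrm{rk}\,S+1$ as well. -/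

import Mathlib

namespace PEI

/-- The orthant of `ℤ^N` based at `a` whose canonical basis consists of the vectors
`σ i • e i` for the coordinates `i` with `σ i ≠ 0`. -/
def orthant {N : ℕ} (a : Fin N → ℤ) (σ : Fin N → SignType) : Set (Fin N → ℤ) :=
  {x | ∀ i, ∃ n : ℕ, x i = a i + (σ i : ℤ) * n}

/-- `L` is an integral orthant of rank `k`. -/
def IsOrthantOfRank {N : ℕ} (L : Set (Fin N → ℤ)) (k : ℕ) : Prop :=
  ∃ (a : Fin N → ℤ) (σ : Fin N → SignType),
    (Finset.univ.filter fun i => σ i ≠ 0).card = k ∧ L = orthant a σ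

/-- `L` is an integral orthant (of some rank). -/
def IsOrthant {N : ℕ} (L : Set (Fin N → ℤ)) : Prop := ∃ k, IsOrthantOfRank L k

/-- Orthohedral sets: finite unions of orthants. -/
def IsOrthohedral {N : ℕ} (S : Set (Fin N → ℤ)) : Prop :=
  ∃ Λ : Set (Set (Fin N → ℤ)), Λ.Finite ∧ (∀ L ∈ Λ, IsOrthant L) ∧ ⋃₀ Λ = S

/-- The rank of a nonempty set: the maximal rank of an orthant contained in it
(bounded by `N`; the value at the empty set is `0`). -/
noncomputable def rk {N : ℕ} (S : Set (Fin N → ℤ)) : ℕ :=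
  sSup {k | ∃ L, IsOrthantOfRank L k ∧ L ⊆ S}

/-- The squared Euclidean distance. -/
def sqDist {N : ℕ} (x y : Fin N → ℤ) : ℤ := ∑ i, (x i - y i) ^ 2

/-- The restriction of `f` to `L` is an isometric embedding for the Euclidean metric. -/
def IsometricOn {N : ℕ} (f : (Fin N → ℤ) → (Fin N → ℤ)) (L : Set (Fin N → ℤ)) : Prop :=
  ∀ x ∈ L, ∀ y ∈ L, sqDist (f x) (f y) = sqDist x y

/-- `g` is a piecewise Euclidean isometric map of `ℤ^N`. -/
def IsPei {N : ℕ} (g : (Fin N → ℤ) → (Fin N → ℤ)) : Prop :=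
  ∃ Λ : Set (Set (Fin N → ℤ)), Λ.Finite ∧ (∀ L ∈ Λ, IsOrthant L) ∧ Λ.PairwiseDisjoint id ∧
    ⋃₀ Λ = Set.univ ∧ ∀ L ∈ Λ, IsometricOn g L

/-! ### Closure properties: the pei-permutations form a group -/

theorem isOrthant_orthant {N : ℕ} (a : Fin N → ℤ) (σ : Fin N → SignType) :
    IsOrthant (orthant a σ) := ⟨_, a, σ, rfl, rfl⟩

theorem line_inter (a b : ℤ) (s t : SignType) :
    ∃ P : Finset (ℤ × SignType),
      (∀ z : ℤ, ((∃ n : ℕ, z = a + (s : ℤ) * n) ∧ (∃ n : ℕ, z = b + (t : ℤ) * n)) ↔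
        ∃ p ∈ P, ∃ n : ℕ, z = p.1 + (p.2 : ℤ) * n) ∧
      ∀ p ∈ P, ∀ q ∈ P, ∀ z : ℤ, (∃ n : ℕ, z = p.1 + (p.2 : ℤ) * n) →
        (∃ n : ℕ, z = q.1 + (q.2 : ℤ) * n) → p = q := by
  have pos : ∀ c z : ℤ, (∃ n : ℕ, z = c + ((1 : SignType) : ℤ) * n) ↔ c ≤ z := by
    intro c z
    constructor
    · rintro ⟨n, rfl⟩; simp
    · intro h; exact ⟨(z - c).toNat, by simp; omega⟩
  have neg : ∀ c z : ℤ, (∃ n : ℕ, z = c + ((-1 : SignType) : ℤ) * n) ↔ z ≤ c := by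
    intro c z
    constructor
    · rintro ⟨n, rfl⟩; simp
    · intro h; exact ⟨(c - z).toNat, by simp; omega⟩
  have zer : ∀ c z : ℤ, (∃ n : ℕ, z = c + ((0 : SignType) : ℤ) * n) ↔ z = c := by
    intro c z; simp
  have single : ∀ (p : ℤ × SignType) (R : ℤ → Prop),
      (∀ z, R z ↔ ∃ n : ℕ, z = p.1 + (p.2 : ℤ) * n) →
      ∃ P : Finset (ℤ × SignType),
      (∀ z : ℤ, R z ↔ ∃ p ∈ P, ∃ n : ℕ, z = p.1 + (p.2 : ℤ) * n) ∧
      ∀ p ∈ P, ∀ q ∈ P, ∀ z : ℤ, (∃ n : ℕ, z = p.1 + (p.2 : ℤ) * n) →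
        (∃ n : ℕ, z = q.1 + (q.2 : ℤ) * n) → p = q := by
    intro p R h
    refine ⟨{p}, fun z => ?_, ?_⟩
    · rw [h]; simp
    · intro x hx y hy _ _ _
      rw [Finset.mem_singleton] at hx hy
      rw [hx, hy]
  have points : ∀ (F : Finset ℤ) (R : ℤ → Prop), (∀ z, R z ↔ z ∈ F) →
      ∃ P : Finset (ℤ × SignType),
      (∀ z : ℤ, R z ↔ ∃ p ∈ P, ∃ n : ℕ, z = p.1 + (p.2 : ℤ) * n) ∧
      ∀ p ∈ P, ∀ q ∈ P, ∀ z : ℤ, (∃ n : ℕ, z = p.1 + (p.2 : ℤ) * n) →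
        (∃ n : ℕ, z = q.1 + (q.2 : ℤ) * n) → p = q := by
    intro F R h
    refine ⟨F.image fun c => (c, 0), fun z => ?_, ?_⟩
    · rw [h]; simp
    · intro x hx y hy z h1 h2
      rw [Finset.mem_image] at hx hy
      obtain ⟨c, -, rfl⟩ := hx
      obtain ⟨d, -, rfl⟩ := hy
      rw [zer] at h1 h2
      simp only at h1 h2
      rw [← h1, ← h2]
  rcases s.trichotomy with rfl | rfl | rfl <;> rcases t.trichotomy with rfl | rfl | rfl
  · exact single (min a b, -1) _ fun z => by simp only [neg]; omega
  · exact points (if b ≤ a then {b} else ∅) _ fun z => by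
      simp only [neg, zer]; split_ifs <;> simp <;> omega
  · exact points (Finset.Icc b a) _ fun z => by simp only [neg, pos, Finset.mem_Icc]; omega
  · exact points (if a ≤ b then {a} else ∅) _ fun z => by
      simp only [neg, zer]; split_ifs <;> simp <;> omega
  · exact points (if a = b then {a} else ∅) _ fun z => by
      simp only [zer]; split_ifs with h
      · simp [h]
      · simp; omega
  · exact points (if b ≤ a then {a} else ∅) _ fun z => by
      simp only [pos, zer]; split_ifs <;> simp <;> omega
  · exact points (Finset.Icc a b) _ fun z => by simp only [neg, pos, Finset.mem_Icc]
  · exact points (if a ≤ b then {b} else ∅) _ fun z => by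
      simp only [pos, zer]; split_ifs <;> simp <;> omega
  · exact single (max a b, 1) _ fun z => by simp only [pos]; omega

theorem inter_orthants {N : ℕ} {L M : Set (Fin N → ℤ)} (hL : IsOrthant L) (hM : IsOrthant M) :
    ∃ Λ : Set (Set (Fin N → ℤ)), Λ.Finite ∧ (∀ K ∈ Λ, IsOrthant K) ∧ Λ.PairwiseDisjoint id ∧
      ⋃₀ Λ = L ∩ M := by
  obtain ⟨_, a, s, -, rfl⟩ := hL
  obtain ⟨_, b, t, -, rfl⟩ := hM
  choose P hP hd using fun i => line_inter (a i) (b i) (s i) (t i)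
  refine ⟨(fun p : Fin N → ℤ × SignType => orthant (fun i => (p i).1) (fun i => (p i).2)) ''
    (Fintype.piFinset P : Set _), (Finset.finite_toSet _).image _, ?_, ?_, ?_⟩
  · rintro _ ⟨p, -, rfl⟩
    exact isOrthant_orthant _ _
  · rintro _ ⟨p, hp, rfl⟩ _ ⟨q, hq, rfl⟩ hne
    refine Set.disjoint_left.2 fun x hx hy => hne ?_
    have : p = q := by
      funext i
      exact hd i _ (Fintype.mem_piFinset.1 hp i) _ (Fintype.mem_piFinset.1 hq i) (x i)
        (hx i) (hy i)
    rw [this]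
  · ext x
    constructor
    · rintro ⟨_, ⟨p, hp, rfl⟩, hx⟩
      have := fun i => (hP i (x i)).2 ⟨p i, Fintype.mem_piFinset.1 hp i, hx i⟩
      exact ⟨fun i => (this i).1, fun i => (this i).2⟩
    · rintro ⟨h1, h2⟩
      choose p hp hx using fun i => (hP i (x i)).1 ⟨h1 i, h2 i⟩
      exact ⟨_, ⟨p, Fintype.mem_piFinset.2 hp, rfl⟩, hx⟩

theorem unit_vector {N : ℕ} (v : Fin N → ℤ) (h : ∑ i, v i ^ 2 = 1) :
    ∃ (j : Fin N) (e : SignType), e ≠ 0 ∧ v = Pi.single j (e : ℤ) := by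
  have hne : ∃ j, v j ≠ 0 := by
    by_contra! h0
    simp [h0] at h
  obtain ⟨j, hj⟩ := hne
  have hsum := Finset.add_sum_erase Finset.univ (fun i => v i ^ 2) (Finset.mem_univ j)
  rw [h] at hsum
  have hnn : 0 ≤ ∑ i ∈ Finset.univ.erase j, v i ^ 2 := Finset.sum_nonneg fun i _ => sq_nonneg _
  have hj1 : 1 ≤ v j ^ 2 := by
    have := sq_pos_of_ne_zero hj
    omega
  have hj2 : v j ^ 2 = 1 := by omega
  have hz : ∑ i ∈ Finset.univ.erase j, v i ^ 2 = 0 := by omega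
  have hz' := (Finset.sum_eq_zero_iff_of_nonneg fun i _ => sq_nonneg _).1 hz
  refine ⟨j, SignType.sign (v j), by simpa using hj, ?_⟩
  funext i
  by_cases hij : i = j
  · subst hij
    rw [Pi.single_eq_same]
    have hj3 : v i = 1 ∨ v i = -1 := by simpa using hj2
    rcases hj3 with h | h <;> simp [h]
  · rw [Pi.single_eq_of_ne hij]
    simpa using hz' i (Finset.mem_erase.2 ⟨hij, Finset.mem_univ _⟩)

theorem image_orthant {N : ℕ} {f : (Fin N → ℤ) → (Fin N → ℤ)} {L : Set (Fin N → ℤ)}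
    (hL : IsOrthant L) (hf : IsometricOn f L) : IsOrthant (f '' L) := by
  obtain ⟨_, a, σ, -, rfl⟩ := hL
  have ha : a ∈ orthant a σ := fun i => ⟨0, by simp⟩
  have pol : ∀ x ∈ orthant a σ, ∀ y ∈ orthant a σ,
      ∑ j, (f x j - f a j) * (f y j - f a j) = ∑ j, (x j - a j) * (y j - a j) := by
    intro x hx y hy
    have h1 := hf x hx y hy
    have h2 := hf x hx a ha
    have h3 := hf y hy a ha
    have key : ∀ u v w : Fin N → ℤ,
        2 * ∑ j, (u j - w j) * (v j - w j) = sqDist u w + sqDist v w - sqDist u v := by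
      intro u v w
      simp only [sqDist]
      rw [Finset.mul_sum, ← Finset.sum_add_distrib, ← Finset.sum_sub_distrib]
      exact Finset.sum_congr rfl fun j _ => by ring
    have k1 := key (f x) (f y) (f a)
    have k2 := key x y a
    omega
  have hE : ∀ i, a + Pi.single i (σ i : ℤ) ∈ orthant a σ := by
    intro i j
    by_cases h : j = i
    · subst h; exact ⟨1, by simp⟩
    · exact ⟨0, by simp [h]⟩
  have hpair : ∀ i, ∀ x ∈ orthant a σ,
      ∑ j, (f x j - f a j) * (f (a + Pi.single i (σ i : ℤ)) j - f a j)
        = (x i - a i) * (σ i : ℤ) := by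
    intro i x hx
    rw [pol x hx _ (hE i)]
    rw [Finset.sum_eq_single i]
    · simp
    · intro j _ hj; simp [hj]
    · simp
  have hsq : ∀ s : SignType, s ≠ 0 → (s : ℤ) * s = 1 := by decide
  have hv : ∀ i : {i // σ i ≠ 0}, ∃ (j : Fin N) (e : SignType), e ≠ 0 ∧
      (fun j => f (a + Pi.single i.1 (σ i.1 : ℤ)) j - f a j) = Pi.single j (e : ℤ) := by
    intro i
    apply unit_vector
    have := hpair i.1 _ (hE i.1)
    simp only [Pi.add_apply, Pi.single_eq_same, add_sub_cancel_left, hsq _ i.2] at this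
    rw [← this]
    exact Finset.sum_congr rfl fun j _ => by ring
  choose π e he hπ using hv
  have coord : ∀ i : {i // σ i ≠ 0}, ∀ x ∈ orthant a σ,
      (f x (π i) - f a (π i)) * (e i : ℤ) = (x i.1 - a i.1) * (σ i.1 : ℤ) := by
    intro i x hx
    rw [← hpair i.1 x hx, Finset.sum_eq_single (π i)]
    · rw [congrFun (hπ i) (π i), Pi.single_eq_same]
    · intro j _ hj
      rw [congrFun (hπ i) j, Pi.single_eq_of_ne hj, mul_zero]
    · simp
  have inj : Function.Injective π := by
    intro i k hik
    by_contra hne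
    have h1 := coord i _ (hE k.1)
    have hik' : i.1 ≠ k.1 := fun h => hne (Subtype.ext h)
    rw [congrFun (hπ k) (π i), hik, Pi.single_eq_same] at h1
    simp only [Pi.add_apply, Pi.single_eq_of_ne hik', add_zero, sub_self, zero_mul] at h1
    have h2 := he i
    have h3 := he k
    revert h1 h2 h3
    generalize e i = s
    generalize e k = t
    revert s t
    decide
  have off : ∀ x ∈ orthant a σ, ∀ j, (∀ i, π i ≠ j) → f x j = f a j := by
    intro x hx j hj
    have h1 := pol x hx x hx
    have h2 : ∑ i, (x i - a i) * (x i - a i)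
        = ∑ i : {i // σ i ≠ 0}, (x i.1 - a i.1) * (x i.1 - a i.1) := by
      rw [← Finset.sum_subtype (Finset.univ.filter fun i => σ i ≠ 0) (by simp)
        (fun i => (x i - a i) * (x i - a i)), Finset.sum_filter_of_ne]
      intro i _ hne h0
      obtain ⟨n, hn⟩ := hx i
      exact hne (by simp [hn, h0])
    have h3 : ∑ i : {i // σ i ≠ 0}, (x i.1 - a i.1) * (x i.1 - a i.1)
        = ∑ k ∈ Finset.univ.image π, (f x k - f a k) * (f x k - f a k) := by
      rw [Finset.sum_image fun _ _ _ _ h => inj h]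
      refine Finset.sum_congr rfl fun i _ => ?_
      have c := coord i x hx
      calc (x i.1 - a i.1) * (x i.1 - a i.1)
          = ((x i.1 - a i.1) * (σ i.1 : ℤ)) * ((x i.1 - a i.1) * (σ i.1 : ℤ)) := by
            rw [mul_mul_mul_comm, hsq _ i.2, mul_one]
        _ = _ := by rw [← c, mul_mul_mul_comm, hsq _ (he i), mul_one]
    have h4 := Finset.sum_add_sum_compl (Finset.univ.image π)
      (fun k => (f x k - f a k) * (f x k - f a k))
    have h5 : ∑ k ∈ (Finset.univ.image π)ᶜ, (f x k - f a k) * (f x k - f a k) = 0 := by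
      linarith
    have h6 := (Finset.sum_eq_zero_iff_of_nonneg fun k _ => mul_self_nonneg _).1 h5 j (by
      simpa using fun i hi => hj ⟨i, hi⟩)
    have := mul_self_eq_zero.1 h6
    linarith
  classical
  let τ : Fin N → SignType := fun j => if h : ∃ i, π i = j then e h.choose else 0
  have τπ : ∀ i, τ (π i) = e i := by
    intro i
    have h : ∃ k, π k = π i := ⟨i, rfl⟩
    simp only [τ, dif_pos h]
    rw [inj h.choose_spec]
  have τoff : ∀ j, (∀ i, π i ≠ j) → τ j = 0 := by
    intro j hj
    simp only [τ]
    rw [dif_neg]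
    rintro ⟨i, hi⟩
    exact hj i hi
  have solve : ∀ i : {i // σ i ≠ 0}, ∀ x ∈ orthant a σ, ∀ n : ℕ,
      x i.1 = a i.1 + (σ i.1 : ℤ) * n → f x (π i) = f a (π i) + (e i : ℤ) * n := by
    intro i x hx n hn
    have c := coord i x hx
    have c2 : (f x (π i) - f a (π i)) * (e i : ℤ) = n := by
      rw [c, hn]
      calc (a i.1 + (σ i.1 : ℤ) * n - a i.1) * (σ i.1 : ℤ)
          = ((σ i.1 : ℤ) * σ i.1) * n := by ring
        _ = n := by rw [hsq _ i.2, one_mul]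
    calc f x (π i) = f a (π i) + (f x (π i) - f a (π i)) * ((e i : ℤ) * e i) := by
          rw [hsq _ (he i)]; ring
      _ = f a (π i) + (e i : ℤ) * ((f x (π i) - f a (π i)) * (e i : ℤ)) := by ring
      _ = _ := by rw [c2]
  have : f '' orthant a σ = orthant (f a) τ := by
    ext y
    constructor
    · rintro ⟨x, hx, rfl⟩ j
      by_cases hj : ∃ i, π i = j
      · obtain ⟨i, rfl⟩ := hj
        obtain ⟨n, hn⟩ := hx i.1
        exact ⟨n, by rw [τπ, solve i x hx n hn]⟩
      · push Not at hj
        exact ⟨0, by rw [off x hx j hj]; simp⟩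
    · intro hy
      choose n hn using hy
      let x : Fin N → ℤ := fun i =>
        if h : σ i ≠ 0 then a i + (σ i : ℤ) * n (π ⟨i, h⟩) else a i
      have hx : x ∈ orthant a σ := by
        intro i
        by_cases h : σ i ≠ 0
        · exact ⟨n (π ⟨i, h⟩), by simp only [x, dif_pos h]⟩
        · exact ⟨0, by simp only [x, dif_neg h]; simp⟩
      refine ⟨x, hx, ?_⟩
      funext j
      by_cases hj : ∃ i, π i = j
      · obtain ⟨i, rfl⟩ := hj
        rw [solve i x hx (n (π i)) (by simp only [x, dif_pos i.2]), hn, τπ]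
      · push Not at hj
        rw [off x hx j hj, hn, τoff j hj]
        simp
  rw [this]
  exact isOrthant_orthant _ _

theorem IsPei.inv {N : ℕ} {g : Equiv.Perm (Fin N → ℤ)} (hg : IsPei g) :
    IsPei (g⁻¹ : Equiv.Perm (Fin N → ℤ)) := by
  obtain ⟨Λ, hfin, hor, hdis, hcov, hiso⟩ := hg
  refine ⟨(fun L => g '' L) '' Λ, hfin.image _, ?_, ?_, ?_, ?_⟩
  · rintro _ ⟨L, hL, rfl⟩
    exact image_orthant (hor L hL) (hiso L hL)
  · rintro _ ⟨L, hL, rfl⟩ _ ⟨M, hM, rfl⟩ hne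
    have hLM : L ≠ M := fun h => hne (by rw [h])
    exact (Set.disjoint_image_iff g.injective).2 (hdis hL hM hLM)
  · rw [Set.eq_univ_iff_forall]
    intro y
    obtain ⟨L, hL, hy⟩ := (Set.eq_univ_iff_forall.1 hcov) (g⁻¹ y)
    exact ⟨_, ⟨L, hL, rfl⟩, ⟨_, hy, by simp⟩⟩
  · rintro _ ⟨L, hL, rfl⟩ _ ⟨x, hx, rfl⟩ _ ⟨y, hy, rfl⟩
    simpa using (hiso L hL x hx y hy).symm

theorem IsPei.mul {N : ℕ} {f g : Equiv.Perm (Fin N → ℤ)} (hf : IsPei f) (hg : IsPei g) :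
    IsPei (f * g : Equiv.Perm (Fin N → ℤ)) := by
  obtain ⟨Φ, hfin, hor, hdis, hcov, hiso⟩ := hf
  obtain ⟨Λ, hfin', hor', hdis', hcov', hiso'⟩ := hg
  have hI : ∀ L M, ∃ Δ : Set (Set (Fin N → ℤ)), L ∈ Λ → M ∈ Φ →
      Δ.Finite ∧ (∀ K ∈ Δ, IsOrthant K) ∧ Δ.PairwiseDisjoint id ∧ ⋃₀ Δ = g '' L ∩ M := by
    intro L M
    by_cases h : L ∈ Λ ∧ M ∈ Φ
    · obtain ⟨Δ, hΔ⟩ := inter_orthants (image_orthant (hor' L h.1) (hiso' L h.1)) (hor M h.2)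
      exact ⟨Δ, fun _ _ => hΔ⟩
    · exact ⟨∅, fun h1 h2 => absurd ⟨h1, h2⟩ h⟩
  choose Δ hΔ using hI
  have hsub : ∀ L ∈ Λ, ∀ M ∈ Φ, ∀ K ∈ Δ L M, K ⊆ g '' L ∩ M := fun L hL M hM K hK => by
    rw [← (hΔ L M hL hM).2.2.2]
    exact Set.subset_sUnion_of_mem hK
  refine ⟨⋃ L ∈ Λ, ⋃ M ∈ Φ, (fun K => g ⁻¹' K) '' Δ L M, ?_, ?_, ?_, ?_, ?_⟩
  · exact hfin'.biUnion fun L hL => hfin.biUnion fun M hM => (hΔ L M hL hM).1.image _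
  · intro K' hK'
    simp only [Set.mem_iUnion] at hK'
    obtain ⟨L, hL, M, hM, K, hK, rfl⟩ := hK'
    have h1 : g ⁻¹' K = (g⁻¹ : Equiv.Perm (Fin N → ℤ)) '' K :=
      (Equiv.image_symm_eq_preimage g K).symm
    simp only [h1]
    refine image_orthant ((hΔ L M hL hM).2.1 K hK) fun x hx y hy => ?_
    obtain ⟨x', hx', rfl⟩ := (hsub L hL M hM K hK hx).1
    obtain ⟨y', hy', rfl⟩ := (hsub L hL M hM K hK hy).1
    simpa using (hiso' L hL x' hx' y' hy').symm
  · intro K₁ h₁ K₂ h₂ hne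
    simp only [Set.mem_iUnion] at h₁ h₂
    obtain ⟨L₁, hL₁, M₁, hM₁, K₁, hK₁, rfl⟩ := h₁
    obtain ⟨L₂, hL₂, M₂, hM₂, K₂, hK₂, rfl⟩ := h₂
    refine Set.disjoint_left.2 fun x hx1 hx2 => hne ?_
    have s1 := hsub L₁ hL₁ M₁ hM₁ K₁ hK₁ hx1
    have s2 := hsub L₂ hL₂ M₂ hM₂ K₂ hK₂ hx2
    have eL : L₁ = L₂ := hdis'.elim_set hL₁ hL₂ x
      (by simpa using s1.1) (by simpa using s2.1)
    have eM : M₁ = M₂ := hdis.elim_set hM₁ hM₂ (g x) s1.2 s2.2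
    subst eL eM
    have eK : K₁ = K₂ := (hΔ _ _ hL₁ hM₁).2.2.1.elim_set hK₁ hK₂ (g x) hx1 hx2
    rw [eK]
  · rw [Set.eq_univ_iff_forall]
    intro x
    obtain ⟨L, hL, hx⟩ := (Set.eq_univ_iff_forall.1 hcov') x
    obtain ⟨M, hM, hy⟩ := (Set.eq_univ_iff_forall.1 hcov) (g x)
    have : g x ∈ ⋃₀ Δ L M := by
      rw [(hΔ L M hL hM).2.2.2]
      exact ⟨⟨x, hx, rfl⟩, hy⟩
    obtain ⟨K, hK, hxK⟩ := this
    refine ⟨g ⁻¹' K, ?_, hxK⟩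
    simp only [Set.mem_iUnion]
    exact ⟨L, hL, M, hM, K, hK, rfl⟩
  · intro K' hK' x hx y hy
    simp only [Set.mem_iUnion] at hK'
    obtain ⟨L, hL, M, hM, K, hK, rfl⟩ := hK'
    have sx := hsub L hL M hM K hK hx
    have sy := hsub L hL M hM K hK hy
    rw [Equiv.Perm.mul_apply, Equiv.Perm.mul_apply, hiso M hM _ sx.2 _ sy.2]
    exact hiso' L hL x (by simpa using sx.1) y (by simpa using sy.1)

theorem isPei_one {N : ℕ} : IsPei ((1 : Equiv.Perm (Fin N → ℤ)) : (Fin N → ℤ) → (Fin N → ℤ)) := by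
  refine ⟨(fun s : Fin N → Bool => orthant (fun i => if s i then 0 else -1)
    (fun i => if s i then 1 else -1)) '' Set.univ, Set.finite_univ.image _, ?_, ?_, ?_, ?_⟩
  · rintro _ ⟨s, -, rfl⟩
    exact isOrthant_orthant _ _
  · rintro _ ⟨s, -, rfl⟩ _ ⟨t, -, rfl⟩ hne
    refine Set.disjoint_left.2 fun x hx hy => hne ?_
    have : s = t := by
      funext i
      obtain ⟨n, hn⟩ := hx i
      obtain ⟨m, hm⟩ := hy i
      cases hs : s i <;> cases ht : t i <;> simp [hs, ht] at hn hm ⊢ <;> omega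
    rw [this]
  · rw [Set.eq_univ_iff_forall]
    intro x
    refine ⟨_, ⟨fun i => decide (0 ≤ x i), trivial, rfl⟩, fun i => ?_⟩
    by_cases h : 0 ≤ x i
    · exact ⟨(x i).toNat, by simp [h]⟩
    · exact ⟨(-1 - x i).toNat, by simp [h]; omega⟩
  · intro L _ x _ y _
    rfl

/-- The group `pei(S)` of pei-permutations of `S`, each extended by the identity to `ℤ^N`. -/
def pei {N : ℕ} (S : Set (Fin N → ℤ)) : Subgroup (Equiv.Perm (Fin N → ℤ)) where
  carrier := {g | IsPei g ∧ ∀ x ∉ S, g x = x}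
  mul_mem' := fun ha hb => ⟨ha.1.mul hb.1, fun x hx => by
    rw [Equiv.Perm.mul_apply, hb.2 x hx, ha.2 x hx]⟩
  one_mem' := ⟨isPei_one, fun _ _ => rfl⟩
  inv_mem' := fun ha => ⟨ha.1.inv, fun x hx => by
    rw [Equiv.Perm.inv_eq_iff_eq, ha.2 x hx]⟩

/-- The support of `g`: the union of all orthants on which `g` restricts to an isometric
embedding different from the identity. -/
def supp {N : ℕ} (g : Equiv.Perm (Fin N → ℤ)) : Set (Fin N → ℤ) :=
  ⋃₀ {L | IsOrthant L ∧ IsometricOn g L ∧ ∃ x ∈ L, g x ≠ x}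

/-- The rank group `G_k` of `pei(S)`: the elements of rank at most `k`. -/
def rankGroup {N : ℕ} (S : Set (Fin N → ℤ)) (k : ℕ) : Set (pei S) :=
  {g | rk (supp (g : Equiv.Perm (Fin N → ℤ))) ≤ k}

/-- Every finitely generated subgroup is finite. -/
def IsLocallyFiniteGroup (G : Type*) [Group G] : Prop :=
  ∀ H : Subgroup G, H.FG → Finite H

/-- `G` has an Abelian normal subgroup with locally finite factor group. -/
def IsAbelianByLocallyFinite (G : Type*) [Group G] : Prop :=
  ∃ (A : Subgroup G) (_ : A.Normal), (∀ x ∈ A, ∀ y ∈ A, x * y = y * x) ∧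
    IsLocallyFiniteGroup (G ⧸ A)

/-- `1 = H 0 ≤ H 1 ≤ ⋯ ≤ H m = G` is a subnormal series whose factors are
Abelian-by-(locally finite). -/
def IsPolySeries {G : Type*} [Group G] (m : ℕ) (H : ℕ → Subgroup G) : Prop :=
  H 0 = ⊥ ∧ H m = ⊤ ∧ ∀ i < m, H i ≤ H (i + 1) ∧
    ∃ _ : ((H i).subgroupOf (H (i + 1))).Normal,
      IsAbelianByLocallyFinite (H (i + 1) ⧸ (H i).subgroupOf (H (i + 1)))

end PEI

namespace PEI

open Filter
open scoped commutatorElement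

/-! ### Signed permutations with translation -/

/-! Far out on an orthant, an element of `pei S` is a single affine signed permutation. Hence `pei
S` acts, for every `k`, on the germs at infinity of rank-`k` orthants, realised as filters. The
elements that are trivial on all germs of rank at least `k` form a normal subgroup `lay S k`, with
`lay S 0 = ⊥` and `lay S (rk S + 1) = ⊤`; the rank groups are these subgroups with the index shifted
by one (`rankGroup_eq_lay`).

One layer: an element of `lay S (k + 1)` moves only finitely many germs of rank `k`. Modulo `lay S
k` it is given by its permutation of these germs, a signed permutation on each of them, and
translation vectors. Elements of `trl S k` have translation vectors only, so `trl S k` is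
torsion-free Abelian modulo `lay S k`; permutations and signs range over a finite set once the germs
are bounded, so `lay S (k + 1)` is locally finite modulo `trl S k` (`exists_finite_cosets`). This
gives a series of length `rk S + 1`.

Maximal condition: in each layer a normal subgroup is controlled by its elements supported on a
fixed finite set of germs, three of them if there are infinitely many (`layer_reduction`). For those
elements the data are a subset of a finite set and a subgroup of a lattice, so ascending chains stop
(`layer_chain`).

Lower bound and invariance: let `H` be normal in a subnormal `K` with Abelian-by-torsion factor. An
element of positive rank in `K` yields a nontrivial translation of the same rank in `K`
(`exists_mem_trl`), and a power of it lies in the Abelian part `A`. A translation displaces a copy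
of the alternating group of degree 5 permuting parallel slices of rank one less, and a perfect
subgroup displaced by an element lies in every subnormal subgroup containing that element
(`exists_perfect_displaced`). So this copy lies in `A`, and being perfect it lies in `H`. Each step
thus loses at most one rank. This bounds the length from below and describes `lay S k` in purely
group-theoretic terms (`mem_lay_iff_exists_series`), so isomorphisms preserve it. -/

/-- The affine signed permutation `x ↦ ε * x ∘ π + c` of `ℤ^N`. -/
def aff {N : ℕ} (π : Equiv.Perm (Fin N)) (ε : Fin N → ℤˣ) (c : Fin N → ℤ) :
    Equiv.Perm (Fin N → ℤ) where
  toFun x j := ε j * x (π j) + c j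
  invFun y i := ε (π.symm i) * (y (π.symm i) - c (π.symm i))
  left_inv x := by
    funext i
    simp [← mul_assoc, ← Units.val_mul]
  right_inv y := by
    funext i
    simp [← mul_assoc, ← Units.val_mul]

/-- The linear part of `aff π ε c`. -/
def lin {N : ℕ} (π : Equiv.Perm (Fin N)) (ε : Fin N → ℤˣ) (v : Fin N → ℤ) : Fin N → ℤ :=
  fun j => ε j * v (π j)

/-- The action of `lin π ε` on sign vectors. -/
noncomputable def sgnMap {N : ℕ} (π : Equiv.Perm (Fin N)) (ε : Fin N → ℤˣ) (σ : Fin N → SignType) :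
    Fin N → SignType :=
  fun j => SignType.sign (ε j : ℤ) * σ (π j)

/-- A sign vector as a lattice vector. -/
def vec {N : ℕ} (σ : Fin N → SignType) : Fin N → ℤ := fun i => (σ i : ℤ)

/-- The number of nonzero entries of a sign vector. -/
def srk {N : ℕ} (σ : Fin N → SignType) : ℕ := (Finset.univ.filter fun i => σ i ≠ 0).card

section
variable {N : ℕ}

theorem aff_apply (π : Equiv.Perm (Fin N)) (ε : Fin N → ℤˣ) (c x : Fin N → ℤ) (j : Fin N) :
    aff π ε c x j = ε j * x (π j) + c j := rfl

theorem aff_add (π : Equiv.Perm (Fin N)) (ε : Fin N → ℤˣ) (c x v : Fin N → ℤ) :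
    aff π ε c (x + v) = aff π ε c x + lin π ε v := by
  funext j
  simp only [aff_apply, Pi.add_apply, lin]
  ring

theorem lin_smul (π : Equiv.Perm (Fin N)) (ε : Fin N → ℤˣ) (n : ℤ) (v : Fin N → ℤ) :
    lin π ε (n • v) = n • lin π ε v := by
  funext j
  simp only [lin, Pi.smul_apply, smul_eq_mul]
  ring

theorem aff_eq_add (π : Equiv.Perm (Fin N)) (ε : Fin N → ℤˣ) (c d x : Fin N → ℤ) :
    aff π ε d x = aff π ε c x + (d - c) := by
  funext j
  simp only [aff_apply, Pi.add_apply, Pi.sub_apply]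
  ring

theorem aff_symm (π : Equiv.Perm (Fin N)) (ε : Fin N → ℤˣ) (c : Fin N → ℤ) :
    (aff π ε c).symm = aff π.symm (fun i => ε (π.symm i))
      (fun i => - (ε (π.symm i) * c (π.symm i))) := by
  ext y i
  simp only [aff, Equiv.coe_fn_symm_mk, Equiv.coe_fn_mk]
  ring

theorem sign_unit (e : ℤˣ) : ((SignType.sign (e : ℤ) : SignType) : ℤ) = e := by
  rcases Int.units_eq_one_or e with rfl | rfl <;> simp

theorem lin_vec (π : Equiv.Perm (Fin N)) (ε : Fin N → ℤˣ) (σ : Fin N → SignType) :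
    lin π ε (vec σ) = vec (sgnMap π ε σ) := by
  funext j
  simp only [lin, vec, sgnMap, SignType.coe_mul, sign_unit]

theorem sgnMap_eq_zero (π : Equiv.Perm (Fin N)) (ε : Fin N → ℤˣ) (σ : Fin N → SignType)
    (j : Fin N) : sgnMap π ε σ j = 0 ↔ σ (π j) = 0 := by
  simp [sgnMap]

theorem srk_sgnMap (π : Equiv.Perm (Fin N)) (ε : Fin N → ℤˣ) (σ : Fin N → SignType) :
    srk (sgnMap π ε σ) = srk σ := by
  unfold srk
  refine Finset.card_bij' (fun j _ => π j) (fun j _ => π.symm j) ?_ ?_ ?_ ?_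
  · intro j hj
    simpa [sgnMap_eq_zero] using hj
  · intro j hj
    simpa [sgnMap_eq_zero] using hj
  · simp
  · simp

theorem srk_le (σ : Fin N → SignType) : srk σ ≤ N := by
  unfold srk
  exact (Finset.card_le_univ _).trans (by simp)

theorem sqDist_aff (π : Equiv.Perm (Fin N)) (ε : Fin N → ℤˣ) (c x y : Fin N → ℤ) :
    sqDist (aff π ε c x) (aff π ε c y) = sqDist x y := by
  simp only [sqDist, aff_apply]
  rw [← Equiv.sum_comp π fun i => (x i - y i) ^ 2]
  refine Finset.sum_congr rfl fun j _ => ?_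
  rcases Int.units_eq_one_or (ε j) with h | h <;> rw [h] <;> push_cast <;> ring

/-! ### Orthants -/

theorem sign_sq {s : SignType} (h : s ≠ 0) : (s : ℤ) * s = 1 := by
  revert h; revert s; decide

theorem exists_ray {s : SignType} {a z : ℤ} :
    (∃ n : ℕ, z = a + (s : ℤ) * n) ↔
      (s = 0 → z = a) ∧ (s = 1 → a ≤ z) ∧ (s = -1 → z ≤ a) := by
  rcases s.trichotomy with rfl | rfl | rfl
  · simp only [SignType.coe_neg, SignType.coe_one]
    refine ⟨?_, fun h => ⟨(a - z).toNat, ?_⟩⟩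
    · rintro ⟨n, rfl⟩
      simp
    · have := h.2.2 trivial
      omega
  · simp
  · simp only [SignType.coe_one]
    refine ⟨?_, fun h => ⟨(z - a).toNat, ?_⟩⟩
    · rintro ⟨n, rfl⟩
      simp
    · have := h.2.1 trivial
      omega

theorem mem_orthant {a : Fin N → ℤ} {σ : Fin N → SignType} {x : Fin N → ℤ} :
    x ∈ orthant a σ ↔
      ∀ i, (σ i = 0 → x i = a i) ∧ (σ i = 1 → a i ≤ x i) ∧ (σ i = -1 → x i ≤ a i) :=
  forall_congr' fun _ => exists_ray

theorem self_mem_orthant (a : Fin N → ℤ) (σ : Fin N → SignType) : a ∈ orthant a σ :=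
  fun _ => ⟨0, by simp⟩

theorem orthant_subset {a b : Fin N → ℤ} {σ : Fin N → SignType} (h : b ∈ orthant a σ) :
    orthant b σ ⊆ orthant a σ := by
  intro x hx i
  obtain ⟨n, hn⟩ := h i
  obtain ⟨m, hm⟩ := hx i
  exact ⟨n + m, by rw [hm, hn]; push_cast; ring⟩

theorem mem_orthant_add {a x v : Fin N → ℤ} {σ : Fin N → SignType} :
    x + v ∈ orthant (a + v) σ ↔ x ∈ orthant a σ := by
  simp only [mem_orthant, Pi.add_apply, add_left_inj, add_le_add_iff_right]

theorem shift_mem_orthant (a : Fin N → ℤ) (σ : Fin N → SignType) (t : ℕ) :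
    a + (t : ℤ) • vec σ ∈ orthant a σ :=
  fun i => ⟨t, by simp [vec, mul_comm]⟩

theorem image_aff_orthant (π : Equiv.Perm (Fin N)) (ε : Fin N → ℤˣ) (c a : Fin N → ℤ)
    (σ : Fin N → SignType) :
    aff π ε c '' orthant a σ = orthant (aff π ε c a) (sgnMap π ε σ) := by
  have key : ∀ x, aff π ε c x ∈ orthant (aff π ε c a) (sgnMap π ε σ) ↔ x ∈ orthant a σ := by
    intro x
    constructor
    · intro h i
      obtain ⟨n, hn⟩ := h (π.symm i)
      refine ⟨n, ?_⟩
      simp only [aff_apply, sgnMap, SignType.coe_mul, sign_unit, Equiv.apply_symm_apply] at hn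
      rcases Int.units_eq_one_or (ε (π.symm i)) with h | h <;> rw [h] at hn <;>
        push_cast at hn <;> linarith
    · intro h j
      obtain ⟨n, hn⟩ := h (π j)
      refine ⟨n, ?_⟩
      simp only [aff_apply, sgnMap, SignType.coe_mul, sign_unit, hn]
      ring
  ext y
  constructor
  · rintro ⟨x, hx, rfl⟩
    exact (key x).2 hx
  · intro hy
    refine ⟨(aff π ε c).symm y, (key _).1 ?_, by simp⟩
    simpa using hy

/-- An isometric embedding of an orthant is the restriction of an affine signed permutation. -/
theorem IsometricOn.exists_aff {f : (Fin N → ℤ) → (Fin N → ℤ)} {a : Fin N → ℤ}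
    {σ : Fin N → SignType} (hf : IsometricOn f (orthant a σ)) :
    ∃ π ε c, ∀ x ∈ orthant a σ, f x = aff π ε c x := by
  classical
  have ha := self_mem_orthant a σ
  have pol : ∀ x ∈ orthant a σ, ∀ y ∈ orthant a σ,
      ∑ j, (f x j - f a j) * (f y j - f a j) = ∑ j, (x j - a j) * (y j - a j) := by
    intro x hx y hy
    have key : ∀ u v w : Fin N → ℤ,
        2 * ∑ j, (u j - w j) * (v j - w j) = sqDist u w + sqDist v w - sqDist u v := by
      intro u v w
      simp only [sqDist]
      rw [Finset.mul_sum, ← Finset.sum_add_distrib, ← Finset.sum_sub_distrib]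
      exact Finset.sum_congr rfl fun j _ => by ring
    have k1 := key (f x) (f y) (f a)
    have k2 := key x y a
    rw [hf x hx y hy, hf x hx a ha, hf y hy a ha] at k1
    omega
  have hE : ∀ i, a + Pi.single i (σ i : ℤ) ∈ orthant a σ := by
    intro i j
    by_cases h : j = i
    · subst h; exact ⟨1, by simp⟩
    · exact ⟨0, by simp [h]⟩
  have hpair : ∀ i, ∀ x ∈ orthant a σ,
      ∑ j, (f x j - f a j) * (f (a + Pi.single i (σ i : ℤ)) j - f a j)
        = (x i - a i) * (σ i : ℤ) := by
    intro i x hx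
    rw [pol x hx _ (hE i), Finset.sum_eq_single i]
    · simp
    · intro j _ hj; simp [hj]
    · simp
  have hv : ∀ i : {i // σ i ≠ 0}, ∃ (j : Fin N) (e : SignType), e ≠ 0 ∧
      (fun j => f (a + Pi.single i.1 (σ i.1 : ℤ)) j - f a j) = Pi.single j (e : ℤ) := by
    intro i
    apply unit_vector
    have := hpair i.1 _ (hE i.1)
    simp only [Pi.add_apply, Pi.single_eq_same, add_sub_cancel_left, sign_sq i.2] at this
    rw [← this]
    exact Finset.sum_congr rfl fun j _ => by ring
  choose π e he hπ using hv
  have coord : ∀ i : {i // σ i ≠ 0}, ∀ x ∈ orthant a σ,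
      f x (π i) = f a (π i) + (e i * σ i.1 : ℤ) * (x i.1 - a i.1) := by
    intro i x hx
    have h := hpair i.1 x hx
    rw [Finset.sum_eq_single (π i), congrFun (hπ i) (π i), Pi.single_eq_same] at h
    · calc f x (π i) = f a (π i) + (f x (π i) - f a (π i)) * ((e i : ℤ) * e i) := by
            rw [sign_sq (he i)]; ring
        _ = f a (π i) + ((f x (π i) - f a (π i)) * (e i : ℤ)) * e i := by ring
        _ = _ := by rw [h]; ring
    · intro j _ hj
      rw [congrFun (hπ i) j, Pi.single_eq_of_ne hj, mul_zero]
    · simp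
  have inj : Function.Injective π := by
    intro i k hik
    by_contra hne
    have hik' : i.1 ≠ k.1 := fun h => hne (Subtype.ext h)
    have h1 := coord i _ (hE k.1)
    have h2 := congrFun (hπ k) (π k)
    rw [hik] at h1
    simp only [Pi.add_apply, Pi.single_eq_of_ne hik', add_zero, sub_self, mul_zero] at h1
    rw [Pi.single_eq_same, h1, sub_self] at h2
    have h3 := he k
    revert h2 h3
    generalize e k = s
    revert s
    decide
  have off : ∀ x ∈ orthant a σ, ∀ j, j ∉ Set.range π → f x j = f a j := by
    intro x hx j hj
    have h1 := pol x hx x hx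
    have h2 : ∑ i, (x i - a i) * (x i - a i)
        = ∑ i : {i // σ i ≠ 0}, (x i.1 - a i.1) * (x i.1 - a i.1) := by
      rw [← Finset.sum_subtype (Finset.univ.filter fun i => σ i ≠ 0) (by simp)
        (fun i => (x i - a i) * (x i - a i)), Finset.sum_filter_of_ne]
      intro i _ hne h0
      obtain ⟨n, hn⟩ := hx i
      exact hne (by simp [hn, h0])
    have h3 : ∑ i : {i // σ i ≠ 0}, (x i.1 - a i.1) * (x i.1 - a i.1)
        = ∑ k ∈ Finset.univ.image π, (f x k - f a k) * (f x k - f a k) := by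
      rw [Finset.sum_image fun _ _ _ _ h => inj h]
      refine Finset.sum_congr rfl fun i _ => ?_
      rw [coord i x hx]
      have e1 := sign_sq (he i)
      have e2 := sign_sq i.2
      calc (x i.1 - a i.1) * (x i.1 - a i.1)
          = ((e i : ℤ) * e i) * ((σ i.1 : ℤ) * σ i.1) * ((x i.1 - a i.1) * (x i.1 - a i.1)) := by
            rw [e1, e2]; ring
        _ = _ := by ring
    have h4 := Finset.sum_add_sum_compl (Finset.univ.image π)
      (fun k => (f x k - f a k) * (f x k - f a k))
    have h5 : ∑ k ∈ (Finset.univ.image π)ᶜ, (f x k - f a k) * (f x k - f a k) = 0 := by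
      linarith
    have h6 := (Finset.sum_eq_zero_iff_of_nonneg fun k _ => mul_self_nonneg _).1 h5 j (by
      simpa using fun i hi h => hj ⟨⟨i, hi⟩, h⟩)
    have := mul_self_eq_zero.1 h6
    linarith
  -- Any extension of the injection `π` from the directions of the orthant to all coordinates will
  -- do: on the remaining coordinates both the points of the orthant and their images are constant.
  let P : Equiv.Perm (Fin N) := (Equiv.ofInjective π inj).extendSubtype
  have P1 : ∀ i (h : σ i ≠ 0), P i = π ⟨i, h⟩ := fun i h =>
    Equiv.extendSubtype_apply_of_mem (Equiv.ofInjective π inj) i h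
  have P2 : ∀ i, σ i = 0 → P i ∉ Set.range π := fun i h =>
    Equiv.extendSubtype_not_mem (Equiv.ofInjective π inj) i (not_not.2 h)
  have hu : ∀ i, ∃ u : ℤˣ, ∀ x ∈ orthant a σ, f x (P i) = f a (P i) + u * (x i - a i) := by
    intro i
    by_cases h : σ i = 0
    · refine ⟨1, fun x hx => ?_⟩
      rw [off x hx _ (P2 i h), ((mem_orthant.1 hx) i).1 h]
      simp
    · have h1 : (e ⟨i, h⟩ * σ i : ℤ) * (e ⟨i, h⟩ * σ i : ℤ) = 1 := by
        rw [mul_mul_mul_comm, sign_sq h, sign_sq (he _)]; rfl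
      refine ⟨⟨_, _, h1, h1⟩, fun x hx => ?_⟩
      rw [P1 i h]
      exact coord ⟨i, h⟩ x hx
  choose u hu using hu
  refine ⟨P.symm, fun j => u (P.symm j), fun j => f a j - u (P.symm j) * a (P.symm j),
    fun x hx => ?_⟩
  funext j
  have := hu (P.symm j) x hx
  rw [Equiv.apply_symm_apply] at this
  rw [this, aff_apply]
  ring

/-- An affine signed permutation that fixes a point of an orthant and its neighbours in the
directions of the orthant is the identity on the orthant. -/
theorem aff_eq_self_of_fixed {π : Equiv.Perm (Fin N)} {ε : Fin N → ℤˣ} {c a x : Fin N → ℤ}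
    {σ : Fin N → SignType} (hx : x ∈ orthant a σ) (h0 : aff π ε c x = x)
    (h1 : ∀ i, aff π ε c (x + Pi.single i (σ i : ℤ)) = x + Pi.single i (σ i : ℤ))
    {z : Fin N → ℤ} (hz : z ∈ orthant a σ) : aff π ε c z = z := by
  have hl : ∀ i j, (ε j : ℤ) * (Pi.single i (σ i : ℤ) : Fin N → ℤ) (π j)
      = (Pi.single i (σ i : ℤ) : Fin N → ℤ) j := by
    intro i j
    have := congrFun (h1 i) j
    rw [aff_add, h0] at this
    simpa [lin] using this
  have hπ : ∀ i, σ i ≠ 0 → π i = i ∧ ε i = 1 := by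
    intro i hi
    have hi' : (σ i : ℤ) ≠ 0 := by
      revert hi; generalize σ i = s; revert s; decide
    have h := hl i i
    rw [Pi.single_eq_same] at h
    by_cases hp : π i = i
    · refine ⟨hp, ?_⟩
      rw [hp, Pi.single_eq_same] at h
      exact Units.ext <| mul_right_cancel₀ hi' (h.trans (one_mul _).symm)
    · rw [Pi.single_eq_of_ne hp, mul_zero] at h
      exact absurd h.symm hi'
  have hu : ∀ i, σ i = 0 → z i - x i = 0 := fun i hi => by
    rw [(mem_orthant.1 hx i).1 hi, (mem_orthant.1 hz i).1 hi, sub_self]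
  have e : z = x + (z - x) := by abel
  rw [e, aff_add, h0]
  congr 1
  funext j
  simp only [lin, Pi.sub_apply]
  by_cases hj : σ j = 0
  · by_cases hp : σ (π j) = 0
    · rw [hu _ hp, hu _ hj, mul_zero]
    · have := π.injective (hπ _ hp).1
      rw [this] at hp
      exact absurd hj hp
  · rw [(hπ j hj).1, (hπ j hj).2]
    simp

/-! ### Cells of a grid -/

/-- The coordinatewise truncation to the interval `[-(B + 1), B + 1]`; its fibres are the cells of
a finite partition of `ℤ^N` into orthants. -/
def clamp (B : ℕ) (x : Fin N → ℤ) : Fin N → ℤ :=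
  fun i => max (-(B + 1 : ℤ)) (min (B + 1 : ℤ) (x i))

/-- `X` is a union of cells of the grid of size `B`. -/
def CellUnion (B : ℕ) (X : Set (Fin N → ℤ)) : Prop :=
  ∀ x y, clamp B x = clamp B y → (x ∈ X ↔ y ∈ X)

theorem clamp_apply (B : ℕ) (x : Fin N → ℤ) (i : Fin N) :
    clamp B x i = max (-(B + 1 : ℤ)) (min (B + 1 : ℤ) (x i)) := rfl

theorem clamp_mono {B C : ℕ} (h : B ≤ C) {x y : Fin N → ℤ} (hxy : clamp C x = clamp C y) :
    clamp B x = clamp B y := by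
  funext i
  have := congrFun hxy i
  simp only [clamp_apply] at this ⊢
  omega

theorem CellUnion.mono {B C : ℕ} (h : B ≤ C) {X : Set (Fin N → ℤ)} (hX : CellUnion B X) :
    CellUnion C X := fun x y hxy => hX x y (clamp_mono h hxy)

theorem CellUnion.diff {B : ℕ} {X Y : Set (Fin N → ℤ)} (hX : CellUnion B X)
    (hY : CellUnion B Y) : CellUnion B (X \ Y) :=
  fun x y hxy => and_congr (hX x y hxy) (not_congr (hY x y hxy))

/-- Once `B` bounds every `|a i|`, comparing a coordinate with `a i` only depends on its truncation
to `[-(B + 1), B + 1]`. -/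
theorem cellUnion_orthant (a : Fin N → ℤ) (σ : Fin N → SignType) :
    ∃ B, CellUnion B (orthant a σ) := by
  refine ⟨∑ i, (a i).natAbs, fun x y hxy => ?_⟩
  rw [mem_orthant, mem_orthant]
  refine forall_congr' fun i => ?_
  have hB : (a i).natAbs ≤ ∑ i, (a i).natAbs :=
    Finset.single_le_sum (f := fun i => (a i).natAbs) (fun _ _ => Nat.zero_le _)
      (Finset.mem_univ i)
  have := congrFun hxy i
  simp only [clamp_apply] at this
  generalize ∑ i, (a i).natAbs = B at *
  have e0 : x i = a i ↔ y i = a i := by omega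
  have e1 : a i ≤ x i ↔ a i ≤ y i := by omega
  have e2 : x i ≤ a i ↔ y i ≤ a i := by omega
  rw [e0, e1, e2]

theorem exists_uniform_grid {ι : Type*} {s : Set ι} (hs : s.Finite) {p : ι → ℕ → Prop}
    (hp : ∀ i B C, B ≤ C → p i B → p i C) (h : ∀ i ∈ s, ∃ B, p i B) : ∃ B, ∀ i ∈ s, p i B := by
  induction s, hs using Set.Finite.induction_on with
  | empty => exact ⟨0, by simp⟩
  | @insert i s _ _ ih =>
    obtain ⟨B, hB⟩ := ih fun j hj => h j (Set.mem_insert_of_mem _ hj)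
    obtain ⟨C, hC⟩ := h i (Set.mem_insert _ _)
    refine ⟨max B C, fun j hj => ?_⟩
    rcases hj with rfl | hj
    · exact hp _ _ _ (le_max_right _ _) hC
    · exact hp _ _ _ (le_max_left _ _) (hB j hj)

theorem IsOrthohedral.cellUnion {S : Set (Fin N → ℤ)} (hS : IsOrthohedral S) :
    ∃ B, CellUnion B S := by
  obtain ⟨Λ, hfin, hor, rfl⟩ := hS
  obtain ⟨B, hB⟩ := exists_uniform_grid (p := fun L B => CellUnion B L) hfin
    (fun _ _ _ h hL => hL.mono h) (fun L hL => by
      obtain ⟨_, a, σ, -, rfl⟩ := hor L hL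
      exact cellUnion_orthant a σ)
  exact ⟨B, fun x y hxy => ⟨fun ⟨L, hL, hx⟩ => ⟨L, hL, (hB L hL x y hxy).1 hx⟩,
    fun ⟨L, hL, hx⟩ => ⟨L, hL, (hB L hL x y hxy).2 hx⟩⟩⟩

/-- The directions of the cell of `x`. -/
def cellSign (B : ℕ) (x : Fin N → ℤ) : Fin N → SignType :=
  fun i => if (B : ℤ) + 1 ≤ x i then 1 else if x i ≤ -(B + 1 : ℤ) then -1 else 0

theorem cell_eq_orthant (B : ℕ) (x : Fin N → ℤ) :
    {y | clamp B y = clamp B x} = orthant (clamp B x) (cellSign B x) := by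
  ext y
  simp only [Set.mem_ofPred_eq, funext_iff, mem_orthant, clamp_apply]
  refine forall_congr' fun i => ?_
  unfold cellSign
  split_ifs with h1 h2 <;> simp <;> omega

theorem finite_cells (B : ℕ) :
    (Set.range fun x : Fin N → ℤ => {y | clamp B y = clamp B x}).Finite := by
  have hf : (Set.range (clamp B : (Fin N → ℤ) → Fin N → ℤ)).Finite := by
    refine (Set.finite_Icc (fun _ => -(B + 1 : ℤ)) (fun _ => (B + 1 : ℤ))).subset ?_
    rintro _ ⟨x, rfl⟩
    refine ⟨fun i => ?_, fun i => ?_⟩ <;> simp only [clamp_apply] <;> omega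
  refine (hf.image fun p => {y | clamp B y = p}).subset ?_
  rintro _ ⟨x, rfl⟩
  exact ⟨_, ⟨x, rfl⟩, rfl⟩

theorem isPei_of_cells {g : (Fin N → ℤ) → (Fin N → ℤ)} (B : ℕ)
    (h : ∀ x, IsometricOn g {y | clamp B y = clamp B x}) : IsPei g := by
  refine ⟨_, finite_cells B, ?_, ?_, ?_, ?_⟩
  · rintro _ ⟨x, rfl⟩
    simp only [cell_eq_orthant]
    exact isOrthant_orthant _ _
  · rintro _ ⟨x, rfl⟩ _ ⟨y, rfl⟩ hne
    refine Set.disjoint_left.2 fun z hx hy => hne ?_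
    have hx : clamp B z = clamp B x := hx
    have hy : clamp B z = clamp B y := hy
    simp only [← hx, ← hy]
  · rw [Set.eq_univ_iff_forall]
    exact fun x => ⟨_, ⟨x, rfl⟩, rfl⟩
  · rintro _ ⟨x, rfl⟩
    exact h x

/-- Grids replace arbitrary partitions: a grid fine enough for all pieces of the given partition has
each of its cells inside one piece. -/
theorem IsPei.exists_cells {g : (Fin N → ℤ) → (Fin N → ℤ)} (hg : IsPei g) :
    ∃ B, ∀ x, ∃ π ε c, ∀ y, clamp B y = clamp B x → g y = aff π ε c y := by
  obtain ⟨Λ, hfin, hor, -, hcov, hiso⟩ := hg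
  obtain ⟨B, hB⟩ := exists_uniform_grid (p := fun L B => CellUnion B L) hfin
    (fun _ _ _ h hL => hL.mono h) (fun L hL => by
      obtain ⟨_, a, σ, -, rfl⟩ := hor L hL
      exact cellUnion_orthant a σ)
  refine ⟨B, fun x => ?_⟩
  obtain ⟨L, hL, hx⟩ := Set.eq_univ_iff_forall.1 hcov x
  obtain ⟨_, a, σ, -, e⟩ := hor L hL
  obtain ⟨π, ε, c, h⟩ := (e ▸ hiso L hL).exists_aff
  exact ⟨π, ε, c, fun y hy => h y (e ▸ (hB L hL y x hy).2 hx)⟩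

end

/-! ### Germs of orthants -/

/-- The germ at infinity of an orthant: the filter generated by the orthants
`orthant (a + t • vec σ) σ`. -/
def germ {N : ℕ} (a : Fin N → ℤ) (σ : Fin N → SignType) : Filter (Fin N → ℤ) :=
  ⨅ t : ℕ, 𝓟 (orthant (a + (t : ℤ) • vec σ) σ)

/-- `F` is the germ of an orthant of rank `k`. -/
def IsGerm {N : ℕ} (k : ℕ) (F : Filter (Fin N → ℤ)) : Prop :=
  ∃ a σ, srk σ = k ∧ F = germ a σ

/-- `X` is contained in a finite union of orthants of rank less than `k`. -/
def Small {N : ℕ} (k : ℕ) (X : Set (Fin N → ℤ)) : Prop :=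
  ∃ Λ : Set (Set (Fin N → ℤ)), Λ.Finite ∧ (∀ L ∈ Λ, ∃ j < k, IsOrthantOfRank L j) ∧ X ⊆ ⋃₀ Λ

section
variable {N : ℕ} {a b : Fin N → ℤ} {σ τ : Fin N → SignType}

theorem mem_germ {X : Set (Fin N → ℤ)} :
    X ∈ germ a σ ↔ ∃ t : ℕ, orthant (a + (t : ℤ) • vec σ) σ ⊆ X := by
  unfold germ
  rw [mem_iInf_of_directed]
  · simp
  · refine (antitone_nat_of_succ_le fun t => ?_).directed_ge
    refine principal_mono.2 (orthant_subset ?_)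
    have := shift_mem_orthant (a + (t : ℤ) • vec σ) σ 1
    rwa [add_assoc, ← add_smul] at this

theorem orthant_mem_germ (a : Fin N → ℤ) (σ : Fin N → SignType) : orthant a σ ∈ germ a σ :=
  mem_germ.2 ⟨0, by simp⟩

instance germ_neBot (a : Fin N → ℤ) (σ : Fin N → SignType) : (germ a σ).NeBot := by
  rw [← forall_mem_nonempty_iff_neBot]
  intro X hX
  obtain ⟨t, ht⟩ := mem_germ.1 hX
  exact ⟨_, ht (self_mem_orthant _ _)⟩

theorem IsGerm.neBot {k : ℕ} {F : Filter (Fin N → ℤ)} (h : IsGerm k F) : F.NeBot := by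
  obtain ⟨a, σ, -, rfl⟩ := h
  infer_instance

/-- Moving far enough along `σ` absorbs any difference of base points in the directions of `σ`; only
the constant coordinates distinguish parallel germs. -/
theorem germ_le_of_eq (h : ∀ i, σ i = 0 → a i = b i) : germ a σ ≤ germ b σ := by
  intro X hX
  obtain ⟨t, ht⟩ := mem_germ.1 hX
  refine mem_germ.2 ⟨t + ∑ i, (b i - a i).natAbs, (orthant_subset ?_).trans ht⟩
  rw [mem_orthant]
  intro i
  have hB : (b i - a i).natAbs ≤ ∑ i, (b i - a i).natAbs :=
    Finset.single_le_sum (f := fun i => (b i - a i).natAbs) (fun _ _ => Nat.zero_le _)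
      (Finset.mem_univ i)
  generalize ∑ i, (b i - a i).natAbs = B at *
  simp only [Pi.add_apply, Pi.smul_apply, vec, smul_eq_mul]
  refine ⟨fun h0 => ?_, fun h0 => ?_, fun h0 => ?_⟩ <;> rw [h0]
  · simp [h i h0]
  · push_cast
    simp
    omega
  · push_cast
    simp
    omega

theorem germ_congr (h : ∀ i, σ i = 0 → a i = b i) : germ a σ = germ b σ :=
  le_antisymm (germ_le_of_eq h) (germ_le_of_eq fun i hi => (h i hi).symm)

theorem germ_eq_of_mem (h : b ∈ orthant a σ) : germ b σ = germ a σ :=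
  germ_congr fun i hi => (mem_orthant.1 h i).1 hi

/-- A property holds on a germ iff it holds on an orthant that represents the germ. -/
theorem eventually_germ {p : (Fin N → ℤ) → Prop} :
    (∀ᶠ x in germ a σ, p x) ↔ ∃ b ∈ orthant a σ, ∀ x ∈ orthant b σ, p x := by
  constructor
  · intro h
    obtain ⟨t, ht⟩ := mem_germ.1 h
    exact ⟨_, shift_mem_orthant a σ t, ht⟩
  · rintro ⟨b, hb, h⟩
    rw [← germ_eq_of_mem hb]
    exact mem_of_superset (orthant_mem_germ b σ) h

theorem map_aff_germ (π : Equiv.Perm (Fin N)) (ε : Fin N → ℤˣ) (c a : Fin N → ℤ)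
    (σ : Fin N → SignType) :
    map (aff π ε c) (germ a σ) = germ (aff π ε c a) (sgnMap π ε σ) := by
  have key : ∀ t : ℕ, aff π ε c '' orthant (a + (t : ℤ) • vec σ) σ
      = orthant (aff π ε c a + (t : ℤ) • vec (sgnMap π ε σ)) (sgnMap π ε σ) := by
    intro t
    rw [image_aff_orthant, aff_add, lin_smul, lin_vec]
  ext X
  rw [mem_map, mem_germ, mem_germ]
  refine exists_congr fun t => ?_
  rw [← key, Set.image_subset_iff]

/-- Far out, each coordinate is constant or beyond the grid, so a germ ends up in a single cell.
Therefore germs decide unions of cells the way ultrafilters decide sets. -/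
theorem exists_clamp_germ (B : ℕ) (a : Fin N → ℤ) (σ : Fin N → SignType) :
    ∃ p, ∀ᶠ x in germ a σ, clamp B x = p := by
  refine ⟨fun i => max (-(B + 1 : ℤ)) (min (B + 1 : ℤ)
      (a i + (σ i : ℤ) * ((B + 1 : ℕ) + ∑ i, (a i).natAbs : ℕ))), mem_germ.2
      ⟨B + 1 + ∑ i, (a i).natAbs, fun x hx => ?_⟩⟩
  funext i
  have hB : (a i).natAbs ≤ ∑ i, (a i).natAbs :=
    Finset.single_le_sum (f := fun i => (a i).natAbs) (fun _ _ => Nat.zero_le _)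
      (Finset.mem_univ i)
  have := mem_orthant.1 hx i
  simp only [clamp_apply]
  generalize ∑ i, (a i).natAbs = C at *
  simp only [Pi.add_apply, Pi.smul_apply, vec, smul_eq_mul] at this
  obtain ⟨h0, h1, h2⟩ := this
  rcases (σ i).trichotomy with h | h | h
  · have := h2 h
    rw [h] at this ⊢
    simp at this ⊢
    omega
  · have := h0 h
    rw [h] at this ⊢
    simp at this ⊢
    omega
  · have := h1 h
    rw [h] at this ⊢
    simp at this ⊢
    omega

theorem CellUnion.mem_or_compl_mem {B : ℕ} {X : Set (Fin N → ℤ)} (hX : CellUnion B X) {k : ℕ}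
    {F : Filter (Fin N → ℤ)} (hF : IsGerm k F) : X ∈ F ∨ Xᶜ ∈ F := by
  obtain ⟨a, σ, -, rfl⟩ := hF
  obtain ⟨p, hp⟩ := exists_clamp_germ B a σ
  obtain ⟨y, hy⟩ := hp.exists
  by_cases h : y ∈ X
  · exact Or.inl (hp.mono fun x hx => (hX x y (hx.trans hy.symm)).2 h)
  · exact Or.inr (hp.mono fun x hx hxX => h ((hX x y (hx.trans hy.symm)).1 hxX))

/-- It suffices to test points of the ray `b + n • vec τ`: a coordinate running off to infinity must
be a direction of the orthant with the same sign. -/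
theorem of_orthant_mem_germ (h : orthant a σ ∈ germ b τ) :
    (∀ i, τ i ≠ 0 → σ i = τ i) ∧ ∀ i, σ i = 0 → b i = a i := by
  obtain ⟨t, ht⟩ := mem_germ.1 h
  have key : ∀ n : ℕ, b + ((t + n : ℕ) : ℤ) • vec τ ∈ orthant a σ := fun n => ht (by
    have := shift_mem_orthant (b + (t : ℤ) • vec τ) τ n
    rw [add_assoc, ← add_smul] at this
    push_cast
    exact this)
  have key2 : ∀ i (n : ℕ), _ := fun i n => mem_orthant.1 (key n) i
  simp only [Pi.add_apply, Pi.smul_apply, vec, smul_eq_mul] at key2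
  have first : ∀ i, τ i ≠ 0 → σ i = τ i := by
    intro i hi
    have k0 := key2 i 0
    obtain ⟨C, hC⟩ : ∃ C : ℕ, a i - b i < C ∧ b i - a i < C :=
      ⟨(a i - b i).natAbs + 1, by omega, by omega⟩
    have k1 := key2 i C
    rcases (σ i).trichotomy with hs | hs | hs <;> rcases (τ i).trichotomy with hh | hh | hh <;>
      rw [hs, hh] at k0 k1 <;> simp at k0 k1 <;> first | exact hs.trans hh.symm | exact absurd hh hi | omega
  refine ⟨first, fun i hi => ?_⟩
  have hτ : τ i = 0 := by
    by_contra h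
    exact h ((first i h).symm.trans hi)
  have := (key2 i 0).1 hi
  rw [hτ] at this
  simpa using this

theorem srk_le_of_orthant_mem_germ (h : orthant a σ ∈ germ b τ) : srk τ ≤ srk σ := by
  refine Finset.card_le_card fun i hi => ?_
  have hi' : τ i ≠ 0 := by simpa using hi
  simpa [(of_orthant_mem_germ h).1 i hi'] using hi'

theorem germ_eq_of_orthant_mem (h : orthant a σ ∈ germ b τ) (hr : srk σ ≤ srk τ) :
    germ b τ = germ a σ := by
  obtain ⟨h1, h2⟩ := of_orthant_mem_germ h
  have hs : (Finset.univ.filter fun i => τ i ≠ 0) = Finset.univ.filter fun i => σ i ≠ 0 := by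
    refine Finset.eq_of_subset_of_card_le (fun i hi => ?_) hr
    have hi' : τ i ≠ 0 := by simpa using hi
    simpa [h1 i hi'] using hi'
  have hστ : σ = τ := by
    funext i
    by_cases hi : τ i = 0
    · have : i ∉ Finset.univ.filter fun i => τ i ≠ 0 := by simp [hi]
      rw [hs] at this
      rw [hi]
      simpa using this
    · exact h1 i hi
  subst hστ
  exact germ_congr h2

theorem IsPei.exists_aff_germ {g : (Fin N → ℤ) → (Fin N → ℤ)} (hg : IsPei g) {k : ℕ}
    {F : Filter (Fin N → ℤ)} (hF : IsGerm k F) :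
    ∃ π ε c, ∀ᶠ x in F, g x = aff π ε c x := by
  obtain ⟨B, hB⟩ := hg.exists_cells
  obtain ⟨a, σ, -, rfl⟩ := hF
  obtain ⟨p, hp⟩ := exists_clamp_germ B a σ
  obtain ⟨y, hy⟩ := hp.exists
  obtain ⟨π, ε, c, h⟩ := hB y
  exact ⟨π, ε, c, hp.mono fun x hx => h x (hx.trans hy.symm)⟩

theorem IsGerm.map_aff {k : ℕ} {F : Filter (Fin N → ℤ)} (hF : IsGerm k F)
    (π : Equiv.Perm (Fin N)) (ε : Fin N → ℤˣ) (c : Fin N → ℤ) : IsGerm k (map (aff π ε c) F) := by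
  obtain ⟨a, σ, hσ, rfl⟩ := hF
  exact ⟨_, _, by rw [srk_sgnMap, hσ], map_aff_germ π ε c a σ⟩

theorem IsGerm.map_pei {g : (Fin N → ℤ) → (Fin N → ℤ)} (hg : IsPei g) {k : ℕ}
    {F : Filter (Fin N → ℤ)} (hF : IsGerm k F) : IsGerm k (map g F) := by
  obtain ⟨π, ε, c, h⟩ := hg.exists_aff_germ hF
  have : map g F = map (aff π ε c) F := map_congr h
  rw [this]
  exact hF.map_aff π ε c

/-! ### Small sets -/

theorem Small.mono {k : ℕ} {X Y : Set (Fin N → ℤ)} (hX : Small k X) (h : Y ⊆ X) : Small k Y := by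
  obtain ⟨Λ, h1, h2, h3⟩ := hX
  exact ⟨Λ, h1, h2, h.trans h3⟩

theorem exists_orthant_mem_of_cover {Λ : Set (Set (Fin N → ℤ))} (hfin : Λ.Finite)
    (hor : ∀ L ∈ Λ, IsOrthant L) {X : Set (Fin N → ℤ)} (hX : X ⊆ ⋃₀ Λ) {k : ℕ}
    {F : Filter (Fin N → ℤ)} (hF : IsGerm k F) (h : Xᶜ ∉ F) : ∃ L ∈ Λ, L ∈ F := by
  by_contra! hne
  refine h ?_
  have : ⋂₀ (compl '' Λ) ∈ F := by
    rw [sInter_mem (hfin.image _)]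
    rintro _ ⟨L, hL, rfl⟩
    obtain ⟨_, a, σ, -, rfl⟩ := hor L hL
    obtain ⟨B, hB⟩ := cellUnion_orthant a σ
    exact (hB.mem_or_compl_mem hF).resolve_left (hne _ hL)
  refine mem_of_superset this ?_
  rw [← Set.compl_sUnion]
  exact Set.compl_subset_compl.2 hX

theorem Small.compl_mem {k j : ℕ} {X : Set (Fin N → ℤ)} (hX : Small k X)
    {F : Filter (Fin N → ℤ)} (hF : IsGerm j F) (hkj : k ≤ j) : Xᶜ ∈ F := by
  obtain ⟨Λ, h1, h2, h3⟩ := hX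
  by_contra h
  obtain ⟨L, hL, hLF⟩ := exists_orthant_mem_of_cover h1
    (fun L hL => (h2 L hL).imp fun _ h => h.2) h3 hF h
  obtain ⟨i, hi, a, σ, hσ, rfl⟩ := h2 L hL
  obtain ⟨b, τ, hτ, rfl⟩ := hF
  have := srk_le_of_orthant_mem_germ hLF
  unfold srk at this hτ
  omega

/-- A germ of rank `k` that is not eventually outside `X` contains one of the finitely many covering
orthants. Such an orthant has rank at most `k`, so the germ is that of the orthant. -/
theorem Small.finite_germs {k : ℕ} {X : Set (Fin N → ℤ)} (hX : Small (k + 1) X) :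
    {F | IsGerm k F ∧ Xᶜ ∉ F}.Finite := by
  obtain ⟨Λ, h1, h2, h3⟩ := hX
  choose! r hr a σ hσ e using h2
  refine (h1.image fun L => germ (a L) (σ L)).subset ?_
  rintro F ⟨hF, h⟩
  obtain ⟨L, hL, hLF⟩ := exists_orthant_mem_of_cover h1 (fun L hL => ⟨_, _, _, hσ L hL, e L hL⟩)
    h3 hF h
  refine ⟨L, hL, ?_⟩
  obtain ⟨b, τ, hτ, rfl⟩ := hF
  rw [e L hL] at hLF
  refine (germ_eq_of_orthant_mem hLF ?_).symm
  have h4 := hr L hL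
  have h5 := hσ L hL
  unfold srk at *
  omega

theorem small_cells (k B : ℕ) :
    Small k {x : Fin N → ℤ | srk (cellSign B x) < k} := by
  refine ⟨(fun x : Fin N → ℤ => {y | clamp B y = clamp B x}) '' {x | srk (cellSign B x) < k},
    (finite_cells B).subset (Set.image_subset_range _ _), ?_, ?_⟩
  · rintro _ ⟨x, hx, rfl⟩
    exact ⟨_, hx, _, _, rfl, cell_eq_orthant B x⟩
  · intro x hx
    exact ⟨_, ⟨x, hx, rfl⟩, rfl⟩

/-- A cell meeting `X` is contained in `X`, and so the germ of the cell excludes rank at least `k`.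
Only the finitely many cells of smaller rank remain. -/
theorem CellUnion.small {k B : ℕ} {X : Set (Fin N → ℤ)} (hX : CellUnion B X)
    (h : ∀ j ≥ k, ∀ F, IsGerm j F → Xᶜ ∈ F) : Small k X := by
  refine (small_cells k B).mono fun x hx => ?_
  by_contra hk
  have h1 := h _ (not_lt.1 hk) (germ (clamp B x) (cellSign B x)) ⟨_, _, rfl, rfl⟩
  have h2 := orthant_mem_germ (clamp B x) (cellSign B x)
  rw [← cell_eq_orthant] at h2
  obtain ⟨y, hy, hy'⟩ := nonempty_of_mem (inter_mem h1 h2)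
  exact hy ((hX y x hy').2 hx)

theorem aff_eq_self_of_eventually {π : Equiv.Perm (Fin N)} {ε : Fin N → ℤˣ} {c a : Fin N → ℤ}
    {σ : Fin N → SignType} (h : ∀ᶠ x in germ a σ, aff π ε c x = x) {z : Fin N → ℤ}
    (hz : z ∈ orthant a σ) : aff π ε c z = z := by
  obtain ⟨b, hb, h⟩ := eventually_germ.1 h
  refine aff_eq_self_of_fixed hb (h b (self_mem_orthant _ _)) (fun i => h _ fun j => ?_) hz
  by_cases hj : j = i
  · subst hj; exact ⟨1, by simp⟩
  · exact ⟨0, by simp [hj]⟩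

/-- On a cell `g` is affine, and an affine signed permutation that is trivial on the germ of an
orthant is trivial on the whole orthant. Hence cells of rank at least `k` contain no moved point. -/
theorem IsPei.small_moved {g : (Fin N → ℤ) → (Fin N → ℤ)} (hg : IsPei g) {k : ℕ}
    (h : ∀ j ≥ k, ∀ F, IsGerm j F → ∀ᶠ x in F, g x = x) : Small k {x | g x ≠ x} := by
  obtain ⟨B, hB⟩ := hg.exists_cells
  refine (small_cells k B).mono fun x hx => ?_
  by_contra hk
  obtain ⟨π, ε, c, hc⟩ := hB x
  have e := cell_eq_orthant B x
  have hc' : ∀ y ∈ orthant (clamp B x) (cellSign B x), g y = aff π ε c y := by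
    rw [← e]
    exact hc
  have hx' : x ∈ orthant (clamp B x) (cellSign B x) := by
    rw [← e]
    rfl
  have h1 := h _ (not_lt.1 hk) (germ (clamp B x) (cellSign B x)) ⟨_, _, rfl, rfl⟩
  refine hx ?_
  rw [hc' x hx']
  refine aff_eq_self_of_eventually ?_ hx'
  filter_upwards [h1, orthant_mem_germ (clamp B x) (cellSign B x)] with y hy hy'
  rw [← hc' y hy', hy]

end

/-! ### The rank filtration of `pei S` -/

section
variable {N : ℕ} {S : Set (Fin N → ℤ)}

theorem pei_exists_aff (g : pei S) {k : ℕ} {F : Filter (Fin N → ℤ)} (hF : IsGerm k F) :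
    ∃ π ε c, ∀ᶠ x in F, g.1 x = aff π ε c x :=
  g.2.1.exists_aff_germ hF

theorem isGerm_map (g : pei S) {k : ℕ} {F : Filter (Fin N → ℤ)} (hF : IsGerm k F) :
    IsGerm k (map g.1 F) :=
  hF.map_pei g.2.1

theorem map_mul_germ (g h : pei S) (F : Filter (Fin N → ℤ)) :
    map (g * h).1 F = map g.1 (map h.1 F) := by
  rw [map_map]
  rfl

theorem map_inv_map (g : pei S) (F : Filter (Fin N → ℤ)) : map (g⁻¹).1 (map g.1 F) = F := by
  rw [← map_mul_germ, inv_mul_cancel]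
  exact map_id

theorem map_map_inv (g : pei S) (F : Filter (Fin N → ℤ)) : map g.1 (map (g⁻¹).1 F) = F := by
  rw [← map_mul_germ, mul_inv_cancel]
  exact map_id

theorem inv_apply_self (g : pei S) (x : Fin N → ℤ) : (g⁻¹).1 (g.1 x) = x :=
  g.1.symm_apply_apply x

theorem apply_inv_self (g : pei S) (x : Fin N → ℤ) : g.1 ((g⁻¹).1 x) = x :=
  g.1.apply_symm_apply x

theorem mul_apply (g h : pei S) (x : Fin N → ℤ) : (g * h).1 x = g.1 (h.1 x) := rfl

theorem map_eq_self_of_fixed {g : pei S} {F : Filter (Fin N → ℤ)} (h : ∀ᶠ x in F, g.1 x = x) :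
    map g.1 F = F := by
  have : map g.1 F = map id F := map_congr h
  rw [this, map_id]

theorem fixed_inv {g : pei S} {F : Filter (Fin N → ℤ)} (h : ∀ᶠ x in F, g.1 x = x) :
    ∀ᶠ x in F, (g⁻¹).1 x = x :=
  h.mono fun x hx => by
    conv_lhs => rw [← hx]
    exact inv_apply_self g x

theorem fixed_mul {g h : pei S} {F : Filter (Fin N → ℤ)} (hg : ∀ᶠ x in F, g.1 x = x)
    (hh : ∀ᶠ x in F, h.1 x = x) : ∀ᶠ x in F, (g * h).1 x = x := by
  filter_upwards [hg, hh] with x h1 h2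
  rw [mul_apply, h2, h1]

theorem fixed_conj {g h : pei S} {F : Filter (Fin N → ℤ)}
    (hg : ∀ᶠ x in map (h⁻¹).1 F, g.1 x = x) : ∀ᶠ x in F, (h * g * h⁻¹).1 x = x := by
  filter_upwards [hg] with x hx
  rw [mul_apply, mul_apply, hx, apply_inv_self]

/-- The elements of `pei S` that are the identity on all germs of rank at least `k`. -/
def lay (S : Set (Fin N → ℤ)) (k : ℕ) : Subgroup (pei S) where
  carrier := {g | ∀ j ≥ k, ∀ F, IsGerm j F → ∀ᶠ x in F, g.1 x = x}
  mul_mem' hg hh j hj F hF := fixed_mul (hg j hj F hF) (hh j hj F hF)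
  one_mem' _ _ _ _ := Eventually.of_forall fun _ => rfl
  inv_mem' hg j hj F hF := fixed_inv (hg j hj F hF)

instance lay_normal (S : Set (Fin N → ℤ)) (k : ℕ) : (lay S k).Normal :=
  ⟨fun _ hn g j hj _ hF => fixed_conj (hn j hj _ (isGerm_map g⁻¹ hF))⟩

theorem lay_mono {j k : ℕ} (h : j ≤ k) : lay S j ≤ lay S k :=
  fun _ hg i hi => hg i (h.trans hi)

theorem mem_lay_of_succ {k : ℕ} {g : pei S} (hg : g ∈ lay S (k + 1))
    (h : ∀ F, IsGerm k F → ∀ᶠ x in F, g.1 x = x) : g ∈ lay S k := by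
  intro j hj
  rcases hj.eq_or_lt with rfl | hj
  · exact h
  · exact hg j hj

theorem exists_moved_germ {k : ℕ} {g : pei S} (hg : g ∈ lay S (k + 1)) (h : g ∉ lay S k) :
    ∃ F, IsGerm k F ∧ ¬ ∀ᶠ x in F, g.1 x = x := by
  by_contra! hne
  exact h (mem_lay_of_succ hg hne)

/-- Germs of rank 0 are points, so triviality on all of them means being the identity. -/
theorem lay_zero : lay S 0 = ⊥ := by
  rw [eq_bot_iff]
  intro g hg
  refine Subgroup.mem_bot.2 (Subtype.ext (Equiv.ext fun x => ?_))
  obtain ⟨b, hb, h⟩ := eventually_germ.1 (hg 0 le_rfl (germ x 0) ⟨x, 0, by simp [srk], rfl⟩)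
  have : b = x := funext fun i => (mem_orthant.1 hb i).1 rfl
  rw [this] at h
  exact h x (self_mem_orthant _ _)

theorem lay_top : lay S (N + 1) = ⊤ := by
  rw [eq_top_iff]
  rintro g - j hj F ⟨a, σ, h, -⟩
  have := srk_le σ
  omega

theorem small_moved {k : ℕ} {g : pei S} (hg : g ∈ lay S k) : Small k {x | g.1 x ≠ x} :=
  g.2.1.small_moved hg

theorem mem_lay_of_small {k : ℕ} {g : pei S} (h : Small k {x | g.1 x ≠ x}) : g ∈ lay S k :=
  fun _ hj _ hF => mem_of_superset (h.compl_mem hF hj) fun _ hx => not_not.1 hx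

theorem finite_moved_germs {k : ℕ} {g : pei S} (hg : g ∈ lay S (k + 1)) :
    {F | IsGerm k F ∧ ¬ ∀ᶠ x in F, g.1 x = x}.Finite := by
  refine (small_moved hg).finite_germs.subset ?_
  rintro F ⟨hF, h⟩
  exact ⟨hF, fun h' => h (mem_of_superset h' fun _ hx => not_not.1 hx)⟩

theorem fixed_of_not_mem (hS : IsOrthohedral S) (g : pei S) {k : ℕ} {F : Filter (Fin N → ℤ)}
    (hF : IsGerm k F) (h : S ∉ F) : ∀ᶠ x in F, g.1 x = x := by
  obtain ⟨B, hB⟩ := hS.cellUnion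
  exact mem_of_superset ((hB.mem_or_compl_mem hF).resolve_left h) fun x hx => g.2.2 x hx

theorem mem_map_germ (g : pei S) {F : Filter (Fin N → ℤ)} (h : S ∈ F) : S ∈ map g.1 F := by
  refine mem_map.2 (mem_of_superset h fun x hx => ?_)
  by_contra hgx
  have h1 := g.2.2 _ hgx
  exact hgx (by rw [Set.mem_preimage, g.1.injective h1]; exact hx)

/-! ### The rank groups -/

theorem bddAbove_ranks (X : Set (Fin N → ℤ)) :
    BddAbove {k | ∃ L, IsOrthantOfRank L k ∧ L ⊆ X} := by
  refine ⟨N, ?_⟩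
  rintro _ ⟨_, ⟨a, σ, rfl, -⟩, -⟩
  exact srk_le σ

theorem le_rk_of_mem_germ {X : Set (Fin N → ℤ)} {k : ℕ} {F : Filter (Fin N → ℤ)}
    (hF : IsGerm k F) (h : X ∈ F) : k ≤ rk X := by
  obtain ⟨a, σ, hσ, rfl⟩ := hF
  obtain ⟨b, -, hb⟩ := eventually_germ.1 h
  exact le_csSup (bddAbove_ranks X) ⟨_, ⟨b, σ, hσ, rfl⟩, hb⟩

theorem exists_germ_rk {X : Set (Fin N → ℤ)} (h : X.Nonempty) :
    ∃ F, IsGerm (rk X) F ∧ X ∈ F := by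
  obtain ⟨x, hx⟩ := h
  have hne : {k | ∃ L, IsOrthantOfRank L k ∧ L ⊆ X}.Nonempty := by
    refine ⟨0, _, ⟨x, 0, by simp, rfl⟩, fun y hy => ?_⟩
    have : y = x := funext fun i => (mem_orthant.1 hy i).1 rfl
    rwa [this]
  obtain ⟨_, ⟨a, σ, hσ, rfl⟩, hL⟩ := Nat.sSup_mem hne (bddAbove_ranks X)
  exact ⟨_, ⟨a, σ, hσ, rfl⟩, mem_of_superset (orthant_mem_germ a σ) hL⟩

theorem Small.rk_le {X : Set (Fin N → ℤ)} {k : ℕ} (h : Small (k + 1) X) : rk X ≤ k := by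
  refine csSup_le' ?_
  rintro j ⟨_, ⟨a, σ, hσ, rfl⟩, hL⟩
  by_contra hj
  have h1 := h.compl_mem (F := germ a σ) ⟨a, σ, hσ, rfl⟩ (not_le.1 hj)
  obtain ⟨y, hy, hy'⟩ := nonempty_of_mem (inter_mem h1 (orthant_mem_germ a σ))
  exact hy (hL hy')

/-- The thickening is a union of finitely many translates of the covering orthants. It is needed
because `supp g` may also contain fixed points of `g`. -/
theorem Small.neighbourhood {X : Set (Fin N → ℤ)} {k : ℕ} (h : Small k X) :
    Small k {x | ∃ v : Fin N → ℤ, (∀ i, -1 ≤ v i ∧ v i ≤ 1) ∧ x + v ∈ X} := by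
  obtain ⟨Λ, h1, h2, h3⟩ := h
  have hV : {v : Fin N → ℤ | ∀ i, -1 ≤ v i ∧ v i ≤ 1}.Finite :=
    (Set.finite_Icc (fun _ => (-1 : ℤ)) (fun _ => (1 : ℤ))).subset
      fun v hv => ⟨fun i => (hv i).1, fun i => (hv i).2⟩
  refine ⟨Set.image2 (fun L v => (fun x => x + v) ⁻¹' L) Λ {v | ∀ i, -1 ≤ v i ∧ v i ≤ 1},
    h1.image2 _ hV, ?_, ?_⟩
  · rintro _ ⟨L, hL, v, -, rfl⟩
    obtain ⟨j, hj, a, σ, hσ, rfl⟩ := h2 L hL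
    refine ⟨j, hj, a - v, σ, hσ, ?_⟩
    ext x
    rw [Set.mem_preimage, ← mem_orthant_add (a := a - v) (v := v), sub_add_cancel]
  · rintro x ⟨v, hv, hx⟩
    obtain ⟨L, hL, hxL⟩ := h3 hx
    exact ⟨_, ⟨L, hL, v, hv, rfl⟩, hxL⟩

/-- If `g` fixed a point of an isometric orthant and all neighbours of the point, rigidity
(`aff_eq_self_of_fixed`) would make `g` trivial on the orthant. So every point of the support is
within sup-distance 1 of a moved point. -/
theorem supp_subset (g : Equiv.Perm (Fin N → ℤ)) :
    supp g ⊆ {x | ∃ v : Fin N → ℤ, (∀ i, -1 ≤ v i ∧ v i ≤ 1) ∧ x + v ∈ {y | g y ≠ y}} := by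
  rintro x ⟨L, ⟨⟨_, a, σ, -, rfl⟩, hiso, z, hz, hgz⟩, hx⟩
  obtain ⟨π, ε, c, h⟩ := hiso.exists_aff
  by_contra hne
  have hfix : ∀ v : Fin N → ℤ, (∀ i, -1 ≤ v i ∧ v i ≤ 1) → g (x + v) = x + v := by
    intro v hv
    by_contra hg
    exact hne ⟨v, hv, hg⟩
  refine hgz ?_
  rw [h z hz]
  refine aff_eq_self_of_fixed hx ?_ (fun i => ?_) hz
  · rw [← h x hx]
    simpa using hfix 0 (by simp)
  · rw [← h]
    · refine hfix _ fun j => ?_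
      by_cases hj : j = i
      · subst hj
        rw [Pi.single_eq_same]
        generalize σ j = s
        revert s
        decide
      · rw [Pi.single_eq_of_ne hj]
        decide
    · refine orthant_subset hx fun j => ?_
      by_cases hj : j = i
      · subst hj; exact ⟨1, by simp⟩
      · exact ⟨0, by simp [hj]⟩

theorem rankGroup_eq_lay (S : Set (Fin N → ℤ)) (k : ℕ) :
    rankGroup S k = (lay S (k + 1) : Set (pei S)) := by
  ext g
  constructor
  · intro hg j hj F hF
    obtain ⟨π, ε, c, h⟩ := pei_exists_aff g hF
    obtain ⟨a, σ, hσ, rfl⟩ := hF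
    obtain ⟨b, hb, h⟩ := eventually_germ.1 h
    refine eventually_germ.2 ⟨b, hb, ?_⟩
    -- The representing orthant is one on which `g` is affine, hence isometric; a single moved point
    -- puts all of it into the support.
    by_contra! hne
    have hj' : j ≤ rk (supp g.1) := by
      refine le_csSup (bddAbove_ranks _) ⟨orthant b σ, ⟨b, σ, hσ, rfl⟩,
        Set.subset_sUnion_of_mem ⟨isOrthant_orthant _ _, fun x hx y hy => ?_, hne⟩⟩
      rw [h x hx, h y hy, sqDist_aff]
    have hg : rk (supp g.1) ≤ k := hg
    omega
  · intro hg
    exact ((small_moved hg).neighbourhood.mono (supp_subset g.1)).rk_le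

/-! ### Elements acting by translations on germs -/

theorem eventually_of_map_eq {g : pei S} {F : Filter (Fin N → ℤ)} (h : map g.1 F = F)
    {p : (Fin N → ℤ) → Prop} (hp : ∀ᶠ x in F, p x) : ∀ᶠ x in F, p (g.1 x) := by
  rw [← h] at hp
  exact hp

/-- The elements of `lay S (k + 1)` that fix all germs of rank `k` and act on them by
translations. -/
def trl (S : Set (Fin N → ℤ)) (k : ℕ) : Subgroup (pei S) where
  carrier := {g | g ∈ lay S (k + 1) ∧
    ∀ F, IsGerm k F → map g.1 F = F ∧ ∃ v, ∀ᶠ x in F, g.1 x = x + v}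
  mul_mem' := by
    rintro g h ⟨hg, hg'⟩ ⟨hh, hh'⟩
    refine ⟨mul_mem hg hh, fun F hF => ?_⟩
    obtain ⟨e1, v, hv⟩ := hg' F hF
    obtain ⟨e2, w, hw⟩ := hh' F hF
    refine ⟨by rw [map_mul_germ, e2, e1], w + v, ?_⟩
    filter_upwards [hw, eventually_of_map_eq e2 hv] with x h1 h2
    rw [mul_apply, h2, h1, add_assoc]
  one_mem' := ⟨one_mem _, fun _ _ => ⟨map_id, 0, Eventually.of_forall fun _ => (add_zero _).symm⟩⟩
  inv_mem' := by
    rintro g ⟨hg, hg'⟩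
    refine ⟨inv_mem hg, fun F hF => ?_⟩
    obtain ⟨e1, v, hv⟩ := hg' F hF
    have e2 : map (g⁻¹).1 F = F := by
      conv_lhs => rw [← e1]
      exact map_inv_map g F
    refine ⟨e2, -v, ?_⟩
    filter_upwards [eventually_of_map_eq e2 hv] with x hx
    rw [apply_inv_self] at hx
    rw [eq_add_neg_iff_add_eq]
    exact hx.symm

theorem trl_le (S : Set (Fin N → ℤ)) (k : ℕ) : trl S k ≤ lay S (k + 1) := fun _ h => h.1

instance trl_normal (S : Set (Fin N → ℤ)) (k : ℕ) : (trl S k).Normal := by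
  refine ⟨fun n hn h => ⟨(lay_normal S (k + 1)).conj_mem n hn.1 h, fun F hF => ?_⟩⟩
  have hF' := isGerm_map h⁻¹ hF
  obtain ⟨e, v, hv⟩ := hn.2 _ hF'
  obtain ⟨π, ε, c, hc⟩ := pei_exists_aff h hF'
  refine ⟨by rw [map_mul_germ, map_mul_germ, e, map_map_inv], lin π ε v, ?_⟩
  filter_upwards [hv, hc, eventually_of_map_eq e hc] with x h1 h2 h3
  rw [mul_apply, mul_apply, h3, h1, aff_add, ← h2, apply_inv_self]

theorem pow_translation {g : pei S} {F : Filter (Fin N → ℤ)} {v : Fin N → ℤ} (e : map g.1 F = F)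
    (h : ∀ᶠ x in F, g.1 x = x + v) (n : ℕ) : ∀ᶠ x in F, (g ^ n).1 x = x + n • v := by
  induction n with
  | zero => exact Eventually.of_forall fun x => by simp
  | succ n ih =>
    filter_upwards [h, eventually_of_map_eq e ih] with x h1 h2
    rw [pow_succ, mul_apply, h2, h1, add_assoc, succ_nsmul, add_comm v]

theorem translation_eq_zero {g : pei S} {F : Filter (Fin N → ℤ)} [F.NeBot] {v : Fin N → ℤ}
    (h : ∀ᶠ x in F, g.1 x = x + v) (h' : ∀ᶠ x in F, g.1 x = x) : v = 0 := by
  obtain ⟨x, h1, h2⟩ := (h.and h').exists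
  rw [h2] at h1
  exact left_eq_add.1 h1

/-- Translation vectors lie in a torsion-free group, so `trl S k` is torsion-free modulo `lay S k`.
-/
theorem mem_lay_of_pow_mem {k : ℕ} {g : pei S} (hg : g ∈ trl S k) {n : ℕ} (hn : n ≠ 0)
    (h : g ^ n ∈ lay S k) : g ∈ lay S k := by
  refine mem_lay_of_succ hg.1 fun F hF => ?_
  obtain ⟨e, v, hv⟩ := hg.2 F hF
  have := hF.neBot
  have h0 := translation_eq_zero (pow_translation e hv n) (h k le_rfl F hF)
  have hv0 : v = 0 := (smul_eq_zero.1 h0).resolve_left hn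
  simpa [hv0] using hv

/-- Since `⁅g, h⁆ * (h * g) = g * h`, the commutator has to be read on the image of `F` under `h *
g`. -/
theorem commute_of_commutator_mem {k : ℕ} {g h : pei S} (hgh : ⁅g, h⁆ ∈ lay S k)
    {F : Filter (Fin N → ℤ)} (hF : IsGerm k F) : ∀ᶠ x in F, g.1 (h.1 x) = h.1 (g.1 x) := by
  have := hgh k le_rfl _ (isGerm_map (h * g) hF)
  rw [eventually_map] at this
  filter_upwards [this] with x hx
  rw [← mul_apply, commutatorElement_def] at hx
  have e : g * h * g⁻¹ * h⁻¹ * (h * g) = g * h := by group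
  rwa [e] at hx

theorem commutator_trl_mem {k : ℕ} {g h : pei S} (hg : g ∈ trl S k) (hh : h ∈ trl S k) :
    ⁅g, h⁆ ∈ lay S k := by
  refine mem_lay_of_succ (Subgroup.commutator_le_left _ _ (Subgroup.commutator_mem_commutator
    hg.1 hh.1)) fun F hF => ?_
  obtain ⟨e1, v, hv⟩ := hg.2 F hF
  obtain ⟨e2, w, hw⟩ := hh.2 F hF
  have e : map (h * g).1 F = F := by rw [map_mul_germ, e1, e2]
  rw [← e, eventually_map]
  filter_upwards [hv, hw, eventually_of_map_eq e1 hw, eventually_of_map_eq e2 hv]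
    with x h1 h2 h3 h4
  rw [← mul_apply]
  have e : ⁅g, h⁆ * (h * g) = g * h := by rw [commutatorElement_def]; group
  rw [e, mul_apply, mul_apply, h4, h3, h1, h2]
  abel

/-! ### Constructions of elements of `pei S` -/

/-- The permutation that agrees with an affine signed permutation `A` on an orthant `Q`, with `A⁻¹`
on `A Q`, and with the identity elsewhere. -/
theorem exists_local_involution {a : Fin N → ℤ} {σ : Fin N → SignType} (π : Equiv.Perm (Fin N))
    (ε : Fin N → ℤˣ) (c : Fin N → ℤ) (hQ : orthant a σ ⊆ S)
    (hAQ : orthant (aff π ε c a) (sgnMap π ε σ) ⊆ S)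
    (hinv : ∀ x ∈ orthant a σ, aff π ε c x ∈ orthant a σ → aff π ε c (aff π ε c x) = x) :
    ∃ g : pei S, g ∈ lay S (srk σ + 1) ∧ (∀ᶠ x in germ a σ, g.1 x = aff π ε c x) ∧
      (∀ᶠ x in map (aff π ε c) (germ a σ), g.1 x = (aff π ε c).symm x) ∧
      ∀ F, IsGerm (srk σ) F → F ≠ germ a σ → F ≠ map (aff π ε c) (germ a σ) →
        ∀ᶠ x in F, g.1 x = x := by
  classical
  set A := aff π ε c with hA
  have hAQ' : A '' orthant a σ = orthant (A a) (sgnMap π ε σ) := image_aff_orthant π ε c a σ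
  have hmem : ∀ x, A.symm x ∈ orthant a σ ↔ x ∈ orthant (A a) (sgnMap π ε σ) := by
    intro x
    rw [← hAQ', Equiv.image_eq_preimage_symm]
    rfl
  let f : (Fin N → ℤ) → (Fin N → ℤ) := fun x =>
    if x ∈ orthant a σ then A x else if A.symm x ∈ orthant a σ then A.symm x else x
  have f1 : ∀ x ∈ orthant a σ, f x = A x := fun x hx => by simp only [f, if_pos hx]
  -- The prescriptions `A` on `Q` and `A⁻¹` on `A Q` agree on the overlap because of `hinv`. The
  -- lemma is used both for disjoint `Q`, `A Q` and for reflections of `Q`.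
  have f2 : ∀ x ∈ orthant a σ, f (A x) = x := fun x hx => by
    by_cases h : A x ∈ orthant a σ
    · rw [f1 _ h, hinv x hx h]
    · simp only [f, if_neg h, Equiv.symm_apply_apply, if_pos hx]
  have f3 : ∀ x, x ∉ orthant a σ → A.symm x ∉ orthant a σ → f x = x := fun x h1 h2 => by
    simp only [f, if_neg h1, if_neg h2]
  have f4 : ∀ x, A.symm x ∈ orthant a σ → f x = A.symm x := fun x h => by
    have := f2 _ h
    rwa [Equiv.apply_symm_apply] at this
  have ff : Function.Involutive f := by
    intro x
    by_cases h1 : x ∈ orthant a σ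
    · rw [f1 x h1, f2 x h1]
    · by_cases h2 : A.symm x ∈ orthant a σ
      · rw [f4 x h2, f1 _ h2, Equiv.apply_symm_apply]
      · rw [f3 x h1 h2, f3 x h1 h2]
  have hpei : IsPei f := by
    obtain ⟨B, hB⟩ := cellUnion_orthant a σ
    obtain ⟨C, hC⟩ := cellUnion_orthant (A a) (sgnMap π ε σ)
    refine isPei_of_cells (max B C) fun x => ?_
    have hB' : ∀ y ∈ {y | clamp (max B C) y = clamp (max B C) x},
        (y ∈ orthant a σ ↔ x ∈ orthant a σ) :=
      fun y hy => hB.mono (le_max_left _ _) y x hy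
    have hC' : ∀ y ∈ {y | clamp (max B C) y = clamp (max B C) x},
        (A.symm y ∈ orthant a σ ↔ A.symm x ∈ orthant a σ) := fun y hy => by
      rw [hmem, hmem]
      exact hC.mono (le_max_right _ _) y x hy
    intro y hy z hz
    by_cases h1 : x ∈ orthant a σ
    · rw [f1 y ((hB' y hy).2 h1), f1 z ((hB' z hz).2 h1), sqDist_aff]
    · by_cases h2 : A.symm x ∈ orthant a σ
      · rw [f4 y ((hC' y hy).2 h2), f4 z ((hC' z hz).2 h2), hA, aff_symm, sqDist_aff]
      · rw [f3 y (mt (hB' y hy).1 h1) (mt (hC' y hy).1 h2),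
          f3 z (mt (hB' z hz).1 h1) (mt (hC' z hz).1 h2)]
  let g : pei S := ⟨ff.toPerm f, hpei, fun x hx => f3 x (fun h => hx (hQ h))
    fun h => hx (hAQ ((hmem x).1 h))⟩
  have hsmall : Small (srk σ + 1) {x | g.1 x ≠ x} := by
    refine ⟨{orthant a σ, orthant (A a) (sgnMap π ε σ)}, Set.toFinite _, ?_, ?_⟩
    · rintro L (rfl | rfl)
      · exact ⟨_, Nat.lt_succ_self _, _, _, rfl, rfl⟩
      · exact ⟨srk σ, Nat.lt_succ_self _, _, _, srk_sgnMap π ε σ, rfl⟩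
    · intro x hx
      by_contra hne
      simp only [Set.sUnion_insert, Set.sUnion_singleton, Set.mem_union, not_or] at hne
      exact hx (f3 x hne.1 (mt (hmem x).1 hne.2))
  refine ⟨g, mem_lay_of_small hsmall, mem_of_superset (orthant_mem_germ a σ) f1, ?_, ?_⟩
  · rw [map_aff_germ]
    exact mem_of_superset (orthant_mem_germ _ _) fun x hx => f4 x ((hmem x).2 hx)
  · intro F hF h1 h2
    have key : ∀ b τ, srk τ = srk σ → F ≠ germ b τ → (orthant b τ)ᶜ ∈ F := by
      intro b τ hτ hne
      obtain ⟨B, hB⟩ := cellUnion_orthant b τ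
      refine (hB.mem_or_compl_mem hF).resolve_left fun h => hne ?_
      obtain ⟨d, ρ, hρ, rfl⟩ := hF
      exact germ_eq_of_orthant_mem h (by omega)
    have k2 := key _ _ (srk_sgnMap π ε σ) (by rw [← map_aff_germ π ε c]; exact h2)
    filter_upwards [key a σ rfl h1, k2] with x hx1 hx2
    exact f3 x hx1 (mt (hmem x).1 hx2)

/-- Signed permutations act transitively on sign vectors with a given number of nonzero entries, so
any two orthants of equal rank are congruent. -/
theorem exists_sgnMap_eq {σ τ : Fin N → SignType} (h : srk σ = srk τ) :
    ∃ π ε, sgnMap π ε σ = τ := by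
  classical
  have e : {j // τ j ≠ 0} ≃ {i // σ i ≠ 0} := Fintype.equivOfCardEq (by
    rw [Fintype.card_subtype, Fintype.card_subtype]
    exact h.symm)
  have h1 : ∀ j, τ j ≠ 0 → σ (e.extendSubtype j) ≠ 0 := fun j hj => e.extendSubtype_mem j hj
  have h2 : ∀ j, τ j = 0 → σ (e.extendSubtype j) = 0 := fun j hj =>
    not_not.1 (e.extendSubtype_not_mem j (not_not.2 hj))
  have h3 : ∀ s t : SignType, (t ≠ 0 → s ≠ 0) → (t = 0 → s = 0) →
      ∃ u : ℤˣ, SignType.sign (u : ℤ) * s = t := by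
    intro s t
    rcases s.trichotomy with rfl | rfl | rfl <;> rcases t.trichotomy with rfl | rfl | rfl <;>
      intro h h' <;> simp at h h' <;> first
        | (refine ⟨1, ?_⟩; simp; done)
        | (refine ⟨-1, ?_⟩; simp)
  choose ε hε using fun j => h3 (σ (e.extendSubtype j)) (τ j) (h1 j) (h2 j)
  exact ⟨e.extendSubtype, ε, funext hε⟩

theorem exists_disjoint_orthants {k : ℕ} {F F' : Filter (Fin N → ℤ)} (hF : IsGerm k F)
    (hF' : IsGerm k F') (hne : F ≠ F') (hS : S ∈ F) (hS' : S ∈ F') :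
    ∃ a σ b τ, srk σ = k ∧ srk τ = k ∧ F = germ a σ ∧ F' = germ b τ ∧ orthant a σ ⊆ S ∧
      orthant b τ ⊆ S ∧ Disjoint (orthant a σ) (orthant b τ) := by
  obtain ⟨a, σ, hσ, rfl⟩ := hF
  obtain ⟨a', ha', haS⟩ := eventually_germ.1 hS
  obtain ⟨B, hB⟩ := cellUnion_orthant a' σ
  have h1 : (orthant a' σ)ᶜ ∈ F' := by
    refine (hB.mem_or_compl_mem hF').resolve_left fun h => hne ?_
    obtain ⟨b, τ, hτ, rfl⟩ := hF'
    rw [germ_eq_of_orthant_mem h (by omega), germ_eq_of_mem ha']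
  obtain ⟨b, τ, hτ, rfl⟩ := hF'
  obtain ⟨b', hb', hbS⟩ := eventually_germ.1 (inter_mem hS' h1)
  exact ⟨a', σ, b', τ, hσ, hτ, (germ_eq_of_mem ha').symm, (germ_eq_of_mem hb').symm, haS,
    fun x hx => (hbS x hx).1, Set.disjoint_left.2 fun x hx hx' => (hbS x hx').2 hx⟩

theorem map_add_germ (a : Fin N → ℤ) {σ : Fin N → SignType} {v : Fin N → ℤ}
    (hv : ∀ i, σ i = 0 → v i = 0) : map (fun x => x + v) (germ a σ) = germ a σ := by
  have h := map_aff_germ 1 1 v a σ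
  have e1 : (aff 1 1 v : (Fin N → ℤ) → Fin N → ℤ) = fun x => x + v := by
    funext x j
    simp [aff_apply]
  have e2 : sgnMap 1 1 σ = σ := by
    funext j
    simp [sgnMap]
  rw [e1, e2] at h
  rw [h]
  exact germ_congr fun i hi => by simp [hv i hi]

theorem map_eq_of_translation {g : pei S} {a : Fin N → ℤ} {σ : Fin N → SignType} {v : Fin N → ℤ}
    (hv : ∀ i, σ i = 0 → v i = 0) (h : ∀ᶠ x in germ a σ, g.1 x = x + v) :
    map g.1 (germ a σ) = germ a σ := by
  rw [map_congr h, map_add_germ a hv]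

theorem aff_target_eq (π : Equiv.Perm (Fin N)) (ε : Fin N → ℤˣ) (a b : Fin N → ℤ) :
    aff π ε (b - lin π ε a) a = b := by
  funext j
  simp [aff_apply, lin]

/-- Two distinct germs of the same rank in `S` can be interchanged. -/
theorem exists_swap {k : ℕ} {F F' : Filter (Fin N → ℤ)} (hF : IsGerm k F) (hF' : IsGerm k F')
    (hne : F ≠ F') (hS : S ∈ F) (hS' : S ∈ F') :
    ∃ g : pei S, g ∈ lay S (k + 1) ∧ map g.1 F = F' ∧ map g.1 F' = F ∧
      ∀ E, IsGerm k E → E ≠ F → E ≠ F' → ∀ᶠ x in E, g.1 x = x := by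
  obtain ⟨a, σ, b, τ, hσ, hτ, rfl, rfl, haS, hbS, hd⟩ :=
    exists_disjoint_orthants hF hF' hne hS hS'
  obtain ⟨π, ε, rfl⟩ := exists_sgnMap_eq (hσ.trans hτ.symm)
  have e := aff_target_eq π ε a b
  have himg := image_aff_orthant π ε (b - lin π ε a) a σ
  have hmap := map_aff_germ π ε (b - lin π ε a) a σ
  rw [e] at himg hmap
  obtain ⟨g, h1, h2, h3, h4⟩ := exists_local_involution π ε (b - lin π ε a) haS (by rwa [e])
    fun x hx hx' => (Set.disjoint_left.1 hd hx' (himg ▸ Set.mem_image_of_mem _ hx)).elim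
  rw [hmap] at h3 h4
  subst hσ
  refine ⟨g, h1, by rw [map_congr h2, hmap], ?_, h4⟩
  rw [map_congr h3, ← hmap, map_map]
  convert map_id
  funext x
  simp

/-- Two distinct germs of positive rank in `S` can be translated in opposite directions. -/
theorem exists_translation_pair {k : ℕ} {F F' : Filter (Fin N → ℤ)} (hF : IsGerm k F)
    (hF' : IsGerm k F') (hne : F ≠ F') (hS : S ∈ F) (hS' : S ∈ F') :
    ∃ t ∈ trl S k, ∃ a σ b τ, srk σ = k ∧ srk τ = k ∧ F = germ a σ ∧ F' = germ b τ ∧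
      (∀ᶠ x in F, t.1 x = x - vec σ) ∧ ∀ᶠ x in F', t.1 x = x + vec τ := by
  obtain ⟨a, σ, b, τ, hσ, hτ, rfl, rfl, haS, hbS, hd⟩ :=
    exists_disjoint_orthants hF hF' hne hS hS'
  obtain ⟨π, ε, rfl⟩ := exists_sgnMap_eq (hσ.trans hτ.symm)
  set τ := sgnMap π ε σ with hτd
  have hb' : b + vec τ ∈ orthant b τ := by simpa using shift_mem_orthant b τ 1
  have key : ∀ b', b' ∈ orthant b τ → ∃ g : pei S, g ∈ lay S (srk σ + 1) ∧
      map g.1 (germ a σ) = germ b τ ∧ map g.1 (germ b τ) = germ a σ ∧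
      (∀ᶠ x in germ a σ, g.1 x = aff π ε (b' - lin π ε a) x) ∧
      (∀ᶠ x in germ b τ, g.1 x = (aff π ε (b' - lin π ε a)).symm x) ∧
      ∀ F, IsGerm (srk σ) F → F ≠ germ a σ → F ≠ germ b τ → ∀ᶠ x in F, g.1 x = x := by
    intro b' hb'
    have e := aff_target_eq π ε a b'
    have himg := image_aff_orthant π ε (b' - lin π ε a) a σ
    have hmap := map_aff_germ π ε (b' - lin π ε a) a σ
    rw [e, ← hτd] at himg hmap
    rw [germ_eq_of_mem hb'] at hmap
    obtain ⟨g, h1, h2, h3, h4⟩ := exists_local_involution π ε (b' - lin π ε a) haS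
      (by rw [e]; exact (orthant_subset hb').trans hbS)
      fun x hx hx' => (Set.disjoint_left.1 hd hx' (orthant_subset hb'
        (himg ▸ Set.mem_image_of_mem _ hx))).elim
    rw [hmap] at h3 h4
    refine ⟨g, h1, by rw [map_congr h2, hmap], ?_, h2, h3, h4⟩
    rw [map_congr h3, ← hmap, map_map]
    convert map_id
    funext x
    simp
  -- Both `g` and `h` interchange the two germs, but `h` aims at the orthant moved by `vec τ`. The
  -- discrepancy makes `h * g` a translation on each germ, inwards on one and outwards on the other.
  obtain ⟨g, g1, g2, g3, g4, g5, g6⟩ := key b (self_mem_orthant b τ)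
  obtain ⟨h, h1, h2, h3, h4, h5, h6⟩ := key (b + vec τ) hb'
  have hA : ∀ x, aff π ε (b + vec τ - lin π ε a) x = aff π ε (b - lin π ε a) x + vec τ := by
    intro x
    rw [aff_eq_add π ε (b - lin π ε a)]
    congr 1
    abel
  have c1 : ∀ᶠ x in germ a σ, (h * g).1 x = x - vec σ := by
    rw [← g2] at h5
    filter_upwards [g4, h5] with x hx hy
    rw [mul_apply, hy, hx, Equiv.symm_apply_eq, sub_eq_add_neg x, aff_add, hA]
    have : lin π ε (-vec σ) = - vec τ := by
      have := lin_smul π ε (-1) (vec σ)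
      rwa [neg_one_smul, neg_one_smul, lin_vec] at this
    rw [this]
    abel
  have c2 : ∀ᶠ x in germ b τ, (h * g).1 x = x + vec τ := by
    rw [← g3] at h4
    filter_upwards [g5, h4] with x hx hy
    rw [mul_apply, hy, hx, hA, Equiv.apply_symm_apply]
  subst hσ
  refine ⟨h * g, ⟨mul_mem h1 g1, fun E hE => ?_⟩, a, σ, b, τ, rfl, hτ, rfl, rfl, c1, c2⟩
  by_cases e1 : E = germ a σ
  · subst e1
    simp only [sub_eq_add_neg] at c1
    refine ⟨map_eq_of_translation ?_ c1, _, c1⟩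
    intro i hi
    simp [vec, hi]
  by_cases e2 : E = germ b τ
  · subst e2
    refine ⟨map_eq_of_translation ?_ c2, _, c2⟩
    intro i hi
    simp [vec, hi]
  · have := fixed_mul (h6 E hE e1 e2) (g6 E hE e1 e2)
    exact ⟨map_eq_self_of_fixed this, 0, by simpa using this⟩

/-- A germ in `S` with two different directions can be translated along their difference. -/
theorem exists_translation_single {a : Fin N → ℤ} {σ : Fin N → SignType} (hS : S ∈ germ a σ)
    {i j : Fin N} (hij : i ≠ j) (hi : σ i ≠ 0) (hj : σ j ≠ 0) :
    ∃ t ∈ trl S (srk σ), ∀ᶠ x in germ a σ,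
      t.1 x = x + (Pi.single i (σ i : ℤ) - Pi.single j (σ j : ℤ)) := by
  classical
  obtain ⟨a', ha', haS⟩ := eventually_germ.1 hS
  rw [← germ_eq_of_mem ha']
  clear hS ha' a
  rename' a' => a
  have hu : (σ i * σ j : ℤ) * (σ i * σ j : ℤ) = 1 := by
    rw [mul_mul_mul_comm, sign_sq hi, sign_sq hj]; rfl
  -- The sign `σ i * σ j` makes the exchange of the coordinates `i` and `j` preserve the sign vector
  -- `σ`.
  let u : ℤˣ := ⟨_, _, hu, hu⟩
  let π : Equiv.Perm (Fin N) := Equiv.swap i j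
  let ε : Fin N → ℤˣ := fun l => if l = i ∨ l = j then u else 1
  have hlin : ∀ v : Fin N → ℤ, lin π ε (lin π ε v) = v := by
    intro v
    funext l
    simp only [lin, π, ε]
    by_cases h1 : l = i
    · subst h1
      simp [← mul_assoc, u, hu]
    · by_cases h2 : l = j
      · subst h2
        simp [← mul_assoc, u, hu]
      · simp [h1, h2, Equiv.swap_apply_of_ne_of_ne h1 h2]
  have hσ : sgnMap π ε σ = σ := by
    have hs : ∀ s t : SignType, t ≠ 0 → SignType.sign ((s : ℤ) * t) * t = s := by decide
    funext l
    simp only [sgnMap, π, ε]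
    by_cases h1 : l = i
    · subst h1
      simpa [u] using hs (σ l) (σ j) hj
    · by_cases h2 : l = j
      · subst h2
        simpa [u, mul_comm] using hs (σ l) (σ i) hi
      · simp [h1, h2, Equiv.swap_apply_of_ne_of_ne h1 h2]
  have key : ∀ b ∈ orthant a σ, ∃ g : pei S, g ∈ lay S (srk σ + 1) ∧
      map g.1 (germ a σ) = germ a σ ∧
      (∀ᶠ x in germ a σ, g.1 x = aff π ε (b - lin π ε b) x) ∧
      ∀ F, IsGerm (srk σ) F → F ≠ germ a σ → ∀ᶠ x in F, g.1 x = x := by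
    intro b hb
    have e := aff_target_eq π ε b b
    have hmap := map_aff_germ π ε (b - lin π ε b) b σ
    rw [e, hσ] at hmap
    have hbS := (orthant_subset hb).trans haS
    obtain ⟨g, h1, h2, h3, h4⟩ := exists_local_involution π ε (b - lin π ε b) hbS
      (by rwa [e, hσ]) (fun x _ _ => by
        have ex : x = b + (x - b) := by abel
        rw [ex, aff_add, e, aff_add, e, hlin])
    rw [hmap, germ_eq_of_mem hb] at h4
    rw [germ_eq_of_mem hb] at h2 hmap
    exact ⟨g, h1, by rw [map_congr h2, hmap], h2, fun F hF hne => h4 F hF hne hne⟩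
  -- The product of the reflections through `a` and through `a + w`, both with linear part `lin π
  -- ε`, is the translation by `w - lin π ε w`. Here `w` is the unit vector in direction `i`, and
  -- its image is the one in direction `j`.
  obtain ⟨g, g1, g2, g3, g4⟩ := key a (self_mem_orthant a σ)
  obtain ⟨h, h1, h2, h3, h4⟩ := key (a + Pi.single i (σ i : ℤ)) (fun l => by
    by_cases hl : l = i
    · subst hl; exact ⟨1, by simp⟩
    · exact ⟨0, by simp [hl]⟩)
  set w : Fin N → ℤ := Pi.single i (σ i : ℤ) with hw
  have hlw : lin π ε w = Pi.single j (σ j : ℤ) := by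
    funext l
    simp only [lin, π, ε, hw]
    by_cases h1 : l = j
    · subst h1
      simp only [or_true, if_true, Equiv.swap_apply_right, Pi.single_eq_same, u]
      rw [mul_comm, ← mul_assoc, sign_sq hi, one_mul]
    · rw [Pi.single_eq_of_ne h1]
      have : Equiv.swap i j l ≠ i := by
        intro h
        rw [Equiv.swap_apply_eq_iff, Equiv.swap_apply_left] at h
        exact h1 h
      rw [Pi.single_eq_of_ne this, mul_zero]
  have c1 : ∀ᶠ x in germ a σ, (h * g).1 x = x + (w - Pi.single j (σ j : ℤ)) := by
    rw [← g2] at h3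
    filter_upwards [g3, h3] with x hx hy
    rw [mul_apply, hy, hx]
    have ex : x = a + (x - a) := by abel
    conv_lhs => rw [ex]
    rw [aff_add, aff_target_eq]
    have ey : a + lin π ε (x - a) = (a + w) + (lin π ε (x - a) + -w) := by abel
    have hadd : ∀ u v : Fin N → ℤ, lin π ε (u + v) = lin π ε u + lin π ε v := fun u v => by
      funext l
      simp only [lin, Pi.add_apply]
      ring
    have hneg : lin π ε (-w) = - Pi.single j (σ j : ℤ) := by
      have := lin_smul π ε (-1) w
      rwa [neg_one_smul, neg_one_smul, hlw] at this
    rw [ey, aff_add, aff_target_eq, hadd, hlin, hneg]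
    abel
  refine ⟨h * g, ⟨mul_mem h1 g1, fun E hE => ?_⟩, c1⟩
  by_cases e1 : E = germ a σ
  · subst e1
    refine ⟨map_eq_of_translation ?_ c1, _, c1⟩
    intro l hl
    have hli : l ≠ i := fun h => hi (h ▸ hl)
    have hlj : l ≠ j := fun h => hj (h ▸ hl)
    simp [hw, hli, hlj]
  · have := fixed_mul (h4 E hE e1) (g4 E hE e1)
    exact ⟨map_eq_self_of_fixed this, 0, by simpa using this⟩

theorem germ_zero (x : Fin N → ℤ) : germ x 0 = pure x := by
  ext X
  rw [mem_pure]
  constructor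
  · intro h
    obtain ⟨b, hb, h⟩ := eventually_germ.1 h
    have : b = x := funext fun i => (mem_orthant.1 hb i).1 rfl
    exact h x (this ▸ self_mem_orthant _ _)
  · intro h
    refine eventually_germ.2 ⟨x, self_mem_orthant _ _, fun y hy => ?_⟩
    have : y = x := funext fun i => (mem_orthant.1 hy i).1 rfl
    exact this ▸ h

theorem isGerm_pure (x : Fin N → ℤ) : IsGerm 0 (pure x) :=
  ⟨x, 0, by simp [srk], (germ_zero x).symm⟩

theorem exists_apply_eq {x y : Fin N → ℤ} (hx : x ∈ S) (hy : y ∈ S) : ∃ g : pei S, g.1 x = y := by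
  by_cases h : x = y
  · exact ⟨1, h⟩
  · obtain ⟨g, -, hg, -⟩ := exists_swap (isGerm_pure x) (isGerm_pure y)
      (fun e => h (pure_injective e)) hx hy
    rw [map_pure] at hg
    exact ⟨g, pure_injective hg⟩

/-! ### Elements supported on few germs -/

/-- The elements of `lay S (k + 1)` that are the identity on all germs of rank `k` outside `E`. -/
def layOn (S : Set (Fin N → ℤ)) (k : ℕ) (E : Set (Filter (Fin N → ℤ))) : Subgroup (pei S) where
  carrier := {g | g ∈ lay S (k + 1) ∧ ∀ F, IsGerm k F → F ∉ E → ∀ᶠ x in F, g.1 x = x}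
  mul_mem' hg hh := ⟨mul_mem hg.1 hh.1, fun F hF hE => fixed_mul (hg.2 F hF hE) (hh.2 F hF hE)⟩
  one_mem' := ⟨one_mem _, fun _ _ _ => Eventually.of_forall fun _ => rfl⟩
  inv_mem' hg := ⟨inv_mem hg.1, fun F hF hE => fixed_inv (hg.2 F hF hE)⟩

theorem layOn_mono {k : ℕ} {E E' : Set (Filter (Fin N → ℤ))} (h : E ⊆ E') :
    layOn S k E ≤ layOn S k E' :=
  fun _ hg => ⟨hg.1, fun F hF hE => hg.2 F hF fun hF' => hE (h hF')⟩

theorem fixed_of_fixed_map {g : pei S} {F : Filter (Fin N → ℤ)}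
    (h : ∀ᶠ x in map g.1 F, g.1 x = x) : ∀ᶠ x in F, g.1 x = x :=
  (eventually_map.1 h).mono fun _ hx => g.1.injective hx

theorem map_mem_of_mem_layOn {k : ℕ} {E : Set (Filter (Fin N → ℤ))} {g : pei S}
    (hg : g ∈ layOn S k E) {F : Filter (Fin N → ℤ)} (hF : IsGerm k F) (hE : F ∈ E) :
    map g.1 F ∈ E := by
  by_contra h
  have := fixed_of_fixed_map (hg.2 _ (isGerm_map g hF) h)
  rw [map_eq_self_of_fixed this] at h
  exact h hE

theorem mem_layOn_moved {k : ℕ} {g : pei S} (hg : g ∈ lay S (k + 1)) :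
    g ∈ layOn S k {F | IsGerm k F ∧ ¬ ∀ᶠ x in F, g.1 x = x} :=
  ⟨hg, fun F hF hE => by
    by_contra h
    exact hE ⟨hF, h⟩⟩

/-- Modulo `trl S k`, an element of `layOn S k E` is determined by the images and the linear parts
on the germs in `E`. -/
theorem exists_data (k : ℕ) {E : Set (Filter (Fin N → ℤ))} (hE : ∀ F ∈ E, IsGerm k F) :
    ∃ d : layOn S k E → E → E × Equiv.Perm (Fin N) × (Fin N → ℤˣ),
      ∀ g h, d g = d h → (g.1)⁻¹ * h.1 ∈ trl S k := by
  choose π ε c hc using fun (g : layOn S k E) (F : E) => pei_exists_aff g.1 (hE F.1 F.2)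
  refine ⟨fun g F => (⟨map g.1.1 F.1, map_mem_of_mem_layOn g.2 (hE F.1 F.2) F.2⟩, π g F, ε g F),
    fun g h hgh => ?_⟩
  have hmem : (g.1)⁻¹ * h.1 ∈ layOn S k E := mul_mem (inv_mem g.2) h.2
  refine ⟨hmem.1, fun F hF => ?_⟩
  by_cases hFE : F ∈ E
  · have e := congrFun hgh ⟨F, hFE⟩
    simp only [Prod.mk.injEq, Subtype.mk.injEq] at e
    obtain ⟨e1, e2, e3⟩ := e
    have hF' := isGerm_map g.1 hF
    obtain ⟨π', ε', c', hc'⟩ := pei_exists_aff (g.1)⁻¹ hF'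
    refine ⟨by rw [map_mul_germ, ← e1, map_inv_map],
      lin π' ε' (c h ⟨F, hFE⟩ - c g ⟨F, hFE⟩), ?_⟩
    have hc'' := hc'
    rw [e1] at hc''
    filter_upwards [hc g ⟨F, hFE⟩, hc h ⟨F, hFE⟩, eventually_map.1 hc', eventually_map.1 hc'']
      with x h1 h2 h3 h4
    -- With equal linear parts, `h` is `g` followed by a constant shift on the germ; the affine map
    -- describing `g⁻¹` there turns the shift into a translation of `F`.
    rw [mul_apply, h4, h2, ← e2, ← e3, aff_eq_add (π g ⟨F, hFE⟩) (ε g ⟨F, hFE⟩) (c g ⟨F, hFE⟩),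
      aff_add, ← h1, ← h3, inv_apply_self]
  · have := hmem.2 F hF hFE
    exact ⟨map_eq_self_of_fixed this, 0, by simpa using this⟩

/-- The subgroup generated by `T` is supported on the finite set of germs moved by the generators,
where `exists_data` leaves finitely many classes modulo `trl S k`. -/
theorem exists_finite_cosets (k : ℕ) {T : Set (pei S)} (hT : T.Finite)
    (hTl : T ⊆ lay S (k + 1)) :
    ∃ R : Set (pei S), R.Finite ∧ ∀ x ∈ Subgroup.closure T, ∃ y ∈ R, y⁻¹ * x ∈ trl S k := by
  let E : Set (Filter (Fin N → ℤ)) := ⋃ g ∈ T, {F | IsGerm k F ∧ ¬ ∀ᶠ x in F, g.1 x = x}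
  have hEf : E.Finite := hT.biUnion fun g hg => finite_moved_germs (hTl hg)
  have hE : ∀ F ∈ E, IsGerm k F := by
    intro F hF
    simp only [E, Set.mem_iUnion] at hF
    obtain ⟨g, -, h, -⟩ := hF
    exact h
  have hcl : Subgroup.closure T ≤ layOn S k E := by
    rw [Subgroup.closure_le]
    intro g hg
    refine layOn_mono ?_ (mem_layOn_moved (hTl hg))
    exact Set.subset_biUnion_of_mem (u := fun g : pei S =>
      {F | IsGerm k F ∧ ¬ ∀ᶠ x in F, g.1 x = x}) hg
  obtain ⟨d, hd⟩ := exists_data (S := S) k hE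
  have : Finite E := hEf
  obtain ⟨R, -, hR⟩ := Set.exists_subset_bijOn (Set.univ : Set (layOn S k E)) d
  refine ⟨Subtype.val '' R, (hR.finite_iff_finite.2 (Set.toFinite _)).image _, fun x hx => ?_⟩
  obtain ⟨y, hy, hyx⟩ := hR.surjOn (Set.mem_image_of_mem d (Set.mem_univ ⟨x, hcl hx⟩))
  exact ⟨y, ⟨y, hy, rfl⟩, hd y ⟨x, hcl hx⟩ hyx⟩

/-- Pigeonhole: two powers of `g` share a coset of `trl S k`. -/
theorem exists_pow_mem_trl {k : ℕ} {g : pei S} (hg : g ∈ lay S (k + 1)) :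
    ∃ n : ℕ, n ≠ 0 ∧ g ^ n ∈ trl S k := by
  obtain ⟨R, hR, h⟩ := exists_finite_cosets k (Set.finite_singleton g)
    (Set.singleton_subset_iff.2 hg)
  choose r hr hr' using fun n : ℕ => h (g ^ n) (pow_mem (Subgroup.subset_closure (Set.mem_singleton g)) n)
  have : Finite R := hR
  obtain ⟨m, n, hmn, e⟩ :=
    Finite.exists_ne_map_eq_of_infinite (fun n => (⟨r n, hr n⟩ : R))
  have e : r m = r n := congrArg Subtype.val e
  have key : ∀ m n : ℕ, m < n → r m = r n → g ^ (n - m) ∈ trl S k := by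
    intro m n hlt e
    have h1 := mul_mem (inv_mem (hr' m)) (hr' n)
    rw [e] at h1
    have h2 : ((r n)⁻¹ * g ^ m)⁻¹ * ((r n)⁻¹ * g ^ n) = (g ^ m)⁻¹ * g ^ n := by
      rw [mul_inv_rev, inv_inv, mul_assoc, mul_inv_cancel_left]
    rw [h2] at h1
    have h3 : g ^ n = g ^ m * g ^ (n - m) := by rw [← pow_add, Nat.add_sub_cancel' hlt.le]
    rwa [h3, inv_mul_cancel_left] at h1
  rcases lt_or_gt_of_ne hmn with hlt | hlt
  · exact ⟨n - m, by omega, key m n hlt e⟩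
  · exact ⟨m - n, by omega, key n m hlt e.symm⟩

/-! ### The maximal condition for normal subgroups -/

/-- Induction on the number of germs of `E'` outside `E`: exchange such a germ with one of `E` not
in `E'`, which leaves the other germs of `E'` in place. -/
theorem exists_map_mem {k : ℕ} {E E' : Set (Filter (Fin N → ℤ))}
    (hE : ∀ F ∈ E, IsGerm k F ∧ S ∈ F) (hEf' : E'.Finite) (hE' : ∀ F ∈ E', IsGerm k F ∧ S ∈ F)
    (hc : E'.ncard ≤ E.ncard) : ∃ h : pei S, ∀ F ∈ E', map h.1 F ∈ E := by
  obtain ⟨n, hn⟩ : ∃ n, (E' \ E).ncard ≤ n := ⟨_, le_rfl⟩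
  induction n generalizing E' with
  | zero =>
    rw [Nat.le_zero, Set.ncard_eq_zero hEf'.sdiff, Set.sdiff_eq_empty] at hn
    exact ⟨1, fun F hF => hn (by rwa [show map (1 : pei S).1 F = F from map_id])⟩
  | succ n ih =>
    by_cases h0 : E' \ E = ∅
    · exact ih hEf' hE' hc (by simp [h0])
    obtain ⟨γ, hγ, hγE⟩ := Set.nonempty_iff_ne_empty.2 h0
    obtain ⟨φ, hφ, hφE⟩ : (E \ E').Nonempty := by
      rw [Set.nonempty_iff_ne_empty, Ne, Set.sdiff_eq_empty]
      intro hsub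
      exact hγE (Set.eq_of_subset_of_ncard_le hsub hc hEf' ▸ hγ)
    obtain ⟨s, -, s1, -, s3⟩ := exists_swap (S := S) (hE' γ hγ).1 (hE φ hφ).1
      (fun e => hγE (e ▸ hφ)) (hE' γ hγ).2 (hE φ hφ).2
    have hs : ∀ F ∈ E', F ≠ γ → map s.1 F = F := fun F hF hne =>
      map_eq_self_of_fixed (s3 F (hE' F hF).1 hne fun e => hφE (e ▸ hF))
    have hsub : (map s.1 '' E') \ E ⊆ (E' \ E) \ {γ} := by
      rintro _ ⟨⟨F, hF, rfl⟩, hFE⟩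
      by_cases h : F = γ
      · rw [h, s1] at hFE
        exact absurd hφ hFE
      · rw [hs F hF h] at hFE ⊢
        exact ⟨⟨hF, hFE⟩, h⟩
    have hle : (map s.1 '' E' \ E).ncard ≤ n := by
      have h1 := Set.ncard_le_ncard hsub hEf'.sdiff.sdiff
      have h2 := Set.ncard_sdiff_singleton_lt_of_mem (s := E' \ E) ⟨hγ, hγE⟩ hEf'.sdiff
      omega
    obtain ⟨h, hh⟩ := ih (hEf'.image _) (by
      rintro _ ⟨F, hF, rfl⟩
      exact ⟨isGerm_map s (hE' F hF).1, mem_map_germ s (hE' F hF).2⟩)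
      ((Set.ncard_image_le hEf').trans hc) hle
    exact ⟨h * s, fun F hF => by
      rw [map_mul_germ]
      exact hh _ ⟨F, hF, rfl⟩⟩

/-- If the normal subgroup `M` accounts, modulo `lay S k`, for the elements of a normal subgroup
`M'` that are supported on a set of at least three germs, then it accounts for all elements of `M'`
of rank at most `k`. -/
theorem layer_reduction {k : ℕ} (hinf : {F | IsGerm k F ∧ S ∈ F}.Infinite) (hS : IsOrthohedral S)
    {E : Set (Filter (Fin N → ℤ))} (hE : ∀ F ∈ E, IsGerm k F ∧ S ∈ F) (hcard : 3 ≤ E.ncard)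
    {M M' : Subgroup (pei S)} (hM : M.Normal) (hM' : M'.Normal)
    (h : ∀ x ∈ M', x ∈ layOn S k E → ∃ y ∈ M, y⁻¹ * x ∈ lay S k)
    {x : pei S} (hx : x ∈ M') (hxl : x ∈ lay S (k + 1)) : ∃ y ∈ M, y⁻¹ * x ∈ lay S k := by
  -- Any set of at most three germs is carried into `E` by some `t`, so conjugating by `t` reduces
  -- to the hypothesis on `E`.
  have small : ∀ x ∈ M', ∀ E' : Set (Filter (Fin N → ℤ)), E'.Finite →
      (∀ F ∈ E', IsGerm k F ∧ S ∈ F) → E'.ncard ≤ 3 → x ∈ layOn S k E' →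
      ∃ y ∈ M, y⁻¹ * x ∈ lay S k := by
    intro x hx E' hf hE' hc hxE
    obtain ⟨t, ht⟩ := exists_map_mem hE hf hE' (hc.trans hcard)
    obtain ⟨y, hy, hyx⟩ := h (t * x * t⁻¹) (hM'.conj_mem x hx t)
      ⟨(lay_normal S (k + 1)).conj_mem x hxE.1 t, fun F hF hFE =>
        fixed_conj (hxE.2 _ (isGerm_map t⁻¹ hF) fun hm => hFE (by
          have := ht _ hm
          rwa [map_map_inv] at this))⟩
    refine ⟨t⁻¹ * y * t, by simpa using hM.conj_mem y hy t⁻¹, ?_⟩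
    have := (lay_normal S k).conj_mem _ hyx t⁻¹
    have e : (t⁻¹ * y * t)⁻¹ * x = t⁻¹ * (y⁻¹ * (t * x * t⁻¹)) * t⁻¹⁻¹ := by group
    rwa [e]
  obtain ⟨n, hn⟩ : ∃ n, {F | IsGerm k F ∧ ¬ ∀ᶠ y in F, x.1 y = y}.ncard ≤ n := ⟨_, le_rfl⟩
  induction n generalizing x with
  | zero =>
    exact small x hx _ (finite_moved_germs hxl) (fun F hF => ⟨hF.1, by
      by_contra hne
      exact hF.2 (fixed_of_not_mem hS x hF.1 hne)⟩) (by omega) (mem_layOn_moved hxl)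
  | succ n ih =>
    have hfin := finite_moved_germs hxl
    set V := {F | IsGerm k F ∧ ¬ ∀ᶠ y in F, x.1 y = y} with hV
    have hVS : ∀ F ∈ V, IsGerm k F ∧ S ∈ F := fun F hF => ⟨hF.1, by
      by_contra hne
      exact hF.2 (fixed_of_not_mem hS x hF.1 hne)⟩
    by_cases hle : V.ncard ≤ 3
    · exact small x hx _ hfin hVS hle (mem_layOn_moved hxl)
    obtain ⟨γ, hγ⟩ : V.Nonempty := by
      rw [← Set.ncard_pos hfin]
      omega
    have hγ' : map x.1 γ ∈ V :=
      ⟨isGerm_map x hγ.1, fun hne => hγ.2 (fixed_of_fixed_map hne)⟩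
    obtain ⟨ε, hε, hεγ⟩ : (V \ {γ, map x.1 γ}).Nonempty := by
      rw [Set.nonempty_iff_ne_empty, Ne, Set.sdiff_eq_empty]
      intro hsub
      have := Set.ncard_le_ncard hsub (Set.toFinite _)
      have := Set.ncard_insert_le γ {map x.1 γ}
      rw [Set.ncard_singleton] at this
      omega
    simp only [Set.mem_insert_iff, Set.mem_singleton_iff, not_or] at hεγ
    obtain ⟨δ, hδ, hδV⟩ := hinf.exists_notMem_finite hfin
    have hδx : ∀ᶠ y in δ, x.1 y = y := by
      by_contra hne
      exact hδV ⟨hδ.1, hne⟩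
    have hγδ : γ ≠ δ := fun e => hδV (e ▸ hγ)
    have hγ'δ : map x.1 γ ≠ δ := fun e => hδV (e ▸ hγ')
    have hεδ : ε ≠ δ := fun e => hδV (e ▸ hε)
    -- With `γ`, `ε` moved and `δ` not moved by `x`, the commutator `⁅x, τ⁆` is supported on `γ`,
    -- `δ`, `map x.1 γ`. Conjugating by `ρ` replaces `δ` by the moved germ `ε`, giving `c`. Now `c⁻¹
    -- * x` is trivial on `γ` and moves no new germ, so the number of moved germs drops.
    obtain ⟨τ, t0, t1, t2, t3⟩ := exists_swap (S := S) hγ.1 hδ.1 hγδ (hVS γ hγ).2 hδ.2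
    obtain ⟨ρ, r0, r1, r2, r3⟩ := exists_swap (S := S) hδ.1 hε.1 hεδ.symm hδ.2 (hVS ε hε).2
    have hcM : ⁅x, τ⁆ ∈ M' := by
      rw [commutatorElement_def, mul_assoc, mul_assoc, ← mul_assoc τ]
      exact mul_mem hx (hM'.conj_mem _ (inv_mem hx) τ)
    have hcE : ⁅x, τ⁆ ∈ layOn S k {γ, δ, map x.1 γ} := by
      refine ⟨?_, fun F hF hFE => ?_⟩
      · rw [commutatorElement_def]
        exact mul_mem (mul_mem (mul_mem hxl t0) (inv_mem hxl)) (inv_mem t0)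
      · simp only [Set.mem_insert_iff, Set.mem_singleton_iff, not_or] at hFE
        rw [commutatorElement_def]
        refine fixed_mul (fixed_conj (t3 _ (isGerm_map x⁻¹ hF) ?_ ?_))
          (fixed_inv (t3 F hF hFE.1 hFE.2.1))
        · intro e
          exact hFE.2.2 (by rw [← e, map_map_inv])
        · intro e
          refine hFE.2.1 ?_
          rw [← map_map_inv x F, e, map_eq_self_of_fixed hδx]
    obtain ⟨y, hy, hyc⟩ := small _ hcM {γ, δ, map x.1 γ} (Set.toFinite _) (by
      rintro F (rfl | rfl | rfl)
      exacts [hVS _ hγ, hδ, hVS _ hγ']) (by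
        have h1 := Set.ncard_insert_le γ {δ, map x.1 γ}
        have h2 := Set.ncard_insert_le δ {map x.1 γ}
        rw [Set.ncard_singleton] at h2
        omega) hcE
    set c := ρ * ⁅x, τ⁆ * ρ⁻¹ with hc
    have hργ : ∀ᶠ y in γ, ρ.1 y = y := r3 γ hγ.1 hγδ (fun e => hεγ.1 e.symm)
    have hργ' : ∀ᶠ y in map x.1 γ, ρ.1 y = y :=
      r3 _ hγ'.1 hγ'δ (fun e => hεγ.2 e.symm)
    have hcl : c ∈ lay S (k + 1) := (lay_normal S (k + 1)).conj_mem _ hcE.1 ρ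
    have hcV : ∀ F, IsGerm k F → F ≠ γ → F ≠ map x.1 γ → F ≠ ε → ∀ᶠ y in F, c.1 y = y := by
      intro F hF h1 h2 h3
      refine fixed_conj (hcE.2 _ (isGerm_map ρ⁻¹ hF) ?_)
      simp only [Set.mem_insert_iff, Set.mem_singleton_iff, not_or]
      refine ⟨fun e => h1 ?_, fun e => h3 ?_, fun e => h2 ?_⟩
      · rw [← map_map_inv ρ F, e, map_eq_self_of_fixed hργ]
      · rw [← map_map_inv ρ F, e, r1]
      · rw [← map_map_inv ρ F, e, map_eq_self_of_fixed hργ']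
    have hcγ : ∀ᶠ y in γ, (c⁻¹ * x).1 y = y := by
      have h1 : ∀ᶠ y in γ, (τ * x * τ⁻¹).1 y = y := by
        refine fixed_conj ?_
        have : map (τ⁻¹).1 γ = δ := by rw [← t2, map_inv_map]
        rwa [this]
      filter_upwards [h1, hργ, eventually_map.1 (fixed_inv hργ')] with y h1 h2 h3
      have e : c⁻¹ * x = ρ * (τ * x * τ⁻¹) * x⁻¹ * ρ⁻¹ * x := by
        rw [hc, commutatorElement_def]
        group
      rw [e, mul_apply, mul_apply, h3, mul_apply, mul_apply, inv_apply_self, h1, h2]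
    have hx1 : c⁻¹ * x ∈ M' := mul_mem (inv_mem (hM'.conj_mem _ hcM ρ)) hx
    have hsub : {F | IsGerm k F ∧ ¬ ∀ᶠ y in F, (c⁻¹ * x).1 y = y} ⊆ V \ {γ} := by
      rintro F ⟨hF, hne⟩
      refine ⟨⟨hF, fun hxF => hne (fixed_mul (fixed_inv (hcV F hF ?_ ?_ ?_)) hxF)⟩, ?_⟩
      · rintro rfl
        exact hne hcγ
      · rintro rfl
        exact hγ'.2 hxF
      · rintro rfl
        exact hε.2 hxF
      · rintro rfl
        exact hne hcγ
    obtain ⟨z, hz, hzx⟩ := ih hx1 (mul_mem (inv_mem hcl) hxl) (by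
      have h1 := Set.ncard_le_ncard hsub hfin.sdiff
      have h2 := Set.ncard_sdiff_singleton_lt_of_mem hγ hfin
      omega)
    refine ⟨ρ * y * ρ⁻¹ * z, mul_mem (hM.conj_mem y hy ρ) hz, ?_⟩
    have e : (ρ * y * ρ⁻¹ * z)⁻¹ * x = z⁻¹ * (ρ * (y⁻¹ * ⁅x, τ⁆) * ρ⁻¹) * z⁻¹⁻¹ *
        (z⁻¹ * (c⁻¹ * x)) := by
      rw [hc]
      group
    rw [e]
    exact mul_mem ((lay_normal S k).conj_mem _ ((lay_normal S k).conj_mem _ hyc ρ) z⁻¹) hzx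

theorem exists_test_germs (hS : IsOrthohedral S) (k : ℕ) :
    ∃ E : Set (Filter (Fin N → ℤ)), E.Finite ∧ (∀ F ∈ E, IsGerm k F) ∧
      ∀ M M' : Subgroup (pei S), M.Normal → M'.Normal →
        (∀ x ∈ M', x ∈ layOn S k E → ∃ y ∈ M, y⁻¹ * x ∈ lay S k) →
        ∀ x ∈ M', x ∈ lay S (k + 1) → ∃ y ∈ M, y⁻¹ * x ∈ lay S k := by
  by_cases hfin : {F | IsGerm k F ∧ S ∈ F}.Finite
  · refine ⟨_, hfin, fun F hF => hF.1, fun M M' _ _ h x hx hxl => h x hx ⟨hxl, ?_⟩⟩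
    intro F hF hFE
    exact fixed_of_not_mem hS x hF fun h => hFE ⟨hF, h⟩
  · obtain ⟨E, hE, hEf, hc⟩ := Set.Infinite.exists_subset_ncard_eq hfin 3
    exact ⟨E, hEf, fun F hF => (hE hF).1, fun M M' hM hM' h x hx hxl =>
      layer_reduction hfin hS hE hc.ge hM hM' h hx hxl⟩

/-- The translation vectors on the germs in `E` of the elements of `M`. -/
def translationVectors (k : ℕ) (E : Set (Filter (Fin N → ℤ))) (hE : ∀ F ∈ E, IsGerm k F)
    (M : Subgroup (pei S)) : AddSubgroup (E → Fin N → ℤ) where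
  carrier := {v | ∃ h ∈ M, h ∈ layOn S k E ∧ h ∈ trl S k ∧
    ∀ F : E, ∀ᶠ x in F.1, h.1 x = x + v F}
  add_mem' := by
    rintro v w ⟨g, g1, g2, g3, g4⟩ ⟨h, h1, h2, h3, h4⟩
    refine ⟨h * g, mul_mem h1 g1, mul_mem h2 g2, mul_mem h3 g3, fun F => ?_⟩
    filter_upwards [g4 F, eventually_of_map_eq (g3.2 F.1 (hE F.1 F.2)).1 (h4 F)] with x hx hy
    rw [mul_apply, hy, hx, Pi.add_apply, add_assoc]
  zero_mem' := ⟨1, one_mem _, one_mem _, one_mem _, fun _ => Eventually.of_forall fun _ =>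
    (add_zero _).symm⟩
  neg_mem' := by
    rintro v ⟨g, g1, g2, g3, g4⟩
    refine ⟨g⁻¹, inv_mem g1, inv_mem g2, inv_mem g3, fun F => ?_⟩
    filter_upwards [eventually_of_map_eq ((inv_mem g3 : g⁻¹ ∈ trl S k).2 F.1 (hE F.1 F.2)).1
      (g4 F)] with x hx
    rw [apply_inv_self] at hx
    rw [Pi.neg_apply, eq_add_neg_iff_add_eq]
    exact hx.symm

/-- On the test germs, modulo `lay S k`, a normal subgroup leaves two traces: a subset of a finite
set of permutation data and a subgroup of a finitely generated free Abelian group. Both traces of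
the chain stabilise. Equal data then reduce `x` to a translation, and equal lattices provide an
element of `f n` with the same vectors. -/
theorem layer_chain (hS : IsOrthohedral S) (k : ℕ) (f : ℕ →o Subgroup (pei S))
    (hf : ∀ n, (f n).Normal) :
    ∃ n, ∀ m ≥ n, ∀ x ∈ f m, x ∈ lay S (k + 1) → ∃ y ∈ f n, y⁻¹ * x ∈ lay S k := by
  obtain ⟨E, hEf, hE, hred⟩ := exists_test_germs hS k
  have : Finite E := hEf
  obtain ⟨d, hd⟩ := exists_data (S := S) k hE
  let I₁ : ℕ →o Set (E → E × Equiv.Perm (Fin N) × (Fin N → ℤˣ)) :=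
    ⟨fun n => {r | ∃ g : layOn S k E, g.1 ∈ f n ∧ d g = r}, fun m n hmn r ⟨g, hg, hr⟩ =>
      ⟨g, f.mono hmn hg, hr⟩⟩
  let I₂ : ℕ →o Submodule ℤ (E → Fin N → ℤ) :=
    ⟨fun n => (translationVectors k E hE (f n)).toIntSubmodule, fun m n hmn v ⟨g, hg, hr⟩ =>
      ⟨g, f.mono hmn hg, hr⟩⟩
  obtain ⟨n₁, h₁⟩ := WellFoundedGT.monotone_chain_condition I₁
  obtain ⟨n₂, h₂⟩ := WellFoundedGT.monotone_chain_condition I₂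
  refine ⟨max n₁ n₂, fun m hm => hred _ _ (hf _) (hf _) fun x hx hxE => ?_⟩
  have e₁ : I₁ (max n₁ n₂) = I₁ m :=
    (h₁ _ (le_max_left _ _)).symm.trans (h₁ m ((le_max_left _ _).trans hm))
  have e₂ : I₂ (max n₁ n₂) = I₂ m :=
    (h₂ _ (le_max_right _ _)).symm.trans (h₂ m ((le_max_right _ _).trans hm))
  obtain ⟨g, hg, hgx⟩ : d ⟨x, hxE⟩ ∈ I₁ (max n₁ n₂) := by
    rw [e₁]
    exact ⟨⟨x, hxE⟩, hx, rfl⟩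
  have ht := hd g ⟨x, hxE⟩ hgx
  have hl : g.1⁻¹ * x ∈ layOn S k E := mul_mem (inv_mem g.2) hxE
  choose v hv using fun F : E => (ht.2 F.1 (hE F.1 F.2)).2
  obtain ⟨h, h1, h2, h3, h4⟩ : v ∈ I₂ (max n₁ n₂) := by
    rw [e₂]
    exact ⟨g.1⁻¹ * x, mul_mem (inv_mem (f.mono hm hg)) hx, hl, ht, hv⟩
  refine ⟨g.1 * h, mul_mem hg h1, ?_⟩
  have e : (g.1 * h)⁻¹ * x = h⁻¹ * (g.1⁻¹ * x) := by group
  rw [e]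
  have hl' : h⁻¹ * (g.1⁻¹ * x) ∈ layOn S k E := mul_mem (inv_mem h2) hl
  refine mem_lay_of_succ hl'.1 fun F hF => ?_
  by_cases hFE : F ∈ E
  · filter_upwards [hv ⟨F, hFE⟩, h4 ⟨F, hFE⟩] with z hz hz'
    rw [mul_apply, hz, ← hz', inv_apply_self]
  · exact hl'.2 F hF hFE

theorem wellFoundedGT_normal (hS : IsOrthohedral S) :
    WellFoundedGT {H : Subgroup (pei S) // H.Normal} := by
  rw [wellFoundedGT_iff_monotone_chain_condition]
  intro f
  let f' : ℕ →o Subgroup (pei S) := ⟨fun n => (f n).1, fun m n hmn => f.mono hmn⟩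
  choose n hn using fun k => layer_chain hS k f' fun n => (f n).2
  refine ⟨(Finset.range (N + 1)).sup n, fun m hm => ?_⟩
  -- All layers are stable from the maximum of the indices on. The induction climbs from the trivial
  -- `lay S 0`, dividing out an element of the stable term at each layer, up to `lay S (N + 1) = ⊤`.
  have key : ∀ k ≤ N + 1, ∀ x ∈ f' m, x ∈ lay S k → x ∈ f' ((Finset.range (N + 1)).sup n) := by
    intro k
    induction k with
    | zero =>
      intro _ x _ hx
      rw [lay_zero, Subgroup.mem_bot] at hx
      rw [hx]
      exact one_mem _
    | succ k ih =>
      intro hk x hx hxl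
      have hle : n k ≤ (Finset.range (N + 1)).sup n :=
        Finset.le_sup (f := n) (Finset.mem_range.2 hk)
      obtain ⟨y, hy, hyx⟩ := hn k m (hle.trans hm) x hx hxl
      have h1 := ih (by omega) (y⁻¹ * x) (mul_mem (inv_mem (f'.mono (hle.trans hm) hy)) hx) hyx
      have h2 := mul_mem (f'.mono hle hy) h1
      rwa [mul_inv_cancel_left] at h2
  refine Subtype.ext (le_antisymm (f'.mono hm) fun x hx => key (N + 1) le_rfl x hx ?_)
  rw [lay_top]
  trivial

/-! ### Permutations of parallel slices -/

/-- Permutations of `ℤ` act on the `l`-th coordinate of the points of a cylinder `C`. -/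
noncomputable def cylinderHom (l : Fin N) (C : Set (Fin N → ℤ))
    (hC : ∀ x z, Function.update x l z ∈ C ↔ x ∈ C) :
    Equiv.Perm ℤ →* Equiv.Perm (Fin N → ℤ) := by
  classical
  exact
  { toFun := fun p =>
      { toFun := fun x => if x ∈ C then Function.update x l (p (x l)) else x
        invFun := fun x => if x ∈ C then Function.update x l (p.symm (x l)) else x
        left_inv := fun x => by by_cases h : x ∈ C <;> simp [h, hC]
        right_inv := fun x => by by_cases h : x ∈ C <;> simp [h, hC] }
    map_one' := by ext x; simp
    map_mul' := fun p q => by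
      ext x
      by_cases h : x ∈ C <;> simp [h, hC] }

theorem cylinderHom_apply_of_mem {l : Fin N} {C : Set (Fin N → ℤ)}
    (hC : ∀ x z, Function.update x l z ∈ C ↔ x ∈ C) (p : Equiv.Perm ℤ) {x : Fin N → ℤ}
    (hx : x ∈ C) : cylinderHom l C hC p x = Function.update x l (p (x l)) := by
  simp [cylinderHom, hx]

theorem cylinderHom_apply_of_notMem {l : Fin N} {C : Set (Fin N → ℤ)}
    (hC : ∀ x z, Function.update x l z ∈ C ↔ x ∈ C) (p : Equiv.Perm ℤ) {x : Fin N → ℤ}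
    (hx : x ∉ C) : cylinderHom l C hC p x = x := by
  simp [cylinderHom, hx]

/-- Choose the grid beyond the finite support of `p`. On a cell in `C` the `l`-th coordinate is
either constant, and then merely replaced by a constant, or outside the support of `p`. -/
theorem isPei_cylinderHom {l : Fin N} {C : Set (Fin N → ℤ)}
    (hC : ∀ x z, Function.update x l z ∈ C ↔ x ∈ C) {B : ℕ} (hB : CellUnion B C)
    {p : Equiv.Perm ℤ} (hp : {z | p z ≠ z}.Finite) : IsPei (cylinderHom l C hC p) := by
  obtain ⟨D, hD⟩ := exists_uniform_grid (p := fun z D => z.natAbs ≤ D) hp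
    (fun _ _ _ h hz => hz.trans h) (fun z _ => ⟨z.natAbs, le_rfl⟩)
  refine isPei_of_cells (max B D) fun x y hy z hz => ?_
  have hyC := hB.mono (le_max_left B D) y x hy
  have hzC := hB.mono (le_max_left B D) z x hz
  by_cases hx : x ∈ C
  · rw [cylinderHom_apply_of_mem hC p (hyC.2 hx), cylinderHom_apply_of_mem hC p (hzC.2 hx)]
    have hy' : max (-((max B D : ℕ) + 1 : ℤ)) (min ((max B D : ℕ) + 1 : ℤ) (y l)) =
      max (-((max B D : ℕ) + 1 : ℤ)) (min ((max B D : ℕ) + 1 : ℤ) (x l)) := congrFun hy l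
    have hz' : max (-((max B D : ℕ) + 1 : ℤ)) (min ((max B D : ℕ) + 1 : ℤ) (z l)) =
      max (-((max B D : ℕ) + 1 : ℤ)) (min ((max B D : ℕ) + 1 : ℤ) (x l)) := congrFun hz l
    have hDm : D ≤ max B D := le_max_right B D
    generalize max B D = K at hy' hz' hDm
    by_cases hxl : (x l).natAbs ≤ K
    · have ey : y l = x l := by omega
      have ez : z l = x l := by omega
      simp only [sqDist]
      refine Finset.sum_congr rfl fun i _ => ?_
      by_cases hi : i = l
      · subst hi
        simp [ey, ez]
      · simp [hi]
    · have fix : ∀ w : ℤ, ¬ w.natAbs ≤ D → p w = w := by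
        intro w hw
        by_contra hne
        exact hw (hD w hne)
      rw [fix (y l) (by omega), fix (z l) (by omega), Function.update_eq_self,
        Function.update_eq_self]
  · rw [cylinderHom_apply_of_notMem hC p (mt hyC.1 hx),
      cylinderHom_apply_of_notMem hC p (mt hzC.1 hx)]

/-! ### Displaced perfect subgroups -/

theorem conj_mem_of_normal {G : Type*} [Group G] {H K : Subgroup G}
    (hN : (H.subgroupOf K).Normal) (hle : H ≤ K) {k h : G} (hk : k ∈ K) (hh : h ∈ H) :
    k * h * k⁻¹ ∈ H := by
  have := hN.conj_mem ⟨h, hle hh⟩ hh ⟨k, hk⟩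
  simpa [Subgroup.mem_subgroupOf] using this

/-- A perfect subgroup that is displaced by `h` is contained in every subnormal subgroup
containing `h`. -/
theorem le_of_displaced {G : Type*} [Group G] {P : Subgroup G} (hP : ⁅P, P⁆ = P) {h : G}
    (hd : ∀ α ∈ P, ∀ β ∈ P, Commute (h * α * h⁻¹) β) {K : Subgroup G} (hK : K.IsSubnormal)
    (hh : h ∈ K) : P ≤ K := by
  induction hK with
  | top => exact le_top
  | step H K hle _ hN ih =>
    have hPK := ih (hle hh)
    rw [← hP, Subgroup.commutator_le]
    intro α hα β hβ
    have comm : ∀ k ∈ K, ∀ x ∈ H, ⁅x, k⁆ ∈ H := fun k hk x hx => by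
      have e : ⁅x, k⁆ = x * (k * x⁻¹ * k⁻¹) := by rw [commutatorElement_def]; group
      rw [e]
      exact mul_mem hx (conj_mem_of_normal hN hle hk (inv_mem hx))
    have h1 := comm β (hPK hβ) _ (comm α⁻¹ (hPK (inv_mem hα)) h hh)
    have c1 := hd α⁻¹ (inv_mem hα) α hα
    have c2 := hd α⁻¹ (inv_mem hα) β hβ
    -- The displaced factor `h * α⁻¹ * h⁻¹` commutes with `α` and `β` and drops out. The left side
    -- lies in `H` since `h` does and `α`, `β` lie in `K`; such commutators generate `P`.
    have e : ⁅⁅h, α⁻¹⁆, β⁆ = ⁅α, β⁆ := by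
      have e1 : ⁅h, α⁻¹⁆ = (h * α⁻¹ * h⁻¹) * α := by rw [commutatorElement_def, inv_inv]
      rw [e1]
      generalize h * α⁻¹ * h⁻¹ = γ at c1 c2
      calc ⁅γ * α, β⁆ = γ * (α * β * α⁻¹) * γ⁻¹ * β⁻¹ := by rw [commutatorElement_def]; group
        _ = (α * β * α⁻¹) * γ * γ⁻¹ * β⁻¹ := by
          rw [((c1.mul_right c2).mul_right c1.inv_right).eq]
        _ = ⁅α, β⁆ := by rw [commutatorElement_def]; group
    rwa [e] at h1

/-- If `h` acts on an orthant of rank `k + 1` in `S` as a nontrivial translation along the orthant,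
then all subnormal subgroups that contain `h` contain a common perfect subgroup of rank `k`. -/
theorem exists_perfect_displaced {k : ℕ} {a v : Fin N → ℤ} {σ : Fin N → SignType}
    (hσ : srk σ = k + 1) (hS : orthant a σ ⊆ S) {h : pei S}
    (hh : ∀ x ∈ orthant a σ, h.1 x = x + v) {l : Fin N} (hl : σ l ≠ 0) (hv : v l ≠ 0) :
    ∃ P : Subgroup (pei S), ⁅P, P⁆ = P ∧ ¬ P ≤ lay S k ∧
      ∀ K : Subgroup (pei S), K.IsSubnormal → h ∈ K → P ≤ K := by
  classical
  let C : Set (Fin N → ℤ) := {x | Function.update x l (a l) ∈ orthant a σ}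
  have hC : ∀ x z, Function.update x l z ∈ C ↔ x ∈ C := fun x z => by simp [C]
  obtain ⟨B, hB⟩ := cellUnion_orthant a σ
  have hCB : CellUnion B C := fun x y hxy => hB _ _ (by
    funext i
    have := congrFun hxy i
    simp only [clamp_apply] at this ⊢
    by_cases hi : i = l
    · subst hi; simp
    · simpa [hi] using this)
  have hσl : (σ l : ℤ) ≠ 0 := by
    revert hl; generalize σ l = s; revert s; decide
  -- Five slices, so that the alternating group is perfect. The spacing `|v l| + 1` exceeds `|v l|`,
  -- and `v l ≠ 0`, so the translation takes no slice to a slice.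
  let ι : Fin 5 ↪ ℤ := ⟨fun i => a l + σ l * (((v l).natAbs + 1) * (i : ℕ)), fun i j hij => by
    have h1 := mul_left_cancel₀ hσl (add_left_cancel hij)
    have h2 : (((v l).natAbs : ℤ) + 1) ≠ 0 := by omega
    have h3 := mul_left_cancel₀ h2 h1
    exact Fin.ext (by exact_mod_cast h3)⟩
  have hι : ∀ i, ι i = a l + σ l * (((v l).natAbs + 1) * (i : ℕ)) := fun i => rfl
  have hCι : ∀ x ∈ C, x l ∈ Set.range ι → x ∈ orthant a σ := by
    rintro x hx ⟨i, hi⟩ j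
    by_cases hj : j = l
    · subst hj
      exact ⟨((v j).natAbs + 1) * (i : ℕ), by rw [← hi, hι]; push_cast; ring⟩
    · have := hx j
      rwa [Function.update_of_ne hj] at this
  let Θ₀ : Equiv.Perm (Fin 5) →* Equiv.Perm (Fin N → ℤ) :=
    (cylinderHom l C hC).comp (Equiv.Perm.viaEmbeddingHom ι)
  have hvia : ∀ p : Equiv.Perm (Fin 5), ∀ z, z ∉ Set.range ι →
      Equiv.Perm.viaEmbeddingHom ι p z = z := fun p z hz =>
    Equiv.Perm.viaEmbedding_apply_of_notMem p ι z hz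
  have hΘ : ∀ p x, ¬ (x ∈ C ∧ x l ∈ Set.range ι) → Θ₀ p x = x := by
    intro p x hx
    by_cases hxC : x ∈ C
    · have hxl : x l ∉ Set.range ι := fun h => hx ⟨hxC, h⟩
      change cylinderHom l C hC (Equiv.Perm.viaEmbeddingHom ι p) x = x
      rw [cylinderHom_apply_of_mem hC _ hxC, hvia p _ hxl, Function.update_eq_self]
    · exact cylinderHom_apply_of_notMem hC _ hxC
  let Θ : Equiv.Perm (Fin 5) →* pei S := Θ₀.codRestrict (pei S) fun p =>
    ⟨isPei_cylinderHom hC hCB ((Set.finite_range ι).subset fun z hz => by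
      by_contra h
      exact hz (hvia p z h)), fun x hx => hΘ p x fun hx' => hx (hS (hCι x hx'.1 hx'.2))⟩
  have hdisp : ∀ x, x ∈ C ∧ x l ∈ Set.range ι → ¬ (h.1 x ∈ C ∧ h.1 x l ∈ Set.range ι) := by
    rintro x ⟨hxC, hxl⟩ ⟨-, j, hj⟩
    have e := hh x (hCι x hxC hxl)
    obtain ⟨i, hi⟩ := hxl
    rw [e, Pi.add_apply, ← hi, hι, hι] at hj
    have hvl : v l = (σ l : ℤ) * ((((v l).natAbs : ℤ) + 1) * ((j : ℕ) - (i : ℕ) : ℤ)) := by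
      linarith
    have habs := congrArg Int.natAbs hvl
    rw [Int.natAbs_mul, Int.natAbs_mul] at habs
    have h1 : (((v l).natAbs : ℤ) + 1).natAbs = (v l).natAbs + 1 := by omega
    rw [h1] at habs
    have h2 : (v l).natAbs ≠ 0 := by omega
    have h3 : ((σ l : ℤ)).natAbs = 1 := by
      revert hl; generalize σ l = s; revert s; decide
    rw [h3, one_mul] at habs
    rcases Nat.eq_zero_or_pos ((j : ℕ) - (i : ℕ) : ℤ).natAbs with h0 | h0
    · rw [h0, mul_zero] at habs
      exact h2 habs
    · have := Nat.le_mul_of_pos_right ((v l).natAbs + 1) h0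
      omega
  refine ⟨(alternatingGroup (Fin 5)).map Θ, ?_, ?_, ?_⟩
  · rw [← Subgroup.map_commutator, commutator_alternatingGroup_eq_self (by simp)]
  · intro hle
    -- This 3-cycle moves the slice 0. That slice is the face of the orthant through `a` without the
    -- direction `l`, hence of rank `k`.
    let p : Equiv.Perm (Fin 5) := Equiv.swap 0 1 * Equiv.swap 1 2
    have hp : p ∈ alternatingGroup (Fin 5) := by
      rw [Equiv.Perm.mem_alternatingGroup]
      decide
    have hΘp := hle (Subgroup.mem_map_of_mem Θ hp)
    let τ : Fin N → SignType := Function.update σ l 0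
    have hτ : srk τ = k := by
      have : (Finset.univ.filter fun i => τ i ≠ 0)
          = (Finset.univ.filter fun i => σ i ≠ 0).erase l := by
        ext i
        by_cases hi : i = l
        · subst hi; simp [τ]
        · simp [τ, hi]
      unfold srk at hσ ⊢
      rw [this, Finset.card_erase_of_mem (by simpa using hl), hσ]
      simp
    obtain ⟨b, hb, hfix⟩ := eventually_germ.1 (hΘp k le_rfl (germ a τ) ⟨a, τ, hτ, rfl⟩)
    have hfix := hfix b (self_mem_orthant b τ)
    have hbl : b l = ι 0 := by
      rw [(mem_orthant.1 hb l).1 (by simp [τ]), hι]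
      simp
    have hbC : b ∈ C := fun i => by
      by_cases hi : i = l
      · subst hi; exact ⟨0, by simp⟩
      · have := hb i
        simpa [τ, hi] using this
    have h1 : Function.update b l (Equiv.Perm.viaEmbeddingHom ι p (b l)) = b := by
      rw [← cylinderHom_apply_of_mem hC _ hbC]
      exact hfix
    have h2 := congrFun h1 l
    rw [Function.update_self, hbl] at h2
    have h3 : ι (p 0) = ι 0 := (Equiv.Perm.viaEmbedding_apply p ι 0).symm.trans h2
    have h4 := ι.injective h3
    revert h4
    decide
  · intro K hK hhK
    refine le_of_displaced (h := h) ?_ ?_ hK hhK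
    · rw [← Subgroup.map_commutator, commutator_alternatingGroup_eq_self (by simp)]
    · rintro _ ⟨p, -, rfl⟩ _ ⟨q, -, rfl⟩
      refine Subtype.ext (Equiv.Perm.Disjoint.commute fun x => ?_)
      by_cases hx : x ∈ C ∧ x l ∈ Set.range ι
      · left
        have hx' : ¬ ((h⁻¹).1 x ∈ C ∧ (h⁻¹).1 x l ∈ Set.range ι) := fun hy =>
          hdisp _ hy (by rwa [apply_inv_self])
        have e : (Θ p).1 ((h⁻¹).1 x) = (h⁻¹).1 x := hΘ p _ hx'
        change h.1 ((Θ p).1 ((h⁻¹).1 x)) = x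
        rw [e, apply_inv_self]
      · right
        exact hΘ q x hx

/-! ### Subnormal subgroups of given rank -/

theorem germ_inj {a b : Fin N → ℤ} {σ τ : Fin N → SignType} (h : germ a σ = germ b τ) :
    σ = τ ∧ ∀ i, σ i = 0 → a i = b i := by
  have h1 := of_orthant_mem_germ (h ▸ orthant_mem_germ a σ : orthant a σ ∈ germ b τ)
  have h2 := of_orthant_mem_germ (h ▸ orthant_mem_germ b τ : orthant b τ ∈ germ a σ)
  refine ⟨?_, fun i hi => (h1.2 i hi).symm⟩
  funext i
  by_cases hi : τ i = 0
  · by_contra hne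
    rw [hi] at hne
    exact hne ((h2.1 i hne).symm.trans hi)
  · exact h1.1 i hi

/-- Take a germ `F` moved by `g`. If `g` sends `F` elsewhere, translate `F` and its image in
opposite senses. If `g` keeps `F` but permutes its directions, translate along the difference of two
directions that correspond under `g`. Otherwise `g` is a translation on `F`, which `g ^ d ∈ lay S r`
forces to be trivial. -/
theorem exists_noncommuting_translation (hS : IsOrthohedral S) {r : ℕ} (hr : r ≠ 0) {g : pei S}
    (hg : g ∈ lay S (r + 1)) (hg' : g ∉ lay S r) {d : ℕ} (hd : d ≠ 0) (hgd : g ^ d ∈ lay S r) :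
    ∃ t ∈ trl S r, ⁅t, g⁆ ∉ lay S r := by
  obtain ⟨F, hF, hgF⟩ := exists_moved_germ hg hg'
  have hSF : S ∈ F := by
    by_contra h
    exact hgF (fixed_of_not_mem hS g hF h)
  obtain ⟨π, ε, c, hc⟩ := pei_exists_aff g hF
  by_cases hmap : map g.1 F = F
  · obtain ⟨a, σ, hσ, rfl⟩ := hF
    have hgerm := hmap
    rw [map_congr hc, map_aff_germ] at hgerm
    obtain ⟨h1, h2⟩ := germ_inj hgerm
    by_cases hπ : ∃ j, σ j ≠ 0 ∧ π j ≠ j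
    · obtain ⟨j, hj, hj'⟩ := hπ
      have hσj : σ (π j) ≠ 0 := fun h0 => hj (by
        rw [← h1]
        exact (sgnMap_eq_zero π ε σ j).2 h0)
      obtain ⟨t, ht, htx⟩ := exists_translation_single hSF hj' hσj hj
      rw [hσ] at ht
      refine ⟨t, ht, fun hmem => ?_⟩
      have hcomm := commute_of_commutator_mem hmem ⟨a, σ, hσ, rfl⟩
      have htF := (ht.2 _ ⟨a, σ, hσ, rfl⟩).1
      obtain ⟨x, e1, e2, e3, e4, e5⟩ := (hcomm.and (hc.and (htx.and
        ((eventually_of_map_eq hmap htx).and (eventually_of_map_eq htF hc))))).exists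
      rw [e4, e5, e3, aff_add, ← e2] at e1
      have e6 := congrFun (add_left_cancel e1) j
      have e7 := congrFun (lin_vec π ε σ) j
      rw [h1] at e7
      simp only [lin, vec, Pi.sub_apply, Pi.single_eq_same, Pi.single_eq_of_ne hj',
        Pi.single_eq_of_ne hj'.symm, sub_zero, zero_sub] at e6 e7
      rw [e7] at e6
      revert e6 hj
      generalize σ j = s
      revert s
      decide
    · push Not at hπ
      exfalso
      let v : Fin N → ℤ := fun j => if σ j = 0 then 0 else c j
      have htr : ∀ᶠ x in germ a σ, g.1 x = x + v := by
        filter_upwards [hc, orthant_mem_germ a σ] with x hx hxa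
        rw [hx]
        have hA : aff π ε c x ∈ orthant (aff π ε c a) σ := by
          rw [← h1, ← image_aff_orthant]
          exact Set.mem_image_of_mem _ hxa
        funext j
        by_cases hj : σ j = 0
        · rw [(mem_orthant.1 hA j).1 hj, h2 j (by rw [h1, hj]), Pi.add_apply,
            (mem_orthant.1 hxa j).1 hj]
          simp [v, hj]
        · have e := congrFun (lin_vec π ε σ) j
          rw [h1] at e
          simp only [lin, vec, hπ j hj] at e
          have hσj : (σ j : ℤ) ≠ 0 := by
            revert hj; generalize σ j = s; revert s; decide
          have e' : (ε j : ℤ) = 1 := mul_right_cancel₀ hσj (e.trans (one_mul _).symm)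
          simp [aff_apply, hπ j hj, e', v, hj]
      have h0 := translation_eq_zero (pow_translation hmap htr d) (hgd r le_rfl _ ⟨a, σ, hσ, rfl⟩)
      have hv0 : v = 0 := (smul_eq_zero.1 h0).resolve_left hd
      rw [hv0] at htr
      exact hgF (by simpa using htr)
  · have hF' := isGerm_map g hF
    obtain ⟨t, ht, a, σ, b, τ, hσ, hτ, rfl, hb, t1, t2⟩ :=
      exists_translation_pair hF hF' (Ne.symm hmap) hSF (mem_map_germ g hSF)
    refine ⟨t, ht, fun hmem => ?_⟩
    have hcomm := commute_of_commutator_mem hmem hF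
    have hgerm := hb
    rw [map_congr hc, map_aff_germ] at hgerm
    obtain ⟨h1, -⟩ := germ_inj hgerm
    obtain ⟨x, e1, e2, e3, e4, e5⟩ := (hcomm.and (hc.and (t1.and
      ((eventually_map.1 t2).and (eventually_of_map_eq (ht.2 _ hF).1 hc))))).exists
    have hneg : lin π ε (-vec σ) = - vec τ := by
      have := lin_smul π ε (-1) (vec σ)
      rwa [neg_one_smul, neg_one_smul, lin_vec, h1] at this
    rw [e4, e5, e3, sub_eq_add_neg, aff_add, ← e2, hneg] at e1
    have e6 := add_left_cancel e1
    have : srk τ = 0 := by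
      unfold srk
      rw [Finset.card_eq_zero, Finset.filter_eq_empty_iff]
      intro i _
      have := congrFun e6 i
      simp only [vec, Pi.neg_apply] at this
      revert this
      generalize τ i = s
      revert s
      decide
    omega

/-- A subnormal subgroup with an element of positive rank `r` contains an element that acts on the
germs of rank `r` as a nontrivial translation. -/
theorem exists_mem_trl (hS : IsOrthohedral S) {r : ℕ} (hr : r ≠ 0) {g : pei S}
    (hg : g ∈ lay S (r + 1)) (hg' : g ∉ lay S r) {K : Subgroup (pei S)} (hK : K.IsSubnormal)
    (hgK : g ∈ K) : ∃ t ∈ K, t ∈ trl S r ∧ t ∉ lay S r := by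
  obtain ⟨d, hd, hgd⟩ := exists_pow_mem_trl hg
  by_cases hgl : g ^ d ∈ lay S r
  -- Commuting with `g` modulo `lay S r` is the property that survives the descent along the
  -- subnormal series in negated form: at each step `t` is replaced by `⁅t, g⁆`, which lies in the
  -- next smaller term.
  · suffices h : ∃ t ∈ K, t ∈ trl S r ∧ ⁅t, g⁆ ∉ lay S r by
      obtain ⟨t, h1, h2, h3⟩ := h
      refine ⟨t, h1, h2, fun hl => h3 ?_⟩
      exact Subgroup.commutator_le_left _ _
        (Subgroup.commutator_mem_commutator hl (Subgroup.mem_top g))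
    clear hgd
    induction hK with
    | top =>
      obtain ⟨t, h1, h2⟩ := exists_noncommuting_translation hS hr hg hg' hd hgl
      exact ⟨t, trivial, h1, h2⟩
    | step H K hle _ hN ih =>
      obtain ⟨t, h1, h2, h3⟩ := ih (hle hgK)
      have hx : ⁅t, g⁆ ∈ trl S r := Subgroup.commutator_le_left _ _
        (Subgroup.commutator_mem_commutator h2 (Subgroup.mem_top g))
      refine ⟨⁅t, g⁆, ?_, hx, fun hl => h3 ?_⟩
      · rw [commutatorElement_def]
        exact mul_mem (conj_mem_of_normal hN hle h1 hgK) (inv_mem hgK)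
      · refine mem_lay_of_pow_mem hx hd ?_
        have q : ∀ y : pei S, y ∈ lay S r ↔ (QuotientGroup.mk' (lay S r)) y = 1 :=
          fun y => (QuotientGroup.eq_one_iff y).symm
        rw [q, map_commutatorElement, commutatorElement_eq_one_iff_commute] at hl
        rw [q, map_pow] at hgl
        rw [q, map_pow]
        set φ := QuotientGroup.mk' (lay S r)
        -- The product is a conjugate of `φ g`, so its `d`-th power is trivial. If `⁅t, g⁆` commuted
        -- with `g` in the quotient, it would be torsion there, hence trivial, as translations are
        -- torsion-free.
        have e : (φ ⁅t, g⁆ * φ g) ^ d = 1 := by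
          have : φ ⁅t, g⁆ * φ g = φ t * φ g * (φ t)⁻¹ := by
            rw [← map_mul, ← map_inv, ← map_mul, ← map_mul, commutatorElement_def,
              inv_mul_cancel_right]
          rw [this, conj_pow, hgl, mul_one, mul_inv_cancel]
        rwa [hl.mul_pow, hgl, mul_one] at e
  · exact ⟨g ^ d, pow_mem hgK d, hgd, hgl⟩

/-! ### Abelian-by-torsion series and their length -/

/-- `K` is an extension of `H` by an Abelian-by-torsion group. -/
def AbelianByTorsionStep {G : Type*} [Group G] (H K : Subgroup G) : Prop :=
  H ≤ K ∧ (H.subgroupOf K).Normal ∧ ∃ A ≤ K, (A.subgroupOf K).Normal ∧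
    (∀ x ∈ A, ∀ y ∈ A, ⁅x, y⁆ ∈ H) ∧ ∀ x ∈ K, ∃ n : ℕ, n ≠ 0 ∧ x ^ n ∈ A

/-- A power of a translation in `K` lies in `A` and displaces a perfect group `P` of rank one less.
As `A` is subnormal, `P ≤ A`, whence `P = ⁅P, P⁆ ≤ H`: passing from `K` to `H` costs at most one
rank. -/
theorem AbelianByTorsionStep.not_le_lay (hS : IsOrthohedral S) {r : ℕ} {H K : Subgroup (pei S)}
    (h : AbelianByTorsionStep H K) (hK : K.IsSubnormal) (hr : ¬ K ≤ lay S (r + 1)) :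
    ¬ H ≤ lay S r := by
  classical
  obtain ⟨-, -, A, hAK, hAn, hAc, hAt⟩ := h
  obtain ⟨g, hgK, hg⟩ := SetLike.not_le_iff_exists.1 hr
  have hex : ∃ m, g ∈ lay S m := ⟨N + 1, by rw [lay_top]; trivial⟩
  -- The exact rank of `g` is `q + 1 + r`; its positivity is what `exists_mem_trl` requires. The
  -- group `P` then escapes `lay S (q + r)`, which contains `lay S r`.
  obtain ⟨q, hq⟩ : ∃ q, Nat.find hex = q + 1 + r + 1 := by
    have : ¬ Nat.find hex ≤ r + 1 := fun h => hg (lay_mono h (Nat.find_spec hex))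
    exact ⟨Nat.find hex - (r + 2), by omega⟩
  have hq1 : g ∈ lay S (q + 1 + r + 1) := hq ▸ Nat.find_spec hex
  have hq2 : g ∉ lay S (q + 1 + r) := Nat.find_min hex (by omega)
  obtain ⟨t, htK, ht, htl⟩ := exists_mem_trl hS (by omega) hq1 hq2 hK hgK
  obtain ⟨n, hn, htA⟩ := hAt t htK
  have ht' := pow_mem ht n
  have htl' : t ^ n ∉ lay S (q + 1 + r) := fun h => htl (mem_lay_of_pow_mem ht hn h)
  obtain ⟨F, hF, hgF⟩ := exists_moved_germ ht'.1 htl'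
  have hSF : S ∈ F := by
    by_contra h
    exact hgF (fixed_of_not_mem hS _ hF h)
  obtain ⟨hmap, v, hv⟩ := ht'.2 F hF
  obtain ⟨a, σ, hσ, rfl⟩ := hF
  obtain ⟨l, hl⟩ : ∃ l, v l ≠ 0 := by
    by_contra! h0
    have : v = 0 := funext h0
    rw [this] at hv
    exact hgF (by simpa using hv)
  have hσl : σ l ≠ 0 := by
    intro h0
    have ho : ∀ᶠ x in germ a σ, x ∈ orthant a σ := orthant_mem_germ a σ
    obtain ⟨x, h1, h2, h3⟩ := (hv.and (ho.and (eventually_of_map_eq hmap ho))).exists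
    have e1 := (mem_orthant.1 h2 l).1 h0
    have e2 := (mem_orthant.1 h3 l).1 h0
    rw [h1, Pi.add_apply, e1] at e2
    omega
  obtain ⟨b, hb, hbv⟩ := eventually_germ.1 (hv.and hSF)
  obtain ⟨P, hP, hPl, hPK⟩ := exists_perfect_displaced (k := q + r) (by omega)
    (fun x hx => (hbv x hx).2) (fun x hx => (hbv x hx).1) hσl hl
  have hPA := hPK A (.step A K hAK hK hAn) htA
  intro hH
  refine hPl (le_trans ?_ (hH.trans (lay_mono (by omega))))
  rw [← hP, Subgroup.commutator_le]
  exact fun x hx y hy => hAc x (hPA hx) y (hPA hy)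

theorem lt_length_of_not_le_lay (hS : IsOrthohedral S) {m : ℕ} {H : ℕ → Subgroup (pei S)}
    (h0 : H 0 = ⊥) (hstep : ∀ i < m, AbelianByTorsionStep (H i) (H (i + 1)))
    (hm : (H m).IsSubnormal) {r : ℕ} (hr : ¬ H m ≤ lay S r) : r < m := by
  induction m generalizing r with
  | zero => exact absurd (h0 ▸ bot_le) hr
  | succ m ih =>
    cases r with
    | zero => omega
    | succ r =>
      have hs := hstep m (Nat.lt_succ_self m)
      have := ih (fun i hi => hstep i (by omega)) (.step _ _ hs.1 hm hs.2.1)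
        (hs.not_le_lay hS hm hr)
      omega

/-! ### The series of rank groups -/

theorem abelianByTorsionStep_lay (S : Set (Fin N → ℤ)) (k : ℕ) :
    AbelianByTorsionStep (lay S k) (lay S (k + 1)) :=
  ⟨lay_mono (Nat.le_succ k), inferInstance, trl S k, trl_le S k, inferInstance,
    fun _ hx _ hy => commutator_trl_mem hx hy, fun _ hx => exists_pow_mem_trl hx⟩

/-- A criterion inside the ambient group: finitely generated subgroups of `K` must meet only
finitely many cosets of `A`. -/
theorem isAbelianByLocallyFinite_quotient {G : Type*} [Group G] {H A K : Subgroup G}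
    [(H.subgroupOf K).Normal] (hAK : A ≤ K) (hA : (A.subgroupOf K).Normal)
    (hc : ∀ x ∈ A, ∀ y ∈ A, ⁅x, y⁆ ∈ H)
    (hfin : ∀ T : Set G, T.Finite → T ⊆ K → ∃ R : Set G, R.Finite ∧
      ∀ x ∈ Subgroup.closure T, ∃ y ∈ R, y⁻¹ * x ∈ A) :
    IsAbelianByLocallyFinite (K ⧸ H.subgroupOf K) := by
  classical
  let φ : K →* K ⧸ H.subgroupOf K := QuotientGroup.mk' _
  have hφ : Function.Surjective φ := QuotientGroup.mk'_surjective _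
  let A' : Subgroup (K ⧸ H.subgroupOf K) := (A.subgroupOf K).map φ
  have hA' : A'.Normal := hA.map φ hφ
  refine ⟨A', hA', ?_, ?_⟩
  · rintro _ ⟨x, hx, rfl⟩ _ ⟨y, hy, rfl⟩
    have h1 : ⁅x, y⁆ ∈ H.subgroupOf K := hc x hx y hy
    have h2 : φ ⁅x, y⁆ = 1 := (QuotientGroup.eq_one_iff _).2 h1
    rw [map_commutatorElement, commutatorElement_eq_one_iff_mul_comm] at h2
    exact h2
  · intro L hL
    let ψ : K →* (K ⧸ H.subgroupOf K) ⧸ A' := (QuotientGroup.mk' A').comp φ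
    have hψ : Function.Surjective ψ := (QuotientGroup.mk'_surjective A').comp hφ
    obtain ⟨T', rfl⟩ := hL
    choose s hs using hψ
    let T : Set K := s '' T'
    have hT : T.Finite := T'.finite_toSet.image s
    have hT' : ψ '' T = T' := by
      rw [Set.image_image]
      simp [hs]
    obtain ⟨R, hR, hRx⟩ := hfin (Subtype.val '' T) (hT.image _) (by
      rintro _ ⟨x, -, rfl⟩
      exact x.2)
    refine Set.Finite.subset ((hR.preimage Subtype.val_injective.injOn).image ψ) ?_
    rw [← hT', ← MonoidHom.map_closure]
    rintro _ ⟨x, hx, rfl⟩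
    have hx' : (x : G) ∈ Subgroup.closure (Subtype.val '' T) := by
      have := Subgroup.mem_map_of_mem K.subtype hx
      rwa [MonoidHom.map_closure] at this
    obtain ⟨y, hy, hyx⟩ := hRx x hx'
    have hyK : y ∈ K := by
      have := mul_mem x.2 (inv_mem (hAK hyx))
      simpa using this
    refine ⟨⟨y, hyK⟩, hy, ?_⟩
    have h1 : φ (⟨y, hyK⟩⁻¹ * x) ∈ A' := Subgroup.mem_map_of_mem φ hyx
    have h2 : ψ (⟨y, hyK⟩⁻¹ * x) = 1 := (QuotientGroup.eq_one_iff _).2 h1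
    rw [map_mul, map_inv, inv_mul_eq_one] at h2
    exact h2

/-- Locally finite groups are torsion, and torsion is all that the lower bound uses. -/
theorem IsPolySeries.abelianByTorsionStep {G : Type*} [Group G] {m : ℕ} {H : ℕ → Subgroup G}
    (h : IsPolySeries m H) {i : ℕ} (hi : i < m) : AbelianByTorsionStep (H i) (H (i + 1)) := by
  obtain ⟨hle, hN, A', hA', hab, hlf⟩ := h.2.2 i hi
  let φ : H (i + 1) →* H (i + 1) ⧸ (H i).subgroupOf (H (i + 1)) := QuotientGroup.mk' _
  have hsub : ((A'.comap φ).map (H (i + 1)).subtype).subgroupOf (H (i + 1)) = A'.comap φ :=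
    Subgroup.comap_map_eq_self_of_injective (Subgroup.subtype_injective _) _
  refine ⟨hle, hN, (A'.comap φ).map (H (i + 1)).subtype, ?_, ?_, ?_, ?_⟩
  · rintro _ ⟨x, -, rfl⟩
    exact x.2
  · rw [hsub]
    exact hA'.comap φ
  · rintro _ ⟨x, hx, rfl⟩ _ ⟨y, hy, rfl⟩
    have h1 : φ ⁅x, y⁆ = 1 := by
      rw [map_commutatorElement, commutatorElement_eq_one_iff_mul_comm]
      exact hab _ hx _ hy
    exact (QuotientGroup.eq_one_iff ⁅x, y⁆).1 h1
  · intro x hx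
    have hfin : Finite (Subgroup.zpowers (QuotientGroup.mk' A' (φ ⟨x, hx⟩))) :=
      hlf _ ⟨{QuotientGroup.mk' A' (φ ⟨x, hx⟩)}, by
        rw [Finset.coe_singleton, Subgroup.zpowers_eq_closure]⟩
    have ho : IsOfFinOrder (QuotientGroup.mk' A' (φ ⟨x, hx⟩)) := finite_zpowers.1 hfin
    obtain ⟨n, hn, e⟩ := isOfFinOrder_iff_pow_eq_one.1 ho
    refine ⟨n, hn.ne', (⟨x, hx⟩ : H (i + 1)) ^ n, ?_, rfl⟩
    rw [← map_pow, ← map_pow] at e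
    exact (QuotientGroup.eq_one_iff (φ ((⟨x, hx⟩ : H (i + 1)) ^ n))).1 e

theorem isPolySeries_lay {n : ℕ} (hn : lay S n = ⊤) : IsPolySeries n (lay S) :=
  ⟨lay_zero, hn, fun i _ => ⟨lay_mono (Nat.le_succ i), inferInstance,
    isAbelianByLocallyFinite_quotient (trl_le S i) inferInstance
      (fun _ hx _ hy => commutator_trl_mem hx hy) fun _ hT hTl => exists_finite_cosets i hT hTl⟩⟩

theorem lay_rk_succ (hS : IsOrthohedral S) : lay S (rk S + 1) = ⊤ := by
  rw [eq_top_iff]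
  intro g _ j hj F hF
  refine fixed_of_not_mem hS g hF fun h => ?_
  have := le_rk_of_mem_germ hF h
  omega

/-! ### Invariance under isomorphism -/

/-- The right side refers only to the group structure. One direction is the series of layers itself;
the other is the length bound applied to a normal, hence subnormal, top term. -/
theorem mem_lay_iff_exists_series (hS : IsOrthohedral S) {k : ℕ} {g : pei S} :
    g ∈ lay S k ↔ ∃ H : ℕ → Subgroup (pei S), H 0 = ⊥ ∧ (H k).Normal ∧ g ∈ H k ∧
      ∀ i < k, AbelianByTorsionStep (H i) (H (i + 1)) := by
  constructor
  · intro hg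
    exact ⟨lay S, lay_zero, inferInstance, hg, fun i _ => abelianByTorsionStep_lay S i⟩
  · rintro ⟨H, h0, hN, hg, hstep⟩
    by_contra hgl
    have hsub : (H k).IsSubnormal := .step _ ⊤ le_top .top inferInstance
    exact lt_irrefl k (lt_length_of_not_le_lay hS h0 hstep hsub fun hle => hgl (hle hg))

theorem AbelianByTorsionStep.map {G G' : Type*} [Group G] [Group G'] (φ : G ≃* G')
    {H K : Subgroup G} (h : AbelianByTorsionStep H K) :
    AbelianByTorsionStep (H.map φ.toMonoidHom) (K.map φ.toMonoidHom) := by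
  obtain ⟨hle, hN, A, hAK, hAN, hc, ht⟩ := h
  have key : ∀ B : Subgroup G, B ≤ K → (B.subgroupOf K).Normal →
      ((B.map φ.toMonoidHom).subgroupOf (K.map φ.toMonoidHom)).Normal := by
    intro B hB hBN
    rw [Subgroup.normal_subgroupOf_iff (Subgroup.map_mono hB)]
    rintro _ _ ⟨b, hb, rfl⟩ ⟨x, hx, rfl⟩
    exact ⟨x * b * x⁻¹, conj_mem_of_normal hBN hB hx hb, by simp⟩
  refine ⟨Subgroup.map_mono hle, key H hle hN, A.map φ.toMonoidHom, Subgroup.map_mono hAK,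
    key A hAK hAN, ?_, ?_⟩
  · rintro _ ⟨x, hx, rfl⟩ _ ⟨y, hy, rfl⟩
    exact ⟨⁅x, y⁆, hc x hx y hy, map_commutatorElement _ _ _⟩
  · rintro _ ⟨x, hx, rfl⟩
    obtain ⟨n, hn, hxn⟩ := ht x hx
    exact ⟨n, hn, x ^ n, hxn, map_pow _ _ _⟩

theorem map_mem_lay (hS : IsOrthohedral S) {M : ℕ} {T : Set (Fin M → ℤ)} (hT : IsOrthohedral T)
    (φ : pei S ≃* pei T) {k : ℕ} {g : pei S} (hg : g ∈ lay S k) : φ g ∈ lay T k := by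
  obtain ⟨H, h0, hN, hgH, hstep⟩ := (mem_lay_iff_exists_series hS).1 hg
  exact (mem_lay_iff_exists_series hT).2 ⟨fun i => (H i).map φ.toMonoidHom,
    by simp only [h0, Subgroup.map_bot], hN.map _ φ.surjective, Subgroup.mem_map_of_mem _ hgH,
    fun i hi => (hstep i hi).map φ⟩

theorem not_mem_lay_of_translation {k : ℕ} {g : pei S} {F : Filter (Fin N → ℤ)}
    (hF : IsGerm k F) {v : Fin N → ℤ} (hv : v ≠ 0) (h : ∀ᶠ x in F, g.1 x = x + v) :
    g ∉ lay S k := fun hg => by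
  have := hF.neBot
  exact hv (translation_eq_zero h (hg k le_rfl F hF))

theorem vec_ne_zero {σ : Fin N → SignType} (h : srk σ ≠ 0) : vec σ ≠ 0 := by
  intro h0
  refine h ?_
  unfold srk
  rw [Finset.card_eq_zero, Finset.filter_eq_empty_iff]
  intro i _
  have := congrFun h0 i
  simp only [vec, Pi.zero_apply] at this
  revert this
  generalize σ i = s
  revert s
  decide

/-! ### Properness of the top layer, and the rank as an invariant -/

/-- A germ of rank at least two admits a translation along the difference of two of its directions,
with no need of a second germ. -/
theorem lay_rk_ne_top_of_two_le (h : 2 ≤ rk S) (hne : S.Nonempty) : lay S (rk S) ≠ ⊤ := by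
  obtain ⟨F, hF, hSF⟩ := exists_germ_rk hne
  obtain ⟨a, σ, hσ, rfl⟩ := hF
  obtain ⟨i, hi, j, hj, hij⟩ := Finset.one_lt_card.1
    (show 1 < (Finset.univ.filter fun i => σ i ≠ 0).card by unfold srk at hσ; omega)
  have hi : σ i ≠ 0 := by simpa using hi
  have hj : σ j ≠ 0 := by simpa using hj
  obtain ⟨t, -, htx⟩ := exists_translation_single hSF hij hi hj
  intro htop
  refine not_mem_lay_of_translation ⟨a, σ, hσ, rfl⟩ ?_ htx (htop ▸ Subgroup.mem_top t)
  intro h0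
  have := congrFun h0 i
  simp only [Pi.sub_apply, Pi.single_eq_same, Pi.single_eq_of_ne hij, sub_zero,
    Pi.zero_apply] at this
  revert this hi
  generalize σ i = s
  revert s
  decide

theorem lay_ne_top_of_ne {k : ℕ} (hk : k ≠ 0) {F F' : Filter (Fin N → ℤ)} (hF : IsGerm k F)
    (hF' : IsGerm k F') (hne : F ≠ F') (hS : S ∈ F) (hS' : S ∈ F') : lay S k ≠ ⊤ := by
  obtain ⟨t, -, a, σ, b, τ, hσ, hτ, -, -, -, ht⟩ := exists_translation_pair hF hF' hne hS hS'
  intro htop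
  exact not_mem_lay_of_translation hF' (vec_ne_zero (hτ.trans_ne hk)) ht
    (htop ▸ Subgroup.mem_top t)

theorem Small.finite {X : Set (Fin N → ℤ)} (h : Small 1 X) : X.Finite := by
  obtain ⟨Λ, h1, h2, h3⟩ := h
  refine (h1.sUnion fun L hL => ?_).subset h3
  obtain ⟨j, hj, a, σ, hσ, rfl⟩ := h2 L hL
  have hσ0 : ∀ i, σ i = 0 := by
    have : (Finset.univ.filter fun i => σ i ≠ 0).card = 0 := by omega
    rw [Finset.card_eq_zero, Finset.filter_eq_empty_iff] at this
    intro i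
    simpa using this (Finset.mem_univ i)
  refine (Set.finite_singleton a).subset fun x hx => ?_
  exact funext fun i => (mem_orthant.1 hx i).1 (hσ0 i)

theorem finite_of_rk_eq_zero (hS : IsOrthohedral S) (h : rk S = 0) : S.Finite := by
  obtain ⟨B, hB⟩ := hS.cellUnion
  refine Small.finite (hB.small fun j hj F hF => ?_)
  refine (hB.mem_or_compl_mem hF).resolve_left fun hSF => ?_
  have := le_rk_of_mem_germ hF hSF
  omega

theorem finite_of_finite_pei [Finite (pei S)] : S.Finite := by
  rcases S.eq_empty_or_nonempty with rfl | ⟨x, hx⟩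
  · exact Set.finite_empty
  · refine (Set.finite_range fun g : pei S => g.1 x).subset fun y hy => ?_
    obtain ⟨g, hg⟩ := exists_apply_eq hx hy
    exact ⟨g, hg⟩

theorem finite_pei_of_finite (hS : S.Finite) : Finite (pei S) := by
  have : Finite S := hS
  have hmem : ∀ (g : pei S) (x : S), g.1 x.1 ∈ S := by
    intro g x
    by_contra h
    exact h (by rw [g.1.injective (g.2.2 _ h)]; exact x.2)
  refine Finite.of_injective (fun (g : pei S) (x : S) => (⟨g.1 x.1, hmem g x⟩ : S)) ?_
  intro g h hgh
  refine Subtype.ext (Equiv.ext fun x => ?_)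
  by_cases hx : x ∈ S
  · exact congrArg Subtype.val (congrFun hgh ⟨x, hx⟩)
  · rw [g.2.2 x hx, h.2.2 x hx]

theorem Small.of_finite {X : Set (Fin N → ℤ)} (h : X.Finite) : Small 1 X := by
  refine ⟨(fun x => {x}) '' X, h.image _, ?_, fun x hx => ⟨{x}, ⟨x, hx, rfl⟩, rfl⟩⟩
  rintro _ ⟨x, -, rfl⟩
  refine ⟨0, one_pos, x, 0, by simp, ?_⟩
  ext y
  rw [mem_orthant]
  simp [funext_iff]

theorem rk_eq_zero_iff (hS : IsOrthohedral S) : rk S = 0 ↔ Finite (pei S) := by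
  constructor
  · exact fun h => finite_pei_of_finite (finite_of_rk_eq_zero hS h)
  · intro h
    exact Nat.le_zero.1 (Small.of_finite finite_of_finite_pei).rk_le

/-- If `rk T < rk S`, then `lay T (rk S)` is everything, and so would be `lay S (rk S)` by
invariance. -/
theorem rk_le_of_mulEquiv (hS : IsOrthohedral S) {M : ℕ} {T : Set (Fin M → ℤ)}
    (hT : IsOrthohedral T) (φ : pei S ≃* pei T) (hne : S.Nonempty) (h : 2 ≤ rk S) :
    rk S ≤ rk T := by
  by_contra! hlt
  refine lay_rk_ne_top_of_two_le h hne ?_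
  rw [eq_top_iff]
  intro g _
  have h1 : φ g ∈ lay T (rk S) := lay_mono (by omega) (lay_rk_succ hT ▸ Subgroup.mem_top (φ g))
  simpa using map_mem_lay hT hS φ.symm h1

/-- The layers settle ranks from two on. Rank 0 is recognised by finiteness of the group, which
leaves rank 1. -/
theorem rk_eq_of_mulEquiv (hS : IsOrthohedral S) {M : ℕ} {T : Set (Fin M → ℤ)}
    (hT : IsOrthohedral T) (φ : pei S ≃* pei T) (hSne : S.Nonempty) (hTne : T.Nonempty) :
    rk S = rk T := by
  have h1 := rk_le_of_mulEquiv hS hT φ hSne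
  have h2 := rk_le_of_mulEquiv hT hS φ.symm hTne
  have h3 : rk S = 0 ↔ rk T = 0 := by
    rw [rk_eq_zero_iff hS, rk_eq_zero_iff hT]
    exact φ.toEquiv.finite_iff
  omega

theorem lay_rk_ne_top (hS : IsOrthohedral S) (hnt : S.Nontrivial)
    (hex : ¬ ∃ L, IsOrthantOfRank L 1 ∧ L ⊆ S ∧ (S \ L).Finite) : lay S (rk S) ≠ ⊤ := by
  rcases Nat.lt_or_ge (rk S) 2 with h2 | h2
  · rcases Nat.eq_zero_or_pos (rk S) with h0 | h0
    · rw [h0, lay_zero]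
      intro htop
      obtain ⟨x, hx, y, hy, hxy⟩ := hnt
      obtain ⟨g, hg⟩ := exists_apply_eq hx hy
      have : g = 1 := Subgroup.mem_bot.1 (htop ▸ Subgroup.mem_top g)
      rw [this] at hg
      exact hxy hg
    · have h1 : rk S = 1 := by omega
      obtain ⟨F, hF, hSF⟩ := exists_germ_rk hnt.nonempty
      rw [h1] at hF ⊢
      obtain ⟨a, σ, hσ, rfl⟩ := hF
      obtain ⟨b, hb, hbS⟩ := eventually_germ.1 hSF
      have hgb := germ_eq_of_mem hb
      by_contra htop
      refine hex ⟨orthant b σ, ⟨b, σ, hσ, rfl⟩, hbS, ?_⟩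
      obtain ⟨B, hB⟩ := hS.cellUnion
      obtain ⟨C, hC⟩ := cellUnion_orthant b σ
      have hcell := (hB.mono (le_max_left B C)).diff (hC.mono (le_max_right B C))
      refine Small.finite (hcell.small fun j hj F hF => ?_)
      rcases hB.mem_or_compl_mem hF with hSF' | hSF'
      · have hj1 : j = 1 := le_antisymm (h1 ▸ le_rk_of_mem_germ hF hSF') hj
        subst hj1
        by_cases hFF : germ a σ = F
        · rw [← hFF, ← hgb]
          exact mem_of_superset (orthant_mem_germ b σ) fun x hx hx' => hx'.2 hx
        · exact absurd htop (lay_ne_top_of_ne one_ne_zero ⟨a, σ, hσ, rfl⟩ hF hFF hSF hSF')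
      · exact mem_of_superset hSF' fun x hx hx' => hx hx'.1
  · exact lay_rk_ne_top_of_two_le h2 hnt.nonempty

theorem rk_lt_length (hS : IsOrthohedral S) (hnt : S.Nontrivial)
    (hex : ¬ ∃ L, IsOrthantOfRank L 1 ∧ L ⊆ S ∧ (S \ L).Finite) {m : ℕ}
    {H : ℕ → Subgroup (pei S)} (h : IsPolySeries m H) : rk S < m := by
  refine lt_length_of_not_le_lay hS h.1 (fun i hi => h.abelianByTorsionStep hi)
    (h.2.1 ▸ .top) fun hle => ?_
  rw [h.2.1] at hle
  exact lay_rk_ne_top hS hnt hex (top_le_iff.1 hle)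

end

end PEI

/-! ### The main theorem -/

theorem mainTheorem8 {N : ℕ} (S : Set (Fin N → ℤ)) (hS : PEI.IsOrthohedral S) :
    -- the maximal condition for normal subgroups
    WellFoundedGT {H : Subgroup (PEI.pei S) // H.Normal} ∧
    -- the rank groups are normal subgroups ...
    (∀ k : ℕ, ∃ H : Subgroup (PEI.pei S), H.Normal ∧ (H : Set (PEI.pei S)) = PEI.rankGroup S k) ∧
    -- ... and they, and the rank, are determined by the isomorphism type of the group
    (∀ {M : ℕ} (T : Set (Fin M → ℤ)), PEI.IsOrthohedral T → ∀ φ : PEI.pei S ≃* PEI.pei T,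
      (∀ k : ℕ, φ '' PEI.rankGroup S k = PEI.rankGroup T k) ∧
      (S.Nonempty → T.Nonempty → PEI.rk S = PEI.rk T)) ∧
    -- the poly-(Abelian-by-locally-finite) length is `rk S + 1`, both for series of normal
    -- subgroups and for subnormal series, unless `S` has at most one point or is the union
    -- of a rank-1 orthant and a finite set
    (S.Nontrivial → (¬ ∃ L, PEI.IsOrthantOfRank L 1 ∧ L ⊆ S ∧ (S \ L).Finite) →
      IsLeast {m : ℕ | ∃ H : ℕ → Subgroup (PEI.pei S),
        PEI.IsPolySeries m H ∧ ∀ i ≤ m, (H i).Normal} (PEI.rk S + 1) ∧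
      IsLeast {m : ℕ | ∃ H : ℕ → Subgroup (PEI.pei S), PEI.IsPolySeries m H}
        (PEI.rk S + 1)) := by
  refine ⟨PEI.wellFoundedGT_normal hS,
    fun k => ⟨PEI.lay S (k + 1), inferInstance, (PEI.rankGroup_eq_lay S k).symm⟩, ?_, ?_⟩
  · intro M T hT φ
    refine ⟨fun k => ?_, PEI.rk_eq_of_mulEquiv hS hT φ⟩
    rw [PEI.rankGroup_eq_lay, PEI.rankGroup_eq_lay]
    ext t
    constructor
    · rintro ⟨g, hg, rfl⟩
      exact PEI.map_mem_lay hS hT φ hg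
    · intro ht
      exact ⟨φ.symm t, PEI.map_mem_lay hT hS φ.symm ht, by simp⟩
  · intro hnt hex
    have hser := PEI.isPolySeries_lay (PEI.lay_rk_succ hS)
    refine ⟨⟨⟨_, hser, fun i _ => inferInstance⟩, ?_⟩, ⟨⟨_, hser⟩, ?_⟩⟩
    · rintro m ⟨H, h, -⟩
      exact PEI.rk_lt_length hS hnt hex h
    · rintro m ⟨H, h⟩
      exact PEI.rk_lt_length hS hnt hex h
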